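/- Let $N\ge 1$, $n=2N$, and let $a,c$ be real with $a<1$, $c\ne 0$. Put $\rho=ax+bt$, $b=a^2+(a-1)c^2$, and take the seed $q=-\bar r=c\,e^{i\rho}$ of the Chen–Lee–Liu derivative NLS equation $$ i r_t+r_{xx}+|r|^2r-i|r|^2r_x=0. \qquad (\ast)$$ For $\lambda\in\mathbb C\setminus\{0\}$ let $S(\lambda)=16\lambda^4+(16a-16+8c^2)\lambda^2-4c^2a+4+4c^2-8a+c^4+4a^2$ and $$\psi_1(\lambda)=D\,e^{i\left(\frac{\sqrt S}{4}x+\frac{\sqrt S}{8}(-4\lambda^2+2+c^2+2a)t-\frac{\rho}{2}\right)},$$ $$\psi_2(\lambda)=\frac{D\,(-i\sqrt S+4i\lambda^2-2i-ic^2+2ia)}{4\lambda c}\,e^{i\left(\frac{\sqrt S}{4}x+\frac{\sqrt S}{8}(-4\lambda^2+2+c^2+2a)t+\frac{\rho}{2}\right)},$$ where $D$ does not depend on $x,t$. Put $f(\lambda)=\psi_1(\lambda)+\overline{\psi_2(-\bar\lambda)}$, $g(\lambda)=\psi_2(\lambda)+\overline{\psi_1(-\bar\lambda)}$. For real $\varepsilon$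 near $0$ let $\lambda(\varepsilon)=\sqrt{\tfrac{1-a}{2}}+\tfrac{ic}{2}+\varepsilon^2$. At $\lambda(\varepsilon)$ the root $\sqrt S$ is either of the two analytic functions of $\varepsilon$ near $0$ whose square is $S(\lambda(\varepsilon))$; at $-\overline{\lambda(\varepsilon)}$ it is the complex conjugate of that value. Moreover $D=\exp\big(i\sqrt S\sum_{l=1}^{N-1}s_l\varepsilon^{2l}\big)$ at $\lambda(\varepsilon)$ and $D=\exp\big(i\sqrt S\sum_{l=1}^{N-1}s_l'\varepsilon^{2l}\big)$ at $-\overline{\lambda(\varepsilon)}$, with free parameters $s_l,s_l'\in\mathbb C$ ($D=1$ if they all vanish). Given numbers $\lambda_1,\dots,\lambda_n$, with $f_k=f(\lambda_k)$ and $g_k=g(\lambda_k)$, let $\Delta_n^1,\Delta_n^2,\Delta_n^3,\Delta_n^4$ be the $n\times n$ matrices whose $k$-th rows are $$(\lambda_k^{n-1}f_k,\lambda_k^{n-2}g_k,\lambda_k^{n-3}f_k,\dots,\lambda_kf_k,g_k),\qquad (\lambda_k^{n-1}g_k,\lambda_k^{n-2}f_k,\lambda_k^{n-3}g_k,\dots,\lambda_kg_k,f_k),$$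 $$(\lambda_k^{n}f_k,\lambda_k^{n-2}f_k,\lambda_k^{n-3}g_k,\dots,\lambda_kg_k,f_k),\qquad (\lambda_k^{n}g_k,\lambda_k^{n-2}g_k,\lambda_k^{n-3}f_k,\dots,\lambda_kf_k,g_k).$$ Let $\widehat\Delta_n^m$ ($m=1,2,3,4$) be the matrix whose $(i,j)$ entry is the $n_i$-th derivative with respect to $\varepsilon$ at $\varepsilon=0$ of the $(i,j)$ entry of $\Delta_n^m$ for $\lambda_{2k-1}=\lambda(\varepsilon)$, $\lambda_{2k}=-\overline{\lambda_{2k-1}}$ $(1\le k\le N)$; here $n_i=i$ for odd $i$ and $n_i=i-1$ for even $i$. Then $|\widehat\Delta_n^1|$ and $|\widehat\Delta_n^2|$ vanish at no $(x,t)\in\mathbb R^2$, and the $N$-th order rogue wave of $(\ast)$ is $$ r_{nr}=\frac{|\widehat\Delta_n^2|}{|\widehat\Delta_n^1|}\,r+2i\,\frac{|\widehat\Delta_n^3|}{|\widehat\Delta_n^1|},\qquad\text{and equivalently}\qquad q_{nr}=-\overline{r_{nr}}=\frac{|\widehat\Delta_n^1|}{|\widehat\Delta_n^2|}\,q-2i\,\frac{|\widehat\Delta_n^4|}{|\widehat\Delta_n^2|}.$$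 That is: (1) for every $(x,t)$, $r_{nr}$ is the limit, as $(\varepsilon_1,\dots,\varepsilon_N)\to0$ through real vectors with $\varepsilon_k\ne0$ and pairwise distinct $\varepsilon_k^2$, of the $n$-fold Darboux transform $r_n=\frac{|\Delta_n^2|}{|\Delta_n^1|}r+2i\frac{|\Delta_n^3|}{|\Delta_n^1|}$ of the seed with $\lambda_{2k-1}=\lambda(\varepsilon_k)$, $\lambda_{2k}=-\overline{\lambda_{2k-1}}$; (2) $r_{nr}$ is a smooth solution of $(\ast)$ on $\mathbb R^2$; (3) $r_{nr}=\frac{P(x,t)}{Q(x,t)}e^{-i\rho}$ with complex polynomials $P,Q$, where $Q$ has no zero on $\mathbb R^2$; (4) $|r_{nr}(x,t)|\to|c|$ as $(x,t)\to\infty$ in $\mathbb R^2$. -/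

import Mathlib

open Complex Filter Topology
open scoped ComplexConjugate ContDiff

noncomputable section

namespace CLL

/-- Smooth solutions on the whole `(x,t)`-plane of
`i r_t + r_xx + |r|² r - i |r|² r_x = 0`. -/
def IsSolution (r : ℝ → ℝ → ℂ) : Prop :=
  ContDiff ℝ ∞ (fun p : ℝ × ℝ => r p.1 p.2) ∧
  ∀ x t : ℝ,
    I * deriv (fun τ => r x τ) t + iteratedDeriv 2 (fun y => r y t) x
      + (‖r x t‖ : ℂ) ^ 2 * r x t
      - I * (‖r x t‖ : ℂ) ^ 2 * deriv (fun y => r y t) x = 0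

/-! ### The plane-wave seed and its eigenfunctions -/

/-- The phase `ρ = a x + b t` with `b = a² + (a - 1) c²`. -/
def phase (a c x t : ℝ) : ℝ := a * x + (a ^ 2 + (a - 1) * c ^ 2) * t

/-- The seed `q = c exp(i ρ)`. -/
def seedQ (a c x t : ℝ) : ℂ := c * exp (I * phase a c x t)

/-- The seed `r = -q̄`. -/
def seedR (a c x t : ℝ) : ℂ := -conj (seedQ a c x t)

/-- The discriminant `S(λ)`. -/
def S (a c : ℝ) (l : ℂ) : ℂ :=
  16 * l ^ 4 + (16 * a - 16 + 8 * c ^ 2) * l ^ 2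
    - 4 * c ^ 2 * a + 4 + 4 * c ^ 2 - 8 * a + c ^ 4 + 4 * a ^ 2

/-- First component of the eigenfunction `ψ` at spectral parameter `l`, with constant factor `D`;
`w` is the chosen value of `√S(l)`. -/
def psi₁ (a c : ℝ) (D w l : ℂ) (x t : ℝ) : ℂ :=
  D * exp (I * (w / 4 * x + w / 8 * (-4 * l ^ 2 + 2 + c ^ 2 + 2 * a) * t - phase a c x t / 2))

/-- Second component of the eigenfunction `ψ`. -/
def psi₂ (a c : ℝ) (D w l : ℂ) (x t : ℝ) : ℂ :=
  D * (-I * w + 4 * I * l ^ 2 - 2 * I - I * c ^ 2 + 2 * I * a)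
    * exp (I * (w / 4 * x + w / 8 * (-4 * l ^ 2 + 2 + c ^ 2 + 2 * a) * t + phase a c x t / 2))
    / (4 * l * c)

/-! ### The spectral data -/

/-- `√((1-a)/2) + i c / 2 + ε²`. -/
def lamOdd (a c ε : ℝ) : ℂ := (Real.sqrt ((1 - a) / 2) : ℂ) + I * c / 2 + (ε : ℂ) ^ 2

/-- The factor `D = exp(i √S ∑_{l=1}^{N-1} s_l ε^{2l})`, with `w` the value of `√S`. -/
def factorD (N : ℕ) (s : ℕ → ℂ) (w : ℂ) (ε : ℝ) : ℂ :=
  exp (I * w * ∑ l ∈ Finset.Icc 1 (N - 1), s l * (ε : ℂ) ^ (2 * l))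

/-- The parameters of the construction: the real constants `a`, `c` of the seed, the free complex
parameters `s`, `s'` (used at `λ` and at `-λ̄` respectively), and a choice `root ε` of the square
root of `S` at `lamOdd a c ε`. -/
structure Data where
  N : ℕ
  a : ℝ
  c : ℝ
  s : ℕ → ℂ
  s' : ℕ → ℂ
  root : ℝ → ℂ

namespace Data

variable (d : Data)

/-- `ψ` at `λ = lamOdd a c ε`. -/
def psiAt₁ (ε x t : ℝ) : ℂ :=
  psi₁ d.a d.c (factorD d.N d.s (d.root ε) ε) (d.root ε) (lamOdd d.a d.c ε) x t

/-- `ψ` at `λ = lamOdd a c ε`. -/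
def psiAt₂ (ε x t : ℝ) : ℂ :=
  psi₂ d.a d.c (factorD d.N d.s (d.root ε) ε) (d.root ε) (lamOdd d.a d.c ε) x t

/-- `ψ` at `-λ̄`, where the square root of `S(-λ̄) = conj (S(λ))` is `conj (√S(λ))`. -/
def psiNeg₁ (ε x t : ℝ) : ℂ :=
  psi₁ d.a d.c (factorD d.N d.s' (conj (d.root ε)) ε) (conj (d.root ε))
    (-conj (lamOdd d.a d.c ε)) x t

/-- `ψ` at `-λ̄`. -/
def psiNeg₂ (ε x t : ℝ) : ℂ :=
  psi₂ d.a d.c (factorD d.N d.s' (conj (d.root ε)) ε) (conj (d.root ε))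
    (-conj (lamOdd d.a d.c ε)) x t

/-- The parameter `ε_k` belonging to the pair of (zero-based) indices `2k`, `2k+1`. -/
def epsOf (e : Fin d.N → ℝ) (m : Fin (2 * d.N)) : ℝ := e ⟨m.1 / 2, by have := m.2; omega⟩

/-- The eigenvalues `λ_{2k-1} = lamOdd a c ε_k`, `λ_{2k} = -λ̄_{2k-1}`
(the zero-based index `m` stands for `λ_{m+1}`). -/
def lam (e : Fin d.N → ℝ) (m : Fin (2 * d.N)) : ℂ :=
  if Even m.1 then lamOdd d.a d.c (d.epsOf e m) else -conj (lamOdd d.a d.c (d.epsOf e m))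

/-- First components `f_k` of `Φ(λ) = (ψ₁(λ) + conj ψ₂(-λ̄), ψ₂(λ) + conj ψ₁(-λ̄))`
at `λ = λ_k`. -/
def f (x t : ℝ) (e : Fin d.N → ℝ) (m : Fin (2 * d.N)) : ℂ :=
  if Even m.1 then d.psiAt₁ (d.epsOf e m) x t + conj (d.psiNeg₂ (d.epsOf e m) x t)
  else d.psiNeg₁ (d.epsOf e m) x t + conj (d.psiAt₂ (d.epsOf e m) x t)

/-- Second components `g_k` of `Φ` at `λ = λ_k`. -/
def g (x t : ℝ) (e : Fin d.N → ℝ) (m : Fin (2 * d.N)) : ℂ :=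
  if Even m.1 then d.psiAt₂ (d.epsOf e m) x t + conj (d.psiNeg₁ (d.epsOf e m) x t)
  else d.psiNeg₂ (d.epsOf e m) x t + conj (d.psiAt₁ (d.epsOf e m) x t)

end Data

/-! ### The determinants -/

/-- Rows `(λ^{n-1} f, λ^{n-2} g, λ^{n-3} f, …, λ f, g)` (for even `n`). -/
def Delta₁ {n : ℕ} (lam f g : Fin n → ℂ) : Matrix (Fin n) (Fin n) ℂ :=
  Matrix.of fun k j => lam k ^ (n - 1 - j.1) * (if Even j.1 then f k else g k)

/-- Rows `(λ^{n-1} g, λ^{n-2} f, λ^{n-3} g, …, λ g, f)` (for even `n`). -/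
def Delta₂ {n : ℕ} (lam f g : Fin n → ℂ) : Matrix (Fin n) (Fin n) ℂ := Delta₁ lam g f

/-- Rows `(λ^n f, λ^{n-2} f, λ^{n-3} g, λ^{n-4} f, …, λ g, f)` (for even `n`). -/
def Delta₃ {n : ℕ} (lam f g : Fin n → ℂ) : Matrix (Fin n) (Fin n) ℂ :=
  Matrix.of fun k j =>
    if j.1 = 0 then lam k ^ n * f k
    else lam k ^ (n - 1 - j.1) * (if Even j.1 then g k else f k)

/-- Rows `(λ^n g, λ^{n-2} g, λ^{n-3} f, λ^{n-4} g, …, λ f, g)` (for even `n`). -/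
def Delta₄ {n : ℕ} (lam f g : Fin n → ℂ) : Matrix (Fin n) (Fin n) ℂ := Delta₃ lam g f

/-- `n_i = i` for odd `i` and `n_i = i - 1` for even `i`. -/
def order (i : ℕ) : ℕ := if Odd i then i else i - 1

/-- The matrix whose `(i,j)` entry is the `n_i`-th derivative at `ε = 0` of the `(i,j)` entry of
`M ε` (rows are numbered from `1` in `n_i`). -/
def hat {n : ℕ} (M : ℝ → Matrix (Fin n) (Fin n) ℂ) : Matrix (Fin n) (Fin n) ℂ :=
  Matrix.of fun i j => iteratedDeriv (order (i.1 + 1)) (fun ε => M ε i j) 0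

namespace Data

variable (d : Data)

/-- The `2N`-fold Darboux transform of the seed with eigenvalues built from `ε_1, …, ε_N`. -/
def breather (e : Fin d.N → ℝ) (x t : ℝ) : ℂ :=
  (Delta₂ (d.lam e) (d.f x t e) (d.g x t e)).det / (Delta₁ (d.lam e) (d.f x t e) (d.g x t e)).det
      * seedR d.a d.c x t
    + 2 * I * ((Delta₃ (d.lam e) (d.f x t e) (d.g x t e)).det
      / (Delta₁ (d.lam e) (d.f x t e) (d.g x t e)).det)

/-- `Δ̂¹`, where all `ε_k` are equal to `ε` before differentiation. -/
def hatDelta₁ (x t : ℝ) : Matrix (Fin (2 * d.N)) (Fin (2 * d.N)) ℂ :=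
  hat fun ε => Delta₁ (d.lam fun _ => ε) (d.f x t fun _ => ε) (d.g x t fun _ => ε)

/-- `Δ̂²`. -/
def hatDelta₂ (x t : ℝ) : Matrix (Fin (2 * d.N)) (Fin (2 * d.N)) ℂ :=
  hat fun ε => Delta₂ (d.lam fun _ => ε) (d.f x t fun _ => ε) (d.g x t fun _ => ε)

/-- `Δ̂³`. -/
def hatDelta₃ (x t : ℝ) : Matrix (Fin (2 * d.N)) (Fin (2 * d.N)) ℂ :=
  hat fun ε => Delta₃ (d.lam fun _ => ε) (d.f x t fun _ => ε) (d.g x t fun _ => ε)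

/-- `Δ̂⁴`. -/
def hatDelta₄ (x t : ℝ) : Matrix (Fin (2 * d.N)) (Fin (2 * d.N)) ℂ :=
  hat fun ε => Delta₄ (d.lam fun _ => ε) (d.f x t fun _ => ε) (d.g x t fun _ => ε)

/-- `u` is the `N`-th order rogue wave with these parameters: the limit of the `2N`-fold Darboux
transforms of the seed as the pairwise distinct eigenvalues `λ_1, λ_3, …, λ_{2N-1}` coalesce at
`√((1-a)/2) + i c / 2`, which is a smooth solution of the equation, is a rational function of
`(x,t)` times the carrier `exp(-i ρ)`, and is localized in space and time on the background of
height `|c|`. -/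
structure IsRogueWave (u : ℝ → ℝ → ℂ) : Prop where
  limit : ∀ x t : ℝ, Tendsto (fun e : Fin d.N → ℝ => d.breather e x t)
    (𝓝[{e | (∀ k, e k ≠ 0) ∧ Function.Injective fun k => e k ^ 2}] 0) (𝓝 (u x t))
  solution : IsSolution u
  rational : ∃ P Q : MvPolynomial (Fin 2) ℂ, ∀ x t : ℝ,
    MvPolynomial.eval ![(x : ℂ), (t : ℂ)] Q ≠ 0 ∧
    u x t = MvPolynomial.eval ![(x : ℂ), (t : ℂ)] P / MvPolynomial.eval ![(x : ℂ), (t : ℂ)] Q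
      * exp (-I * phase d.a d.c x t)
  localized : Tendsto (fun p : ℝ × ℝ => ‖u p.1 p.2‖) (cocompact (ℝ × ℝ)) (𝓝 |d.c|)

end Data

end CLL

end

/-! ### Conjugation-symmetric polynomial forms -/

/-! All four determinants come from one `2N × (2N+1)` matrix whose column `j` is `λ ^ (2N-j) f` for
even `j` and `λ ^ (2N-j) g` for odd `j`. Its signed maximal minors form a kernel vector `y` with
`y_0 = |Δ²|`, `y_1 = -|Δ³|`, and last entry `|Δ¹|` times the product of the eigenvalues
(`mulVec_minorVec`, `minorVec_hatExt_last`). The whole proof works with `y` instead of with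
determinants.

Nonvanishing. Write `∑ y_j λ^(2N-j) = A(λ²) + λ B(λ²)`. The data at `-λ̄` are the conjugates of the
data at `λ` with `f` and `g` exchanged, so the two kernel equations of a pair read `A f + λ B g = 0`
and `Ā g - λ B̄ f = 0`. Eliminating `(f, g)` shows that `A Ā + X B B̄` vanishes at `λ²`. This real
polynomial has degree at most `2N` and top coefficient `|y_0|²`, and it vanishes at the conjugate
points as well. Hence it is `|y_0|²` times a fixed product, and if `y_0 = 0` it is zero, so that
positivity on `X > 0` gives `A = B = 0` (`herm_eq_zero`, `eq_zero_of_dvd_herm`). Thus the kernel is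
a line on which `y_0` does not vanish, and `|Δ²| ≠ 0`; `|Δ¹|` is its conjugate.

Confluence. Near the branch point `√S` is `ε` times a unit, and `f`, `g` are a common factor of
exact order `ε` times functions of `z = ε²`, up to order `2N+1` (`fE_eq_trig`, `hasJet_fE_gE`).
Vanishing of the odd derivatives of order below `2N` therefore means divisibility of a jet by `z^N`,
and the elimination argument applies with multiplicity (`pow_dvd_herm`). The Darboux transforms
converge because limits of the normalized discrete kernel vectors satisfy the confluent conditions,
by Rolle's theorem applied to the zeros `± ε_k`, and the confluent kernel is a line
(`tendsto_breather`).

The equation. The jets solve the Lax pair of the seed modulo `z^N`. Differentiating the kernel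
conditions shows that the first row of `T' + T U - U₁ T`, with `T` the Darboux matrix, satisfies the
same conditions, hence is a multiple `τ` of the first row of `T`. Comparing the top and the constant
coefficients with the relations `|y_0| = 1` and `y_last = κ ȳ_0` gives `τ = 0`
(`IsDressing.rows_fst`, `IsDressing.rows_snd`). The leading coefficients of the resulting system
yield the differential equation (`pde_algebra`).

Infinity. The constant coefficient `η` of the phase jet tends to infinity with `(x, t)`. After the
rescaling `z ↦ z / η²` the kernel conditions approach a Padé problem for `sin √z / √z` and `cos √z`,
which is nondegenerate by the recurrence of Bessel functions. It follows that `∑ (-1)^j y_j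
λ^(2N-j)`, without its carrier, acquires zeros at `± λ₀`, `± λ̄₀` of multiplicities `⌈N/2⌉` and
`⌊N/2⌋`. Vieta's formula then gives the limit of `y_1 / y_0`, and with it `|r| → |c|`
(`coeff_eq_zero_of_tendsto`, `gauge_limit`). -/

namespace CLL

section PolynomialKernel

open Polynomial

/-- Coefficientwise complex conjugation of polynomials. -/
noncomputable def cj : ℂ[X] →+* ℂ[X] := mapRingHom (starRingEnd ℂ)

@[simp] lemma cj_coeff (p : ℂ[X]) (n : ℕ) : (cj p).coeff n = conj (p.coeff n) := by
  simp [cj]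

@[simp] lemma cj_cj (p : ℂ[X]) : cj (cj p) = p := by
  ext n; simp

@[simp] lemma cj_X : cj X = X := by simp [cj]

@[simp] lemma cj_C (z : ℂ) : cj (C z) = C (conj z) := by simp [cj]

lemma cj_eval (p : ℂ[X]) (z : ℂ) : (cj p).eval (conj z) = conj (p.eval z) := by
  simp [cj, eval_map, eval₂_at_apply]

lemma cj_eval_ofReal (p : ℂ[X]) (x : ℝ) : (cj p).eval (x : ℂ) = conj (p.eval (x : ℂ)) := by
  rw [← cj_eval, conj_ofReal]

@[simp] lemma cj_natDegree (p : ℂ[X]) : (cj p).natDegree = p.natDegree := by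
  simp [cj]

/-- The real polynomial `A Ā + X B B̄`. -/
noncomputable def herm (A B : ℂ[X]) : ℂ[X] := A * cj A + X * B * cj B

lemma herm_eval_ofReal (A B : ℂ[X]) (x : ℝ) :
    (herm A B).eval (x : ℂ) =
      ((‖A.eval (x : ℂ)‖ ^ 2 + x * ‖B.eval (x : ℂ)‖ ^ 2 : ℝ) : ℂ) := by
  simp only [herm, eval_add, eval_mul, eval_X, cj_eval_ofReal]
  push_cast
  rw [← Complex.mul_conj', ← Complex.mul_conj']
  ring

lemma cj_herm (A B : ℂ[X]) : cj (herm A B) = herm A B := by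
  simp only [herm, map_add, map_mul, cj_cj, cj_X]; ring

/-- At a positive real point both summands are nonnegative, so both vanish there, and a polynomial
with infinitely many zeros is zero. This positivity is the source of all nonvanishing statements
below. -/
lemma herm_eq_zero {A B : ℂ[X]} (h : herm A B = 0) : A = 0 ∧ B = 0 := by
  have key : ∀ x : ℝ, 0 < x → A.eval (x : ℂ) = 0 ∧ B.eval (x : ℂ) = 0 := by
    intro x hx
    have := herm_eval_ofReal A B x
    rw [h, eval_zero] at this
    have h2 : ‖A.eval (x : ℂ)‖ ^ 2 + x * ‖B.eval (x : ℂ)‖ ^ 2 = 0 := by exact_mod_cast this.symm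
    have h3 : 0 ≤ x * ‖B.eval (x : ℂ)‖ ^ 2 := by positivity
    have h4 : 0 ≤ ‖A.eval (x : ℂ)‖ ^ 2 := by positivity
    have h5 : ‖A.eval (x : ℂ)‖ ^ 2 = 0 := by linarith
    have h6 : x * ‖B.eval (x : ℂ)‖ ^ 2 = 0 := by linarith
    constructor
    · simpa using h5
    · simpa [hx.ne'] using h6
  have inf : Set.Infinite ((fun x : ℝ => (x : ℂ)) '' Set.Ioi 0) :=
    (Set.Ioi_infinite (0 : ℝ)).image (Complex.ofReal_injective.injOn)
  constructor
  · refine eq_zero_of_infinite_isRoot A (inf.mono ?_)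
    rintro _ ⟨x, hx, rfl⟩
    exact (key x hx).1
  · refine eq_zero_of_infinite_isRoot B (inf.mono ?_)
    rintro _ ⟨x, hx, rfl⟩
    exact (key x hx).2

lemma herm_natDegree_le {N : ℕ} {A B : ℂ[X]} (hA : A.natDegree ≤ N) (hB : B.degree < N) :
    (herm A B).natDegree ≤ 2 * N := by
  unfold herm
  refine (natDegree_add_le _ _).trans (max_le ?_ ?_)
  · refine natDegree_mul_le.trans ?_
    simp; omega
  · by_cases h0 : B = 0
    · simp [h0]
    have := (natDegree_lt_iff_degree_lt h0).2 hB
    refine natDegree_mul_le.trans ?_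
    have h2 : (X * B).natDegree ≤ 1 + B.natDegree := natDegree_mul_le.trans (by simp)
    simp; omega

lemma herm_coeff_top {N : ℕ} {A B : ℂ[X]} (hA : A.natDegree ≤ N) (hB : B.degree < N) :
    (herm A B).coeff (2 * N) = A.coeff N * conj (A.coeff N) := by
  unfold herm
  rw [coeff_add, two_mul, coeff_mul_add_eq_of_natDegree_le hA (by simpa using hA), cj_coeff]
  by_cases h0 : B = 0
  · simp [h0]
  have := (natDegree_lt_iff_degree_lt h0).2 hB
  have h2 : (X * B).natDegree ≤ 1 + B.natDegree := natDegree_mul_le.trans (by simp)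
  rw [coeff_eq_zero_of_natDegree_lt (p := X * B * cj B), add_zero]
  refine natDegree_mul_le.trans_lt ?_
  simp; omega

/-- The form is fixed by `cj`, so it is divisible by `cj Ω` along with `Ω`. Coprimality gives
divisibility by the product, whose degree `2 * N` already exhausts the degree of the form, and the
remaining constant is read off at the top. -/
lemma herm_eq_of_dvd {N : ℕ} {A B Ω : ℂ[X]} (hA : A.natDegree ≤ N) (hB : B.degree < N)
    (hΩ : Ω.Monic) (hdeg : Ω.natDegree = N) (hco : IsCoprime Ω (cj Ω)) (hdvd : Ω ∣ herm A B) :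
    herm A B = C (A.coeff N * conj (A.coeff N)) * (Ω * cj Ω) := by
  have hdvd' : cj Ω ∣ herm A B := by
    rw [← cj_herm]; exact map_dvd cj hdvd
  obtain ⟨R, hR⟩ := hco.mul_dvd hdvd hdvd'
  have hmon' : (cj Ω).Monic := hΩ.map _
  have hmon : (Ω * cj Ω).Monic := hΩ.mul hmon'
  have hd : (Ω * cj Ω).natDegree = 2 * N := by
    rw [hΩ.natDegree_mul hmon', cj_natDegree, hdeg]; ring
  have hR0 : R.natDegree = 0 := by
    by_cases h0 : R = 0
    · simp [h0]
    have h1 := hmon.natDegree_mul' h0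
    have h2 := herm_natDegree_le hA hB
    rw [hR, h1, hd] at h2
    omega
  obtain ⟨c, rfl⟩ := natDegree_eq_zero.1 hR0
  have h3 := herm_coeff_top hA hB
  rw [hR, coeff_mul_C, ← hd, hmon.coeff_natDegree, one_mul] at h3
  rw [hR, h3, mul_comm]

/-- An element of the kernel of the (confluent) interpolation problem is determined by its top
coefficient. -/
lemma eq_zero_of_dvd_herm {N : ℕ} {A B Ω : ℂ[X]} (hA : A.natDegree ≤ N) (hB : B.degree < N)
    (hΩ : Ω.Monic) (hdeg : Ω.natDegree = N) (hco : IsCoprime Ω (cj Ω)) (hdvd : Ω ∣ herm A B)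
    (h0 : A.coeff N = 0) : A = 0 ∧ B = 0 := by
  apply herm_eq_zero
  rw [herm_eq_of_dvd hA hB hΩ hdeg hco hdvd, h0]
  simp

/-- Since `l ≠ 0`, the map `z ↦ (l + z) ^ 2` is a local coordinate at `l ^ 2`: the difference `(l +
z) ^ 2 - l ^ 2` is `z` times `2 * l + z`, which does not vanish at `z = 0`. Multiplicities are
therefore preserved. -/
lemma pow_dvd_of_pow_dvd_comp {l : ℂ} (hl : l ≠ 0) {H : ℂ[X]} {N : ℕ}
    (h : X ^ N ∣ H.comp ((C l + X) ^ 2)) : (X - C (l ^ 2)) ^ N ∣ H := by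
  by_cases h0 : H = 0
  · simp [h0]
  obtain ⟨R, hR, hR0⟩ := exists_eq_pow_rootMultiplicity_mul_and_not_dvd H h0 (l ^ 2)
  set m := rootMultiplicity (l ^ 2) H
  by_cases hm : N ≤ m
  · rw [hR]; exact Dvd.dvd.mul_right (pow_dvd_pow _ hm) _
  exfalso
  push Not at hm
  have h1 : H.comp ((C l + X) ^ 2) = X ^ m * ((2 * C l + X) ^ m * R.comp ((C l + X) ^ 2)) := by
    rw [hR]
    simp only [mul_comp, pow_comp, sub_comp, X_comp, C_comp, C_pow]
    rw [← mul_assoc, ← mul_pow]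
    ring
  rw [h1] at h
  have h2 : X ^ (N - m) ∣ (2 * C l + X) ^ m * R.comp ((C l + X) ^ 2) := by
    have : (X : ℂ[X]) ^ N = X ^ m * X ^ (N - m) := by rw [← pow_add]; congr 1; omega
    rw [this] at h
    exact (mul_dvd_mul_iff_left (pow_ne_zero _ X_ne_zero)).1 h
  have h3 : X ∣ (2 * C l + X) ^ m * R.comp ((C l + X) ^ 2) :=
    (dvd_pow_self X (by omega)).trans h2
  rw [X_dvd_iff, coeff_zero_eq_eval_zero] at h3
  simp only [eval_mul, eval_pow, eval_add, eval_C, eval_X, add_zero, eval_comp, mul_eq_zero,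
    pow_eq_zero_iff', eval_ofNat] at h3
  rcases h3 with h3 | h3
  · exact hl (by simpa using h3.1)
  · exact hR0 (dvd_iff_isRoot.2 h3)

lemma isCoprime_pow_cj {l : ℂ} (hl : conj l ≠ l) (N : ℕ) :
    IsCoprime ((X - C l) ^ N) (cj ((X - C l) ^ N)) := by
  simp only [map_pow, map_sub, cj_X, cj_C]
  exact (pairwise_coprime_X_sub_C Function.injective_id (Ne.symm hl)).pow

/-- The confluent interpolation conditions imply that the Hermitian form vanishes to order `N`. -/
lemma pow_dvd_herm {l : ℂ} (hl : l ≠ 0) {N : ℕ} {A B f g : ℂ[X]}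
    (hfg : f.coeff 0 ≠ 0 ∨ g.coeff 0 ≠ 0)
    (h1 : X ^ N ∣ A.comp ((C l + X) ^ 2) * f + (C l + X) * B.comp ((C l + X) ^ 2) * g)
    (h2 : X ^ N ∣ (cj A).comp ((C l + X) ^ 2) * g - (C l + X) * (cj B).comp ((C l + X) ^ 2) * f) :
    (X - C (l ^ 2)) ^ N ∣ herm A B := by
  apply pow_dvd_of_pow_dvd_comp hl
  have cop : ∀ p : ℂ[X], p.coeff 0 ≠ 0 → IsCoprime (X ^ N) p := by
    intro p hp
    refine IsCoprime.pow_left ?_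
    rw [(prime_X (R := ℂ)).irreducible.coprime_iff_not_dvd, X_dvd_iff]
    exact hp
  have e : (herm A B).comp ((C l + X) ^ 2) = A.comp ((C l + X) ^ 2) * (cj A).comp ((C l + X) ^ 2)
      + (C l + X) ^ 2 * B.comp ((C l + X) ^ 2) * (cj B).comp ((C l + X) ^ 2) := by
    simp [herm]
  rw [e]
  rcases hfg with h | h
  -- Eliminate `g`: the first condition times `Ā` minus the second times `λ B` is the form times
  -- `f`. In the other case `f` is eliminated. The remaining factor has nonzero constant term, so it
  -- is coprime to `X ^ N`.
  · refine (cop f h).dvd_of_dvd_mul_right ?_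
    convert dvd_sub (Dvd.dvd.mul_left h1 ((cj A).comp ((C l + X) ^ 2)))
      (Dvd.dvd.mul_left h2 ((C l + X) * B.comp ((C l + X) ^ 2))) using 1
    ring
  · refine (cop g h).dvd_of_dvd_mul_right ?_
    convert dvd_add (Dvd.dvd.mul_left h2 (A.comp ((C l + X) ^ 2)))
      (Dvd.dvd.mul_left h1 ((C l + X) * (cj B).comp ((C l + X) ^ 2))) using 1
    ring

/-- The same elimination at a simple node, as needed for distinct eigenvalues. -/
lemma herm_eval_eq_zero {l f g : ℂ} {A B : ℂ[X]} (hfg : f ≠ 0 ∨ g ≠ 0)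
    (h1 : A.eval (l ^ 2) * f + l * B.eval (l ^ 2) * g = 0)
    (h2 : (cj A).eval (l ^ 2) * g - l * (cj B).eval (l ^ 2) * f = 0) :
    (herm A B).eval (l ^ 2) = 0 := by
  simp only [herm, eval_add, eval_mul, eval_X]
  rcases hfg with h | h
  · apply mul_right_cancel₀ h
    linear_combination (cj A).eval (l ^ 2) * h1 - l * B.eval (l ^ 2) * h2
  · apply mul_right_cancel₀ h
    linear_combination A.eval (l ^ 2) * h2 + l * (cj B).eval (l ^ 2) * h1

/-- The even part of `∑ y_j λ^{2N-j}`, as a polynomial in `λ²`. -/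
noncomputable def evenPoly {N : ℕ} (y : Fin (2 * N + 1) → ℂ) : ℂ[X] :=
  ∑ j, if Even j.1 then C (y j) * X ^ (N - j.1 / 2) else 0

/-- `λ⁻¹` times the odd part of `∑ y_j λ^{2N-j}`, as a polynomial in `λ²`. -/
noncomputable def oddPoly {N : ℕ} (y : Fin (2 * N + 1) → ℂ) : ℂ[X] :=
  ∑ j, if Even j.1 then 0 else C (y j) * X ^ (N - 1 - j.1 / 2)

lemma evenPoly_coeff {N : ℕ} (y : Fin (2 * N + 1) → ℂ) (j : Fin (2 * N + 1)) (hj : Even j.1) :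
    (evenPoly y).coeff (N - j.1 / 2) = y j := by
  rw [evenPoly, finsetSum_coeff, Finset.sum_eq_single j]
  · simp [hj]
  · intro i _ hi
    split_ifs with h
    · rw [coeff_C_mul_X_pow, if_neg]
      intro h2
      apply hi
      rcases h with ⟨r, hr⟩
      rcases hj with ⟨s, hs⟩
      ext; omega
    · simp
  · simp

lemma oddPoly_coeff {N : ℕ} (y : Fin (2 * N + 1) → ℂ) (j : Fin (2 * N + 1)) (hj : ¬ Even j.1) :
    (oddPoly y).coeff (N - 1 - j.1 / 2) = y j := by
  rw [oddPoly, finsetSum_coeff, Finset.sum_eq_single j]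
  · simp [hj]
  · intro i _ hi
    split_ifs with h
    · simp
    · rw [coeff_C_mul_X_pow, if_neg]
      intro h2
      apply hi
      rw [Nat.not_even_iff_odd] at h hj
      rcases h with ⟨r, hr⟩
      rcases hj with ⟨s, hs⟩
      ext; omega
  · simp

lemma evenPoly_natDegree_le {N : ℕ} (y : Fin (2 * N + 1) → ℂ) : (evenPoly y).natDegree ≤ N := by
  refine natDegree_sum_le_of_forall_le _ _ fun j _ => ?_
  split_ifs
  · exact (natDegree_C_mul_X_pow_le _ _).trans (by omega)
  · simp

lemma oddPoly_degree_lt {N : ℕ} (y : Fin (2 * N + 1) → ℂ) : (oddPoly y).degree < N := by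
  rw [← mem_degreeLT]
  refine Submodule.sum_mem _ fun j _ => ?_
  rw [mem_degreeLT]
  split_ifs with h
  · simp
  · rw [Nat.not_even_iff_odd] at h
    rcases h with ⟨r, hr⟩
    refine (degree_C_mul_X_pow_le _ _).trans_lt ?_
    have := j.2
    exact_mod_cast (by omega : N - 1 - j.1 / 2 < N)

/-- The alternating combination of the columns `λ^{2N-j} f`, `λ^{2N-j} g`. -/
lemma sum_columns {R : Type*} [CommRing R] [Algebra ℂ R] {N : ℕ} (y : Fin (2 * N + 1) → ℂ)
    (l f g : R) :
    ∑ j : Fin (2 * N + 1), y j • (l ^ (2 * N - j.1) * (if Even j.1 then f else g)) =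
      aeval (l ^ 2) (evenPoly y) * f + l * aeval (l ^ 2) (oddPoly y) * g := by
  simp only [evenPoly, oddPoly, map_sum, Finset.sum_mul, Finset.mul_sum]
  rw [← Finset.sum_add_distrib]
  refine Finset.sum_congr rfl fun j _ => ?_
  have := j.2
  split_ifs with h
  · rcases h with ⟨r, hr⟩
    simp only [map_mul, aeval_C, map_pow, aeval_X, map_zero, mul_zero, zero_mul, add_zero,
      Algebra.smul_def, ← pow_mul]
    rw [show 2 * (N - j.1 / 2) = 2 * N - j.1 by omega, mul_assoc]
  · rw [Nat.not_even_iff_odd] at h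
    rcases h with ⟨r, hr⟩
    simp only [map_mul, aeval_C, map_pow, aeval_X, map_zero, zero_mul, zero_add,
      Algebra.smul_def, ← pow_mul]
    rw [show 2 * N - j.1 = 2 * (N - 1 - j.1 / 2) + 1 by omega, pow_succ]
    ring

lemma evenPoly_coeff_top {N : ℕ} (y : Fin (2 * N + 1) → ℂ) : (evenPoly y).coeff N = y 0 := by
  simpa using evenPoly_coeff y 0 (by simp)

lemma evenPoly_coeff_zero {N : ℕ} (y : Fin (2 * N + 1) → ℂ) :
    (evenPoly y).coeff 0 = y (Fin.last _) := by
  simpa using evenPoly_coeff y (Fin.last _) (by simp)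

lemma eq_zero_of_evenPoly_oddPoly {N : ℕ} {y : Fin (2 * N + 1) → ℂ} (h1 : evenPoly y = 0)
    (h2 : oddPoly y = 0) : y = 0 := by
  funext j
  by_cases h : Even j.1
  · rw [← evenPoly_coeff y j h, h1]; simp
  · rw [← oddPoly_coeff y j h, h2]; simp

lemma oddPoly_coeff_top {N : ℕ} (hN : 1 ≤ N) (y : Fin (2 * N + 1) → ℂ) :
    (oddPoly y).coeff (N - 1) = y ⟨1, by omega⟩ := by
  simpa using oddPoly_coeff y ⟨1, by omega⟩ (by simp)

lemma cj_evenPoly {N : ℕ} (y : Fin (2 * N + 1) → ℂ) :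
    cj (evenPoly y) = evenPoly fun j => conj (y j) := by
  simp only [evenPoly, map_sum]
  refine Finset.sum_congr rfl fun j _ => ?_
  split_ifs <;> simp

lemma cj_oddPoly {N : ℕ} (y : Fin (2 * N + 1) → ℂ) :
    cj (oddPoly y) = oddPoly fun j => conj (y j) := by
  simp only [oddPoly, map_sum]
  refine Finset.sum_congr rfl fun j _ => ?_
  split_ifs <;> simp

end PolynomialKernel

end CLL

/-! ### Polynomial jets of the eigenfunctions -/

namespace CLL

/-! ### Coefficientwise derivatives of families of polynomials -/

section CoeffDeriv

open Polynomial

/-- `F' ` is the coefficientwise derivative of the family of polynomials `F` at `x`. -/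
def CoeffDeriv (F : ℝ → ℂ[X]) (F' : ℂ[X]) (x : ℝ) : Prop :=
  ∀ n, HasDerivAt (fun y => (F y).coeff n) (F'.coeff n) x

namespace CoeffDeriv

variable {F G : ℝ → ℂ[X]} {F' G' : ℂ[X]} {x : ℝ}

lemma const (p : ℂ[X]) (x : ℝ) : CoeffDeriv (fun _ => p) 0 x := fun n => by
  simpa using hasDerivAt_const x (p.coeff n)

lemma C {h : ℝ → ℂ} {h' : ℂ} (hh : HasDerivAt h h' x) :
    CoeffDeriv (fun y => Polynomial.C (h y)) (Polynomial.C h') x := fun n => by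
  by_cases hn : n = 0
  · subst hn; simpa using hh
  · simpa [coeff_C, hn] using hasDerivAt_const x (0 : ℂ)

lemma add (hF : CoeffDeriv F F' x) (hG : CoeffDeriv G G' x) :
    CoeffDeriv (fun y => F y + G y) (F' + G') x := fun n => by
  simpa using! (hF n).add (hG n)

lemma sub (hF : CoeffDeriv F F' x) (hG : CoeffDeriv G G' x) :
    CoeffDeriv (fun y => F y - G y) (F' - G') x := fun n => by
  simpa using! (hF n).sub (hG n)

lemma mul (hF : CoeffDeriv F F' x) (hG : CoeffDeriv G G' x) :
    CoeffDeriv (fun y => F y * G y) (F' * G x + F x * G') x := fun n => by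
  simp only [coeff_mul, coeff_add, ← Finset.sum_add_distrib]
  exact HasDerivAt.fun_sum fun i _ => (hF i.1).mul (hG i.2)

lemma sum {ι : Type*} {s : Finset ι} {F : ι → ℝ → ℂ[X]} {F' : ι → ℂ[X]}
    (h : ∀ i ∈ s, CoeffDeriv (F i) (F' i) x) :
    CoeffDeriv (fun y => ∑ i ∈ s, F i y) (∑ i ∈ s, F' i) x := fun n => by
  simp only [finsetSum_coeff]
  exact HasDerivAt.fun_sum fun i hi => h i hi n

lemma pow (hF : CoeffDeriv F F' x) (k : ℕ) :
    CoeffDeriv (fun y => F y ^ k) ((k : ℂ[X]) * F x ^ (k - 1) * F') x := by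
  induction k with
  | zero => simpa using const 1 x
  | succ k ih =>
    have := ih.mul hF
    simp only [pow_succ]
    convert this using 1
    rcases k with _ | k
    · simp
    · push_cast
      simp only [pow_succ]
      ring

lemma congr_deriv (hF : CoeffDeriv F F' x) (h : F' = G') : CoeffDeriv F G' x := h ▸ hF

lemma eq_zero_of_coeff_zero (hF : CoeffDeriv F F' x) {n : ℕ} (h : ∀ y, (F y).coeff n = 0) :
    F'.coeff n = 0 := by
  have h1 := hF n
  simp only [h] at h1
  exact h1.unique (hasDerivAt_const x 0)

/-- Divisibility by `X ^ N` is the vanishing of finitely many coefficients, so the interpolation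
conditions may be differentiated in `x` and `t`. -/
lemma pow_dvd (hF : CoeffDeriv F F' x) {N : ℕ} (h : ∀ y, X ^ N ∣ F y) : X ^ N ∣ F' := by
  simp only [X_pow_dvd_iff] at h ⊢
  exact fun n hn => hF.eq_zero_of_coeff_zero fun y => h y n hn

lemma natDegree_le (hF : CoeffDeriv F F' x) {N : ℕ} (h : ∀ y, (F y).natDegree ≤ N) :
    F'.natDegree ≤ N :=
  natDegree_le_iff_coeff_eq_zero.2 fun _ hn =>
    hF.eq_zero_of_coeff_zero fun y => coeff_eq_zero_of_natDegree_lt ((h y).trans_lt hn)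

/-- The uniform degree bound turns the composition into a sum of fixed length, linear in the
coefficients of `F y`. -/
lemma comp (hF : CoeffDeriv F F' x) {N : ℕ} (h : ∀ y, (F y).natDegree ≤ N) (M : ℂ[X]) :
    CoeffDeriv (fun y => (F y).comp M) (F'.comp M) x := by
  have e : ∀ p : ℂ[X], p.natDegree ≤ N →
      p.comp M = ∑ i ∈ Finset.range (N + 1), Polynomial.C (p.coeff i) * M ^ i := by
    intro p hp
    rw [Polynomial.comp, eval₂_eq_sum_range' _ (Nat.lt_succ_of_le hp)]
  simp only [fun y => e (F y) (h y), e F' (hF.natDegree_le h)]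
  refine sum fun i _ => ?_
  simpa using (C (hF i)).mul (const (M ^ i) x)

lemma cj (hF : CoeffDeriv F F' x) : CoeffDeriv (fun y => cj (F y)) (CLL.cj F') x := fun n => by
  simpa using (hF n).star

end CoeffDeriv

end CoeffDeriv

/-! ### Truncations of `sin (w Y) / w` and `cos (w Y)`, which involve only `w²` -/

section TruncatedTrig

open Polynomial

/-- Truncation of `sin (w Y) / w` with `w² = S`. -/
noncomputable def truncSin (N : ℕ) (S Y : ℂ[X]) : ℂ[X] :=
  ∑ k ∈ Finset.range N, C ((-1) ^ k / (2 * k + 1).factorial : ℂ) * (S ^ k * Y ^ (2 * k + 1))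

/-- Truncation of `cos (w Y)` with `w² = S`. -/
noncomputable def truncCos (N : ℕ) (S Y : ℂ[X]) : ℂ[X] :=
  ∑ k ∈ Finset.range N, C ((-1) ^ k / (2 * k).factorial : ℂ) * (S ^ k * Y ^ (2 * k))

/-- With equal numbers of terms in both truncations, termwise differentiation is exact and leaves no
remainder. -/
lemma truncSin_coeffDeriv (N : ℕ) (S : ℂ[X]) {Y : ℝ → ℂ[X]} {Y' : ℂ[X]} {x : ℝ}
    (hY : CoeffDeriv Y Y' x) :
    CoeffDeriv (fun y => truncSin N S (Y y)) (truncCos N S (Y x) * Y') x := by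
  unfold truncSin truncCos
  rw [Finset.sum_mul]
  refine CoeffDeriv.sum fun k _ => ?_
  have := (CoeffDeriv.const (C ((-1) ^ k / (2 * k + 1).factorial : ℂ) * S ^ k) x).mul
    (hY.pow (2 * k + 1))
  simp only [← mul_assoc] at this ⊢
  refine this.congr_deriv ?_
  have e : C ((-1) ^ k / (2 * k + 1).factorial : ℂ) * ((2 * k + 1 : ℕ) : ℂ[X])
      = C ((-1) ^ k / (2 * k).factorial : ℂ) := by
    rw [← C_eq_natCast, ← C_mul]
    congr 1
    rw [Nat.factorial_succ]
    have h1 : ((2 * k).factorial : ℂ) ≠ 0 := by exact_mod_cast Nat.factorial_ne_zero _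
    have h2 : ((2 * k + 1 : ℕ) : ℂ) ≠ 0 := by exact_mod_cast (Nat.succ_ne_zero (2 * k))
    rw [Nat.cast_mul]
    field_simp
  rw [← e]
  simp only [zero_mul, zero_add, Nat.add_sub_cancel]
  ring

/-- Here termwise differentiation misses the last term of `S * truncSin`. That term contains `S ^
N`, which is divisible by `X ^ N` because `S` has no constant term. -/
lemma truncCos_coeffDeriv (N : ℕ) (S : ℂ[X]) (hS : S.coeff 0 = 0) {Y : ℝ → ℂ[X]} {Y' : ℂ[X]}
    {x : ℝ} (hY : CoeffDeriv Y Y' x) :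
    ∃ D, CoeffDeriv (fun y => truncCos N S (Y y)) D x ∧
      X ^ N ∣ D + S * truncSin N S (Y x) * Y' := by
  refine ⟨_, CoeffDeriv.sum fun k _ => (CoeffDeriv.const _ x).mul
    ((CoeffDeriv.const _ x).mul (hY.pow (2 * k))), ?_⟩
  have hSX : X ∣ S := X_dvd_iff.2 hS
  rcases N with _ | N
  · simp
  · rw [Finset.sum_range_succ', truncSin, Finset.sum_range_succ]
    have e : ∀ k ∈ Finset.range N,
        (0 * (S ^ (k + 1) * Y x ^ (2 * (k + 1))) +
          C ((-1) ^ (k + 1) / (2 * (k + 1)).factorial : ℂ) * (0 * Y x ^ (2 * (k + 1)) +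
          S ^ (k + 1) * (((2 * (k + 1) : ℕ) : ℂ[X]) * Y x ^ (2 * (k + 1) - 1) * Y'))) =
        - (S * (C ((-1) ^ k / (2 * k + 1).factorial : ℂ) * (S ^ k * Y x ^ (2 * k + 1))) * Y') := by
      intro k _
      have e : C ((-1) ^ (k + 1) / (2 * (k + 1)).factorial : ℂ) * ((2 * (k + 1) : ℕ) : ℂ[X])
          = - C ((-1) ^ k / (2 * k + 1).factorial : ℂ) := by
        rw [← C_eq_natCast, ← C_mul, ← C_neg]
        congr 1
        rw [show 2 * (k + 1) = 2 * k + 1 + 1 by ring, Nat.factorial_succ (2 * k + 1)]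
        have h1 : ((2 * k + 1).factorial : ℂ) ≠ 0 := by exact_mod_cast Nat.factorial_ne_zero _
        have h2 : ((2 * k + 1 + 1 : ℕ) : ℂ) ≠ 0 := by exact_mod_cast (Nat.succ_ne_zero (2 * k + 1))
        rw [Nat.cast_mul]
        field_simp
        ring
      rw [show 2 * (k + 1) - 1 = 2 * k + 1 by omega]
      linear_combination (S ^ (k + 1) * Y x ^ (2 * k + 1) * Y') * e
    rw [Finset.sum_congr rfl e, Finset.sum_neg_distrib, ← Finset.sum_mul,
      ← Finset.mul_sum]
    have : X ^ (N + 1) ∣ S * (C ((-1) ^ N / (2 * N + 1).factorial : ℂ) *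
        (S ^ N * Y x ^ (2 * N + 1))) * Y' := by
      have h : X ^ (N + 1) ∣ S ^ (N + 1) := pow_dvd_pow_of_dvd hSX _
      refine h.trans ⟨C ((-1) ^ N / (2 * N + 1).factorial : ℂ) * Y x ^ (2 * N + 1) * Y', ?_⟩
      ring
    convert this using 1
    simp only [Nat.cast_zero, zero_mul, mul_zero, add_zero]
    ring

lemma truncSin_coeff_zero {N : ℕ} (hN : 1 ≤ N) {S : ℂ[X]} (hS : S.coeff 0 = 0) (Y : ℂ[X]) :
    (truncSin N S Y).coeff 0 = Y.coeff 0 := by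
  rw [coeff_zero_eq_eval_zero] at *
  obtain ⟨N, rfl⟩ := Nat.exists_eq_add_of_le' hN
  simp [truncSin, eval_finsetSum, Finset.sum_range_succ', hS, coeff_zero_eq_eval_zero]

lemma truncCos_coeff_zero {N : ℕ} (hN : 1 ≤ N) {S : ℂ[X]} (hS : S.coeff 0 = 0) (Y : ℂ[X]) :
    (truncCos N S Y).coeff 0 = 1 := by
  rw [coeff_zero_eq_eval_zero] at *
  obtain ⟨N, rfl⟩ := Nat.exists_eq_add_of_le' hN
  simp [truncCos, eval_finsetSum, Finset.sum_range_succ', hS]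

end TruncatedTrig

namespace Data

variable (d : Data)

/-! ### The eigenfunctions as polynomials in `z = ε²` -/

section Jets

open Polynomial

/-- The limiting eigenvalue `√((1-a)/2) + i c / 2`. -/
noncomputable def lam₀ : ℂ := (Real.sqrt ((1 - d.a) / 2) : ℂ) + I * d.c / 2

/-- `λ = λ₀ + z` as a polynomial in `z = ε²`. -/
noncomputable def lamP : ℂ[X] := C d.lam₀ + X

/-- The discriminant is `KP ^ 2 + (4 * c * λ) ^ 2`, which splits into `QP` and its companion `4 * c
* λ + I * KP`. At the branch point `KP = 4 * I * c * λ₀`, so `QP` is nonzero there and the companion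
has a simple zero. -/
noncomputable def KP : ℂ[X] := 4 * d.lamP ^ 2 - C (2 + (d.c : ℂ) ^ 2 - 2 * d.a)

noncomputable def QP : ℂ[X] := C (4 * d.c : ℂ) * d.lamP - C I * d.KP

noncomputable def SP : ℂ[X] := d.QP * (C (4 * d.c : ℂ) * d.lamP + C I * d.KP)

/-- The coefficient of `t` in `YP`. -/
noncomputable def VP : ℂ[X] := C (1 / 8) * (C (2 + (d.c : ℂ) ^ 2 + 2 * d.a) - 4 * d.lamP ^ 2)

/-- The free parameters enter through the mean of `s` and `conj s'`. Half of their difference gives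
a factor common to `f` and `g`, which is absorbed in `unitE` and does not affect the potential. -/
noncomputable def YP (x t : ℝ) : ℂ[X] :=
  C (x / 4 : ℂ) + C (t : ℂ) * d.VP +
    ∑ l ∈ Finset.Icc 1 (d.N - 1), C ((d.s l + conj (d.s' l)) / 2) * X ^ l

/-- The jet of the normalized eigenfunction, without the carrier. -/
noncomputable def fJ (x t : ℝ) : ℂ[X] :=
  d.QP * truncSin d.N d.SP (d.YP x t) - truncCos d.N d.SP (d.YP x t)

noncomputable def gJ (x t : ℝ) : ℂ[X] :=
  -d.QP * truncSin d.N d.SP (d.YP x t) - truncCos d.N d.SP (d.YP x t)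

/-- The carrier `exp (i ρ / 2)`. -/
noncomputable def carrier (x t : ℝ) : ℂ := exp (I * (phase d.a d.c x t / 2))

/-- The jet of the normalized first component. -/
noncomputable def fP (x t : ℝ) : ℂ[X] := C (conj (d.carrier x t)) * d.fJ x t

/-- The jet of the normalized second component. -/
noncomputable def gP (x t : ℝ) : ℂ[X] := C (d.carrier x t) * d.gJ x t

lemma conj_carrier (x t : ℝ) : conj (d.carrier x t) = exp (-I * (phase d.a d.c x t / 2)) := by
  rw [carrier, ← exp_conj]; simp [map_ofNat]

lemma carrier_mul_conj (x t : ℝ) : d.carrier x t * conj (d.carrier x t) = 1 := by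
  rw [conj_carrier, carrier, ← exp_add]; simp

lemma carrier_ne_zero (x t : ℝ) : d.carrier x t ≠ 0 := exp_ne_zero _

lemma seedQ_eq (x t : ℝ) : seedQ d.a d.c x t = d.c * d.carrier x t ^ 2 := by
  rw [seedQ, carrier, ← exp_nat_mul]; congr 2; push_cast; ring

lemma seedR_eq (x t : ℝ) : seedR d.a d.c x t = -d.c * conj (d.carrier x t) ^ 2 := by
  rw [seedR, seedQ_eq]; simp

variable {d}

lemma lam₀_sq (ha : d.a < 1) : 4 * d.lam₀ ^ 2 = 2 + (d.c : ℂ) ^ 2 - 2 * d.a + 4 * I * d.c * d.lam₀ := by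
  have h : (Real.sqrt ((1 - d.a) / 2) : ℂ) ^ 2 = (1 - d.a) / 2 := by
    rw [← ofReal_pow, Real.sq_sqrt (by linarith)]; push_cast; ring
  rw [lam₀]
  linear_combination 4 * h - (d.c : ℂ) ^ 2 * I_sq

lemma sqrt_pos' (ha : d.a < 1) : 0 < Real.sqrt ((1 - d.a) / 2) := Real.sqrt_pos.2 (by linarith)

lemma lam₀_re : d.lam₀.re = Real.sqrt ((1 - d.a) / 2) := by simp [lam₀]

lemma lam₀_im : d.lam₀.im = d.c / 2 := by simp [lam₀]

lemma lam₀_ne_zero (ha : d.a < 1) : d.lam₀ ≠ 0 := fun h => by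
  have := sqrt_pos' ha
  rw [← lam₀_re, h] at this; simp at this

lemma SP_coeff_zero (ha : d.a < 1) : d.SP.coeff 0 = 0 := by
  rw [coeff_zero_eq_eval_zero]
  simp [SP, KP, lamP, lam₀_sq ha, ← mul_assoc]
  right
  linear_combination (4 * d.c * d.lam₀ : ℂ) * I_sq

lemma QP_coeff_zero (ha : d.a < 1) : d.QP.coeff 0 = 8 * d.c * d.lam₀ := by
  rw [coeff_zero_eq_eval_zero]
  simp [QP, KP, lamP, lam₀_sq ha]
  linear_combination -(4 * d.c * d.lam₀ : ℂ) * I_sq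

lemma QP_coeff_zero_ne (ha : d.a < 1) (hc : d.c ≠ 0) : d.QP.coeff 0 ≠ 0 := by
  rw [QP_coeff_zero ha]
  have h1 := lam₀_ne_zero ha
  have h2 : (d.c : ℂ) ≠ 0 := by exact_mod_cast hc
  simp [h1, h2]

/-- The branch point is simple: the derivative of `4 * c * λ + I * KP` at `λ₀` is `4 * c + 8 * I *
λ₀`, whose imaginary part is `8 * re λ₀ > 0`. Consequently the root has exact order `ε`, and `S`
becomes linear after rescaling at infinity. -/
lemma SP_coeff_one_ne (ha : d.a < 1) (hc : d.c ≠ 0) : d.SP.coeff 1 ≠ 0 := by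
  have h : d.SP.coeff 1 = d.QP.coeff 0 * (4 * d.c + 8 * I * d.lam₀) := by
    have hP : (C (4 * d.c : ℂ) * d.lamP + C I * d.KP).coeff 0 = 0 := by
      rw [coeff_zero_eq_eval_zero]
      simp [KP, lamP, lam₀_sq ha]
      linear_combination (4 * d.c * d.lam₀ : ℂ) * I_sq
    have hP1 : (C (4 * d.c : ℂ) * d.lamP + C I * d.KP).coeff 1 = 4 * d.c + 8 * I * d.lam₀ := by
      have : C (4 * d.c : ℂ) * d.lamP + C I * d.KP =
        C (4 * d.c * d.lam₀ + I * (4 * d.lam₀ ^ 2 - (2 + (d.c : ℂ) ^ 2 - 2 * d.a)))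
          + C (4 * d.c + 8 * I * d.lam₀) * X + C (4 * I) * X ^ 2 := by
        simp only [KP, lamP, map_add, map_sub, map_mul, map_pow, map_ofNat]
        ring
      rw [this]
      simp only [coeff_add, coeff_C_mul, coeff_X_one, coeff_C_of_ne_zero one_ne_zero, coeff_X_pow]
      simp
    rw [SP, mul_coeff_one, hP, hP1]
    ring
  rw [h]
  refine mul_ne_zero (QP_coeff_zero_ne ha hc) fun h0 => ?_
  have := congrArg Complex.im h0
  simp [lam₀_re] at this
  exact (sqrt_pos' ha).ne' (by simpa using this)

/-- The sine parts cancel in `fJ + gJ`, and the truncated cosine has constant term `1`, so the sum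
has constant term `-2`. -/
lemma fP_gP_coeff_zero (ha : d.a < 1) (hN : 1 ≤ d.N) (x t : ℝ) :
    (d.fP x t).coeff 0 ≠ 0 ∨ (d.gP x t).coeff 0 ≠ 0 := by
  by_contra! h
  obtain ⟨h1, h2⟩ := h
  have hS := SP_coeff_zero ha
  rw [fP, coeff_C_mul, mul_eq_zero, map_eq_zero, or_iff_right (d.carrier_ne_zero x t)] at h1
  rw [gP, coeff_C_mul, mul_eq_zero, or_iff_right (d.carrier_ne_zero x t)] at h2
  simp only [fJ, gJ, coeff_sub, mul_coeff_zero, truncSin_coeff_zero hN hS, truncCos_coeff_zero hN hS,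
    coeff_neg] at h1 h2
  have : (2 : ℂ) = 0 := by linear_combination -h1 - h2
  norm_num at this

end Jets

end Data

end CLL

/-! ### Expansion of the eigenfunctions at the branch point -/

namespace CLL

/-! ### Taylor remainders and orders of vanishing at `ε = 0` -/

section Remainder

/-- An analytic factor in the remainder is required, since the remainder is later differentiated in
`ε`. -/
lemma sin_eq_truncation_add (N : ℕ) : ∃ R : ℂ → ℂ, AnalyticAt ℂ R 0 ∧ ∀ᶠ z in 𝓝 (0 : ℂ),
    Complex.sin z = ∑ k ∈ Finset.range N, (-1) ^ k / (2 * k + 1).factorial * z ^ (2 * k + 1)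
      + z ^ (2 * N + 1) * R z := by
  have han : AnalyticAt ℂ (fun z : ℂ => Complex.sin z -
      ∑ k ∈ Finset.range N, ((-1) ^ k / (2 * k + 1).factorial : ℂ) * z ^ (2 * k + 1)) 0 := by
    fun_prop
  obtain ⟨R, hR, hR'⟩ := (natCast_le_analyticOrderAt han).1
    ((natCast_le_analyticOrderAt_iff_iteratedDeriv_eq_zero (n := 2 * N + 1) han).2 (by
      intro i hi
      rw [iteratedDeriv_fun_sub (by fun_prop) (by fun_prop),
        iteratedDeriv_fun_sum (fun k _ => by fun_prop)]
      simp only [iteratedDeriv_const_mul_field, iteratedDeriv_fun_pow_zero]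
      rcases Nat.even_or_odd' i with ⟨m, rfl | rfl⟩
      · rw [iteratedDeriv_even_sin, Finset.sum_eq_zero]
        · simp
        · intro k _
          rw [if_neg (by omega), Nat.cast_zero, mul_zero]
      · rw [iteratedDeriv_odd_sin, Finset.sum_eq_single m]
        · have : ((2 * m + 1).factorial : ℂ) ≠ 0 := by exact_mod_cast Nat.factorial_ne_zero _
          simp [this]
        · intro k _ hk
          rw [if_neg (by omega), Nat.cast_zero, mul_zero]
        · intro h
          exact absurd (Finset.mem_range.2 (by omega)) h))
  exact ⟨R, hR, hR'.mono fun z hz => by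
    simp only [sub_zero, smul_eq_mul] at hz; linear_combination hz⟩

lemma cos_eq_truncation_add (N : ℕ) : ∃ R : ℂ → ℂ, AnalyticAt ℂ R 0 ∧ ∀ᶠ z in 𝓝 (0 : ℂ),
    Complex.cos z = ∑ k ∈ Finset.range N, (-1) ^ k / (2 * k).factorial * z ^ (2 * k)
      + z ^ (2 * N) * R z := by
  have han : AnalyticAt ℂ (fun z : ℂ => Complex.cos z -
      ∑ k ∈ Finset.range N, ((-1) ^ k / (2 * k).factorial : ℂ) * z ^ (2 * k)) 0 := by
    fun_prop
  obtain ⟨R, hR, hR'⟩ := (natCast_le_analyticOrderAt han).1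
    ((natCast_le_analyticOrderAt_iff_iteratedDeriv_eq_zero (n := 2 * N) han).2 (by
      intro i hi
      rw [iteratedDeriv_fun_sub (by fun_prop) (by fun_prop),
        iteratedDeriv_fun_sum (fun k _ => by fun_prop)]
      simp only [iteratedDeriv_const_mul_field, iteratedDeriv_fun_pow_zero]
      rcases Nat.even_or_odd' i with ⟨m, rfl | rfl⟩
      · rw [iteratedDeriv_even_cos, Finset.sum_eq_single m]
        · have : ((2 * m).factorial : ℂ) ≠ 0 := by exact_mod_cast Nat.factorial_ne_zero _
          simp [this]
        · intro k _ hk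
          rw [if_neg (by omega), Nat.cast_zero, mul_zero]
        · intro h
          exact absurd (Finset.mem_range.2 (by omega)) h
      · rw [iteratedDeriv_odd_cos, Finset.sum_eq_zero]
        · simp
        · intro k _
          rw [if_neg (by omega), Nat.cast_zero, mul_zero]))
  exact ⟨R, hR, hR'.mono fun z hz => by
    simp only [sub_zero, smul_eq_mul] at hz; linear_combination hz⟩

@[fun_prop]
lemma analyticAt_ofReal (x : ℝ) : AnalyticAt ℝ (fun ε : ℝ => (ε : ℂ)) x :=
  ofRealCLM.analyticAt x

@[fun_prop]
lemma analyticAt_exp_comp {f : ℝ → ℂ} {x : ℝ} (hf : AnalyticAt ℝ f x) :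
    AnalyticAt ℝ (fun ε => exp (f ε)) x :=
  (analyticAt_cexp.restrictScalars (𝕜 := ℝ)).comp hf

/-- Derivatives at `0` of a function that vanishes there to order `m`. -/
lemma iteratedDeriv_pow_mul_eq_zero {R : ℝ → ℂ} (hR : AnalyticAt ℝ R 0) {i m : ℕ} (h : i < m) :
    iteratedDeriv i (fun ε : ℝ => (ε : ℂ) ^ m * R ε) 0 = 0 := by
  have han : AnalyticAt ℝ (fun ε : ℝ => (ε : ℂ) ^ m * R ε) 0 := by fun_prop
  refine (natCast_le_analyticOrderAt_iff_iteratedDeriv_eq_zero han).1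
    ((natCast_le_analyticOrderAt han).2 ⟨R, hR, Eventually.of_forall fun ε => ?_⟩) i h
  simp

lemma iteratedDeriv_pow_mul_self {R : ℝ → ℂ} (hR : AnalyticAt ℝ R 0) (m : ℕ) :
    iteratedDeriv m (fun ε : ℝ => (ε : ℂ) ^ m * R ε) 0 = m.factorial * R 0 := by
  have h1 : AnalyticAt ℝ (fun ε : ℝ => R ε - R 0) 0 := by fun_prop
  obtain ⟨G, hG, hG'⟩ := (natCast_le_analyticOrderAt (n := 1) h1).1 (by
    rw [natCast_le_analyticOrderAt_iff_iteratedDeriv_eq_zero h1]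
    intro i hi
    obtain rfl : i = 0 := by omega
    simp)
  have e : (fun ε : ℝ => (ε : ℂ) ^ m * R ε) =ᶠ[𝓝 0]
      fun ε : ℝ => ((ε ^ m : ℝ) : ℂ) * R 0 + (ε : ℂ) ^ (m + 1) * G ε := by
    filter_upwards [hG'] with ε hε
    simp only [sub_zero, pow_one, real_smul] at hε
    push_cast
    linear_combination (ε : ℂ) ^ m * hε
  rw [e.iteratedDeriv_eq, iteratedDeriv_fun_add, iteratedDeriv_pow_mul_eq_zero hG (by omega)]
  · have : (fun ε : ℝ => ((ε ^ m : ℝ) : ℂ) * R 0) = fun ε : ℝ => (ε ^ m) • R 0 := by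
      ext; simp
    rw [this, iteratedDeriv_smul_const (by fun_prop), iteratedDeriv_fun_pow_zero]
    simp
  · have : AnalyticAt ℝ (fun ε : ℝ => ((ε ^ m : ℝ) : ℂ) * R 0) 0 := by
      push_cast; fun_prop
    exact this.contDiffAt
  · have : AnalyticAt ℝ (fun ε : ℝ => (ε : ℂ) ^ (m + 1) * G ε) 0 := by fun_prop
    exact this.contDiffAt

open Polynomial in
lemma analyticAt_eval_sq (p : ℂ[X]) (x : ℝ) :
    AnalyticAt ℝ (fun ε : ℝ => p.eval ((ε : ℂ) ^ 2)) x := by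
  have : (fun ε : ℝ => p.eval ((ε : ℂ) ^ 2)) =
      fun ε : ℝ => ∑ i ∈ Finset.range (p.natDegree + 1), p.coeff i * ((ε : ℂ) ^ 2) ^ i := by
    ext ε; rw [eval_eq_sum_range]
  rw [this]; fun_prop

end Remainder

namespace Data

variable (d : Data)

/-! ### From the exponential eigenfunctions to their jets -/

section Rows

open Polynomial

/-- `f` at `λ = lamOdd a c ε`. -/
noncomputable def fE (ε x t : ℝ) : ℂ := d.psiAt₁ ε x t + conj (d.psiNeg₂ ε x t)

/-- `g` at `λ = lamOdd a c ε`. -/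
noncomputable def gE (ε x t : ℝ) : ℂ := d.psiAt₂ ε x t + conj (d.psiNeg₁ ε x t)

lemma lamOdd_eq (ε : ℝ) : lamOdd d.a d.c ε = d.lamP.eval ((ε : ℂ) ^ 2) := by
  simp [lamOdd, lamP, lam₀]

lemma S_eq (ε : ℝ) : S d.a d.c (lamOdd d.a d.c ε) = d.SP.eval ((ε : ℂ) ^ 2) := by
  rw [lamOdd_eq]
  generalize (ε : ℂ) ^ 2 = z
  simp only [S, SP, QP, KP, eval_mul, eval_sub, eval_add, eval_C, eval_pow, eval_ofNat]
  generalize d.lamP.eval z = l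
  linear_combination (-1 * (4 * l ^ 2 - (2 + d.c ^ 2 - 2 * d.a)) ^ 2 : ℂ) * (-I_sq)

/-- The exponent polynomial that does not depend on `x, t`. -/
noncomputable def shiftP : ℂ[X] :=
  ∑ l ∈ Finset.Icc 1 (d.N - 1), C ((d.s l - conj (d.s' l)) / 2) * X ^ l

/-- The ratio `k` of the two components of `ψ`, without the carrier. -/
noncomputable def ratio (ε : ℝ) : ℂ :=
  I * (d.KP.eval ((ε : ℂ) ^ 2) - d.root ε) / (4 * d.lamP.eval ((ε : ℂ) ^ 2) * d.c)

lemma factorD_eq (ε : ℝ) : factorD d.N d.s (d.root ε) ε =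
    exp (I * d.root ε * (∑ l ∈ Finset.Icc 1 (d.N - 1), d.s l * ((ε : ℂ) ^ 2) ^ l)) := by
  simp only [factorD, pow_mul]

lemma conj_factorD_eq (ε : ℝ) : conj (factorD d.N d.s' (conj (d.root ε)) ε) =
    exp (-I * d.root ε * (∑ l ∈ Finset.Icc 1 (d.N - 1), conj (d.s' l) * ((ε : ℂ) ^ 2) ^ l)) := by
  simp only [factorD, pow_mul]
  rw [← exp_conj]
  simp

/-- The two exponentials of which `f` and `g` are combinations. -/
noncomputable def expPos (ε x t : ℝ) : ℂ :=
  exp (I * d.root ε * ((d.YP x t).eval ((ε : ℂ) ^ 2) + d.shiftP.eval ((ε : ℂ) ^ 2)))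

noncomputable def expNeg (ε x t : ℝ) : ℂ :=
  exp (-I * d.root ε * ((d.YP x t).eval ((ε : ℂ) ^ 2) - d.shiftP.eval ((ε : ℂ) ^ 2)))

lemma YP_add_shiftP (z : ℂ) (x t : ℝ) : (d.YP x t).eval z + d.shiftP.eval z =
    x / 4 + t / 8 * (2 + (d.c : ℂ) ^ 2 + 2 * d.a - 4 * d.lamP.eval z ^ 2) +
      ∑ l ∈ Finset.Icc 1 (d.N - 1), d.s l * z ^ l := by
  simp only [YP, shiftP, VP, eval_add, eval_mul, eval_C, eval_sub, eval_pow, eval_ofNat,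
    eval_finsetSum, eval_X]
  rw [add_assoc, ← Finset.sum_add_distrib]
  congr 1
  · ring
  · exact Finset.sum_congr rfl fun l _ => by ring

lemma YP_sub_shiftP (z : ℂ) (x t : ℝ) : (d.YP x t).eval z - d.shiftP.eval z =
    x / 4 + t / 8 * (2 + (d.c : ℂ) ^ 2 + 2 * d.a - 4 * d.lamP.eval z ^ 2) +
      ∑ l ∈ Finset.Icc 1 (d.N - 1), conj (d.s' l) * z ^ l := by
  simp only [YP, shiftP, VP, eval_add, eval_mul, eval_C, eval_sub, eval_pow, eval_ofNat,
    eval_finsetSum, eval_X]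
  rw [add_sub_assoc, ← Finset.sum_sub_distrib]
  congr 1
  · ring
  · exact Finset.sum_congr rfl fun l _ => by ring

lemma psiAt₁_eq (ε x t : ℝ) : d.psiAt₁ ε x t = conj (d.carrier x t) * d.expPos ε x t := by
  simp only [psiAt₁, psi₁, factorD_eq, lamOdd_eq, expPos, YP_add_shiftP, conj_carrier, ← exp_add]
  congr 1; ring

lemma psiAt₂_eq (ε x t : ℝ) :
    d.psiAt₂ ε x t = d.carrier x t * (d.ratio ε * d.expPos ε x t) := by
  have h : factorD d.N d.s (d.root ε) ε * exp (I * (d.root ε / 4 * x + d.root ε / 8 *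
      (-4 * lamOdd d.a d.c ε ^ 2 + 2 + d.c ^ 2 + 2 * d.a) * t + phase d.a d.c x t / 2)) =
      d.carrier x t * d.expPos ε x t := by
    simp only [factorD_eq, lamOdd_eq, expPos, YP_add_shiftP, carrier, ← exp_add]
    congr 1; ring
  simp only [psiAt₂, psi₂, ratio, KP, eval_sub, eval_mul, eval_pow, eval_ofNat, eval_C,
    ← lamOdd_eq]
  linear_combination ((-I * d.root ε + 4 * I * lamOdd d.a d.c ε ^ 2 - 2 * I - I * d.c ^ 2
    + 2 * I * d.a) / (4 * lamOdd d.a d.c ε * d.c)) * h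

lemma conj_psiNeg₁_eq (ε x t : ℝ) :
    conj (d.psiNeg₁ ε x t) = d.carrier x t * d.expNeg ε x t := by
  simp only [psiNeg₁, psi₁, map_mul, conj_factorD_eq, lamOdd_eq, expNeg, YP_sub_shiftP, carrier,
    ← exp_conj, ← exp_add, map_add, map_sub, map_neg, map_div₀, map_pow, conj_I, conj_ofReal,
    conj_conj, map_ofNat]
  congr 1; ring

lemma conj_psiNeg₂_eq (ε x t : ℝ) :
    conj (d.psiNeg₂ ε x t) = conj (d.carrier x t) * (d.ratio ε * d.expNeg ε x t) := by
  have h : conj (factorD d.N d.s' (conj (d.root ε)) ε) * exp (-I * (d.root ε / 4 * x +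
      d.root ε / 8 * (-4 * (-lamOdd d.a d.c ε) ^ 2 + 2 + d.c ^ 2 + 2 * d.a) * t +
      phase d.a d.c x t / 2)) = conj (d.carrier x t) * d.expNeg ε x t := by
    simp only [conj_factorD_eq, lamOdd_eq, expNeg, YP_sub_shiftP, conj_carrier, ← exp_add]
    congr 1; ring
  simp only [psiNeg₂, psi₂, ratio, KP, eval_sub, eval_add, eval_mul, eval_pow, eval_ofNat, eval_C,
    ← lamOdd_eq, ← exp_conj, map_add, map_sub, map_neg, map_div₀, map_pow, conj_I, conj_ofReal,
    conj_conj, map_ofNat, map_mul]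
  rw [show 4 * -lamOdd d.a d.c ε * d.c = -(4 * lamOdd d.a d.c ε * d.c) by ring, div_neg]
  linear_combination (-(I * d.root ε - 4 * I * lamOdd d.a d.c ε ^ 2 + 2 * I + I * d.c ^ 2
    - 2 * I * d.a) / (4 * lamOdd d.a d.c ε * d.c)) * h

lemma fE_eq (ε x t : ℝ) :
    d.fE ε x t = conj (d.carrier x t) * (d.expPos ε x t + d.ratio ε * d.expNeg ε x t) := by
  rw [fE, psiAt₁_eq, conj_psiNeg₂_eq, mul_add]

lemma gE_eq (ε x t : ℝ) :
    d.gE ε x t = d.carrier x t * (d.ratio ε * d.expPos ε x t + d.expNeg ε x t) := by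
  rw [gE, psiAt₂_eq, conj_psiNeg₁_eq, mul_add]

/-- The common factor of `f` and `g`, which does not depend on `x, t`. -/
noncomputable def unitE (ε : ℝ) : ℂ :=
  I * d.root ε * (exp (I * d.root ε * d.shiftP.eval ((ε : ℂ) ^ 2)) *
    (d.QP.eval ((ε : ℂ) ^ 2) + I * d.root ε) /
      (4 * d.lamP.eval ((ε : ℂ) ^ 2) * d.c * d.QP.eval ((ε : ℂ) ^ 2)))

lemma one_sub_ratio {ε : ℝ} (hl : d.lamP.eval ((ε : ℂ) ^ 2) ≠ 0) (hc : d.c ≠ 0) :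
    1 - d.ratio ε = (d.QP.eval ((ε : ℂ) ^ 2) + I * d.root ε) /
      (4 * d.lamP.eval ((ε : ℂ) ^ 2) * d.c) := by
  have hc' : (d.c : ℂ) ≠ 0 := by exact_mod_cast hc
  rw [ratio, QP]
  simp only [eval_sub, eval_mul, eval_C]
  field_simp
  ring

/-- With `k` the ratio and `w` the root, `w² = Q * (4 c λ + I K)` makes `1 + k` equal to `-I * w /
Q` times `1 - k`. This extra factor `w` is what makes `f` and `g` even in `w` once the common factor
is removed. -/
lemma one_add_ratio {ε : ℝ} (hl : d.lamP.eval ((ε : ℂ) ^ 2) ≠ 0) (hc : d.c ≠ 0)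
    (hQ : d.QP.eval ((ε : ℂ) ^ 2) ≠ 0) (hw : d.root ε ^ 2 = S d.a d.c (lamOdd d.a d.c ε)) :
    1 + d.ratio ε = -I * d.root ε * (d.QP.eval ((ε : ℂ) ^ 2) + I * d.root ε) /
      (4 * d.lamP.eval ((ε : ℂ) ^ 2) * d.c * d.QP.eval ((ε : ℂ) ^ 2)) := by
  have hc' : (d.c : ℂ) ≠ 0 := by exact_mod_cast hc
  rw [S_eq, SP, eval_mul] at hw
  simp only [eval_add, eval_mul, eval_C] at hw
  rw [ratio]
  rw [eq_div_iff (by simp [hl, hc', hQ]), add_mul, one_mul]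
  have h : I * (d.KP.eval ((ε : ℂ) ^ 2) - d.root ε) / (4 * d.lamP.eval ((ε : ℂ) ^ 2) * d.c) *
      (4 * d.lamP.eval ((ε : ℂ) ^ 2) * d.c * d.QP.eval ((ε : ℂ) ^ 2)) =
      I * (d.KP.eval ((ε : ℂ) ^ 2) - d.root ε) * d.QP.eval ((ε : ℂ) ^ 2) := by
    field_simp
  rw [h]
  linear_combination -hw + d.root ε ^ 2 * I_sq

/-- Writing both exponentials with `cos θ ± I * sin θ` gives `(1 + k) * cos θ + I * (1 - k) * sin θ`
for `f`, and the opposite sign of the sine term for `g`. The formulas for `1 ± k` then produce one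
common factor. -/
lemma fE_eq_trig {ε : ℝ} (hl : d.lamP.eval ((ε : ℂ) ^ 2) ≠ 0) (hc : d.c ≠ 0)
    (hQ : d.QP.eval ((ε : ℂ) ^ 2) ≠ 0) (hw : d.root ε ^ 2 = S d.a d.c (lamOdd d.a d.c ε))
    (x t : ℝ) : d.fE ε x t = conj (d.carrier x t) *
      (exp (I * d.root ε * d.shiftP.eval ((ε : ℂ) ^ 2)) *
      (d.QP.eval ((ε : ℂ) ^ 2) + I * d.root ε) /
      (4 * d.lamP.eval ((ε : ℂ) ^ 2) * d.c * d.QP.eval ((ε : ℂ) ^ 2))) * I *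
      (d.QP.eval ((ε : ℂ) ^ 2) * Complex.sin (d.root ε * (d.YP x t).eval ((ε : ℂ) ^ 2)) -
        d.root ε * Complex.cos (d.root ε * (d.YP x t).eval ((ε : ℂ) ^ 2))) ∧
    d.gE ε x t = d.carrier x t *
      (exp (I * d.root ε * d.shiftP.eval ((ε : ℂ) ^ 2)) *
      (d.QP.eval ((ε : ℂ) ^ 2) + I * d.root ε) /
      (4 * d.lamP.eval ((ε : ℂ) ^ 2) * d.c * d.QP.eval ((ε : ℂ) ^ 2))) * I *
      (-d.QP.eval ((ε : ℂ) ^ 2) * Complex.sin (d.root ε * (d.YP x t).eval ((ε : ℂ) ^ 2)) -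
        d.root ε * Complex.cos (d.root ε * (d.YP x t).eval ((ε : ℂ) ^ 2))) := by
  have h1 := d.one_sub_ratio hl hc
  have h2 := d.one_add_ratio hl hc hQ hw
  have hc' : (d.c : ℂ) ≠ 0 := by exact_mod_cast hc
  set θ := d.root ε * (d.YP x t).eval ((ε : ℂ) ^ 2) with hθ
  have e1 : d.expPos ε x t = exp (I * d.root ε * d.shiftP.eval ((ε : ℂ) ^ 2)) *
      (Complex.cos θ + Complex.sin θ * I) := by
    rw [← exp_mul_I, expPos, ← exp_add, hθ]; congr 1; ring
  have e2 : d.expNeg ε x t = exp (I * d.root ε * d.shiftP.eval ((ε : ℂ) ^ 2)) *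
      (Complex.cos θ - Complex.sin θ * I) := by
    have : Complex.cos θ - Complex.sin θ * I = exp (-θ * I) := by
      rw [exp_mul_I, Complex.cos_neg, Complex.sin_neg]; ring
    rw [this, expNeg, ← exp_add, hθ]; congr 1; ring
  rw [fE_eq, gE_eq, e1, e2]
  set E := exp (I * d.root ε * d.shiftP.eval ((ε : ℂ) ^ 2))
  set U := (d.QP.eval ((ε : ℂ) ^ 2) + I * d.root ε) /
      (4 * d.lamP.eval ((ε : ℂ) ^ 2) * d.c * d.QP.eval ((ε : ℂ) ^ 2)) with hU
  have h1' : 1 - d.ratio ε = U * d.QP.eval ((ε : ℂ) ^ 2) := by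
    rw [h1, hU]; field_simp
  have h2' : 1 + d.ratio ε = -I * d.root ε * U := by
    rw [h2, hU]; ring
  rw [mul_div_assoc, ← hU]
  constructor
  · linear_combination conj (d.carrier x t) * E * (Complex.cos θ * h2' + I * Complex.sin θ * h1')
  · linear_combination d.carrier x t * E * (Complex.cos θ * h2' - I * Complex.sin θ * h1')

lemma eval_truncSin (N : ℕ) (S Y : ℂ[X]) (z w : ℂ) (h : w ^ 2 = S.eval z) :
    w * (truncSin N S Y).eval z = ∑ k ∈ Finset.range N,
      (-1) ^ k / (2 * k + 1).factorial * (w * Y.eval z) ^ (2 * k + 1) := by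
  simp only [truncSin, eval_finsetSum, eval_mul, eval_C, eval_pow, ← h, Finset.mul_sum]
  refine Finset.sum_congr rfl fun k _ => ?_
  ring

lemma eval_truncCos (N : ℕ) (S Y : ℂ[X]) (z w : ℂ) (h : w ^ 2 = S.eval z) :
    (truncCos N S Y).eval z = ∑ k ∈ Finset.range N,
      (-1) ^ k / (2 * k).factorial * (w * Y.eval z) ^ (2 * k) := by
  simp only [truncCos, eval_finsetSum, eval_mul, eval_C, eval_pow, ← h]
  refine Finset.sum_congr rfl fun k _ => ?_
  ring

variable {d}

lemma root_zero (ha : d.a < 1)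
    (hsq : ∀ᶠ ε in 𝓝 (0 : ℝ), d.root ε ^ 2 = S d.a d.c (lamOdd d.a d.c ε)) : d.root 0 = 0 := by
  have h := hsq.self_of_nhds
  rw [S_eq] at h
  have := SP_coeff_zero ha
  rw [coeff_zero_eq_eval_zero] at this
  simpa [this] using h

/-- The root is `ε` times a non-vanishing analytic function. -/
lemma root_factor (ha : d.a < 1) (hc : d.c ≠ 0) (hroot : AnalyticAt ℝ d.root 0)
    (hsq : ∀ᶠ ε in 𝓝 (0 : ℝ), d.root ε ^ 2 = S d.a d.c (lamOdd d.a d.c ε)) :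
    ∃ v : ℝ → ℂ, AnalyticAt ℝ v 0 ∧ v 0 ≠ 0 ∧ ∀ᶠ ε in 𝓝 (0 : ℝ), d.root ε = ε * v ε := by
  obtain ⟨v, hv, hv'⟩ := (natCast_le_analyticOrderAt (n := 1) hroot).1 (by
    rw [natCast_le_analyticOrderAt_iff_iteratedDeriv_eq_zero hroot]
    intro i hi
    obtain rfl : i = 0 := by omega
    simpa using root_zero ha hsq)
  have hv'' : ∀ᶠ ε in 𝓝 (0 : ℝ), d.root ε = ε * v ε :=
    hv'.mono fun ε h => by simpa using h
  refine ⟨v, hv, ?_, hv''⟩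
  obtain ⟨T, hT⟩ := X_dvd_iff.2 (SP_coeff_zero ha)
  have hT0 : T.eval 0 ≠ 0 := by
    rw [← coeff_zero_eq_eval_zero]
    have := SP_coeff_one_ne ha hc
    rwa [hT, coeff_X_mul] at this
  -- With `S = z * T`, dividing `root² = S` by `ε²` gives `v² = T(ε²)` off `0`. Continuity extends
  -- this to `v 0 ^ 2 = T 0`, which is nonzero.
  have h1 : ∀ᶠ ε in 𝓝[≠] (0 : ℝ), v ε ^ 2 = T.eval ((ε : ℂ) ^ 2) := by
    filter_upwards [hv''.filter_mono nhdsWithin_le_nhds, hsq.filter_mono nhdsWithin_le_nhds,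
      self_mem_nhdsWithin] with ε h1 h2 h3
    have h3' : (ε : ℂ) ≠ 0 := by exact_mod_cast h3
    rw [S_eq, hT, eval_mul, eval_X, h1] at h2
    apply mul_left_cancel₀ (pow_ne_zero 2 h3')
    linear_combination h2
  have h2 : Tendsto (fun ε => v ε ^ 2) (𝓝[≠] (0 : ℝ)) (𝓝 (v 0 ^ 2)) :=
    (hv.continuousAt.pow 2).tendsto.mono_left nhdsWithin_le_nhds
  have h3 : Tendsto (fun ε : ℝ => T.eval ((ε : ℂ) ^ 2)) (𝓝[≠] (0 : ℝ))
      (𝓝 (T.eval (((0 : ℝ) : ℂ) ^ 2))) :=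
    (analyticAt_eval_sq T 0).continuousAt.tendsto.mono_left nhdsWithin_le_nhds
  have h4 := tendsto_nhds_unique (h2.congr' h1) h3
  intro h0
  rw [h0] at h4
  simp at h4
  exact hT0 h4.symm

lemma lamP_eval_zero : d.lamP.eval 0 = d.lam₀ := by simp [lamP]

lemma eventually_ne (ha : d.a < 1) (hc : d.c ≠ 0) : ∀ᶠ ε : ℝ in 𝓝 0,
    d.lamP.eval ((ε : ℂ) ^ 2) ≠ 0 ∧ d.QP.eval ((ε : ℂ) ^ 2) ≠ 0 := by
  refine ((analyticAt_eval_sq d.lamP 0).continuousAt.eventually_ne ?_).and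
    ((analyticAt_eval_sq d.QP 0).continuousAt.eventually_ne ?_)
  · simpa [lamP_eval_zero] using lam₀_ne_zero ha
  · simpa [coeff_zero_eq_eval_zero] using QP_coeff_zero_ne ha hc

/-- `unitE` vanishes to first order exactly. -/
lemma unitE_factor (ha : d.a < 1) (hc : d.c ≠ 0) (hroot : AnalyticAt ℝ d.root 0)
    (hsq : ∀ᶠ ε in 𝓝 (0 : ℝ), d.root ε ^ 2 = S d.a d.c (lamOdd d.a d.c ε)) :
    ∃ v : ℝ → ℂ, AnalyticAt ℝ v 0 ∧ v 0 ≠ 0 ∧ ∀ᶠ ε in 𝓝 (0 : ℝ), d.unitE ε = ε * v ε := by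
  obtain ⟨v, hv, hv0, hv'⟩ := root_factor ha hc hroot hsq
  have hc' : (d.c : ℂ) ≠ 0 := by exact_mod_cast hc
  obtain ⟨h1, h2⟩ := (eventually_ne ha hc).self_of_nhds
  have hr0 := root_zero ha hsq
  have := analyticAt_eval_sq d.shiftP 0
  have := analyticAt_eval_sq d.QP 0
  have := analyticAt_eval_sq d.lamP 0
  refine ⟨fun ε => I * v ε * (exp (I * d.root ε * d.shiftP.eval ((ε : ℂ) ^ 2)) *
    (d.QP.eval ((ε : ℂ) ^ 2) + I * d.root ε) /
      (4 * d.lamP.eval ((ε : ℂ) ^ 2) * d.c * d.QP.eval ((ε : ℂ) ^ 2))), ?_, ?_, ?_⟩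
  · refine AnalyticAt.mul (by fun_prop) (AnalyticAt.div (by fun_prop) (by fun_prop) ?_)
    exact mul_ne_zero (mul_ne_zero (mul_ne_zero (by norm_num) h1) hc') h2
  · simp only [hr0, mul_zero, zero_mul, add_zero, exp_zero, one_mul]
    refine mul_ne_zero (mul_ne_zero I_ne_zero hv0) (div_ne_zero h2 ?_)
    exact mul_ne_zero (mul_ne_zero (mul_ne_zero (by norm_num) h1) hc') h2
  · filter_upwards [hv'] with ε h
    rw [unitE]; nth_rewrite 1 [h]; ring

/-- `F` agrees with `unitE ε · p(ε²)` up to order `2N+1`. -/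
def HasJet (d : Data) (F : ℝ → ℂ) (p : ℂ[X]) : Prop :=
  ∃ R : ℝ → ℂ, AnalyticAt ℝ R 0 ∧ ∀ᶠ ε in 𝓝 (0 : ℝ),
    F ε = d.unitE ε * p.eval ((ε : ℂ) ^ 2) + (ε : ℂ) ^ (2 * d.N + 1) * R ε


namespace HasJet

variable {F G : ℝ → ℂ} {p q : ℂ[X]}

lemma add (hF : d.HasJet F p) (hG : d.HasJet G q) :
    d.HasJet (fun ε => F ε + G ε) (p + q) := by
  obtain ⟨R, hR, h⟩ := hF
  obtain ⟨R', hR', h'⟩ := hG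
  refine ⟨fun ε => R ε + R' ε, by fun_prop, ?_⟩
  filter_upwards [h, h'] with ε h h'
  rw [h, h', eval_add]; ring

lemma mul_left (hF : d.HasJet F p) (q : ℂ[X]) :
    d.HasJet (fun ε => q.eval ((ε : ℂ) ^ 2) * F ε) (q * p) := by
  obtain ⟨R, hR, h⟩ := hF
  have := analyticAt_eval_sq q 0
  refine ⟨fun ε => q.eval ((ε : ℂ) ^ 2) * R ε, by fun_prop, ?_⟩
  filter_upwards [h] with ε h
  rw [h, eval_mul]; ring

lemma const_mul (hF : d.HasJet F p) (z : ℂ) : d.HasJet (fun ε => z * F ε) (C z * p) := by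
  simpa using hF.mul_left (C z)

lemma sum {ι : Type*} (s : Finset ι) {F : ι → ℝ → ℂ} {p : ι → ℂ[X]}
    (h : ∀ i ∈ s, d.HasJet (F i) (p i)) :
    d.HasJet (fun ε => ∑ i ∈ s, F i ε) (∑ i ∈ s, p i) := by
  classical
  induction s using Finset.induction_on with
  | empty => exact ⟨0, analyticAt_const, by simp⟩
  | insert i s hi ih =>
    simp only [Finset.sum_insert hi]
    exact (h i (Finset.mem_insert_self i s)).add
      (ih fun j hj => h j (Finset.mem_insert_of_mem hj))

end HasJet

/-- The coefficients of the jet of `F` in its odd derivatives. -/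
noncomputable def jetCoeff (d : Data) (i l : ℕ) : ℂ :=
  iteratedDeriv (2 * i + 1) (fun ε : ℝ => d.unitE ε * (ε : ℂ) ^ (2 * l)) 0

section

variable (ha : d.a < 1) (hc : d.c ≠ 0) (hroot : AnalyticAt ℝ d.root 0)
    (hsq : ∀ᶠ ε in 𝓝 (0 : ℝ), d.root ε ^ 2 = S d.a d.c (lamOdd d.a d.c ε))
include ha hc hroot hsq

lemma unitE_analyticAt : AnalyticAt ℝ d.unitE 0 := by
  obtain ⟨v, hv, -, h⟩ := unitE_factor ha hc hroot hsq
  exact AnalyticAt.congr (f := fun ε : ℝ => (ε : ℂ) * v ε) (by fun_prop)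
    (h.mono fun ε hε => hε.symm)

/-- Since `unitE` vanishes at `0`, its product with `ε ^ (2 * l)` has order at least `2 * l + 1 > 2
* i + 1`. So `jetCoeff` is lower triangular; by the next lemma its diagonal is nonzero. This makes
the odd derivatives equivalent to the jet coefficients, whatever the even part of `unitE`. -/
lemma jetCoeff_eq_zero {i l : ℕ} (h : i < l) : d.jetCoeff i l = 0 := by
  obtain ⟨v, hv, -, hv'⟩ := unitE_factor ha hc hroot hsq
  have e : (fun ε : ℝ => d.unitE ε * (ε : ℂ) ^ (2 * l)) =ᶠ[𝓝 0]
      fun ε : ℝ => (ε : ℂ) ^ (2 * l + 1) * v ε := by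
    filter_upwards [hv'] with ε hε
    rw [hε]; ring
  rw [jetCoeff, e.iteratedDeriv_eq, iteratedDeriv_pow_mul_eq_zero hv (by omega)]

lemma jetCoeff_self_ne_zero (i : ℕ) : d.jetCoeff i i ≠ 0 := by
  obtain ⟨v, hv, hv0, hv'⟩ := unitE_factor ha hc hroot hsq
  have e : (fun ε : ℝ => d.unitE ε * (ε : ℂ) ^ (2 * i)) =ᶠ[𝓝 0]
      fun ε : ℝ => (ε : ℂ) ^ (2 * i + 1) * v ε := by
    filter_upwards [hv'] with ε hε
    rw [hε]; ring
  rw [jetCoeff, e.iteratedDeriv_eq, iteratedDeriv_pow_mul_self hv]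
  exact mul_ne_zero (by exact_mod_cast Nat.factorial_ne_zero _) hv0

lemma HasJet.analyticAt {F : ℝ → ℂ} {p : ℂ[X]} (hF : d.HasJet F p) : AnalyticAt ℝ F 0 := by
  obtain ⟨R, hR, h⟩ := hF
  have := unitE_analyticAt ha hc hroot hsq
  have := analyticAt_eval_sq p 0
  exact AnalyticAt.congr (f := fun ε : ℝ => d.unitE ε * p.eval ((ε : ℂ) ^ 2) +
    (ε : ℂ) ^ (2 * d.N + 1) * R ε) (by fun_prop) (h.mono fun ε hε => hε.symm)

/-- For `i < N` the order `2 * i + 1` stays below `2 * N + 1`, so the remainder does not contribute.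
-/
lemma HasJet.iteratedDeriv_eq {F : ℝ → ℂ} {p : ℂ[X]} (hF : d.HasJet F p) {i : ℕ}
    (hi : i < d.N) :
    iteratedDeriv (2 * i + 1) F 0 = ∑ l ∈ Finset.range d.N, d.jetCoeff i l * p.coeff l := by
  obtain ⟨R, hR, h⟩ := hF
  have hu := unitE_analyticAt ha hc hroot hsq
  set M := max d.N (p.natDegree + 1) with hM
  have e : F =ᶠ[𝓝 0] fun ε : ℝ =>
      (∑ l ∈ Finset.range M, p.coeff l * (d.unitE ε * (ε : ℂ) ^ (2 * l))) +
        (ε : ℂ) ^ (2 * d.N + 1) * R ε := by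
    filter_upwards [h] with ε hε
    rw [hε, eval_eq_sum_range' (n := M) (by omega), Finset.mul_sum]
    congr 1
    refine Finset.sum_congr rfl fun l _ => ?_
    rw [← pow_mul]; ring
  have han : ∀ l, AnalyticAt ℝ (fun ε : ℝ => p.coeff l * (d.unitE ε * (ε : ℂ) ^ (2 * l))) 0 :=
    fun l => by fun_prop
  rw [e.iteratedDeriv_eq, iteratedDeriv_fun_add, iteratedDeriv_pow_mul_eq_zero hR (by omega),
    add_zero, iteratedDeriv_fun_sum fun l _ => (han l).contDiffAt]
  · have hj : ∀ l, iteratedDeriv (2 * i + 1) (fun ε : ℝ => d.unitE ε * (ε : ℂ) ^ (2 * l)) 0 =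
        d.jetCoeff i l := fun l => rfl
    simp only [iteratedDeriv_const_mul_field, hj]
    rw [← Finset.sum_subset (Finset.range_mono (le_max_left d.N (p.natDegree + 1)))]
    · exact Finset.sum_congr rfl fun l _ => mul_comm _ _
    · intro l _ hl
      rw [Finset.mem_range, not_lt] at hl
      rw [jetCoeff_eq_zero ha hc hroot hsq (by omega), mul_zero]
  · exact (Finset.analyticAt_fun_sum _ fun l _ => han l).contDiffAt
  · have : AnalyticAt ℝ (fun ε : ℝ => (ε : ℂ) ^ (2 * d.N + 1) * R ε) 0 := by fun_prop
    exact this.contDiffAt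

/-- If the odd derivatives vanish, so does the jet. -/
lemma HasJet.pow_dvd {F : ℝ → ℂ} {p : ℂ[X]} (hF : d.HasJet F p)
    (h : ∀ i < d.N, iteratedDeriv (2 * i + 1) F 0 = 0) : X ^ d.N ∣ p := by
  rw [X_pow_dvd_iff]
  intro i
  induction i using Nat.strong_induction_on with
  | _ i ih =>
    intro hi
    have h1 := h i hi
    rw [hF.iteratedDeriv_eq ha hc hroot hsq hi, Finset.sum_eq_single i] at h1
    · exact (mul_eq_zero.1 h1).resolve_left (jetCoeff_self_ne_zero ha hc hroot hsq i)
    · intro l hl hli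
      rcases lt_or_gt_of_ne hli with h2 | h2
      · rw [ih l h2 (Finset.mem_range.1 hl), mul_zero]
      · rw [jetCoeff_eq_zero ha hc hroot hsq h2, zero_mul]
    · exact fun h => absurd (Finset.mem_range.2 hi) h

/-- Replace sine and cosine in `fE_eq_trig` by their truncations. With `θ = root * Y` and `root = ε
* v`, the errors contain `θ ^ (2 * N + 1)` and `root * θ ^ (2 * N)`, both of order `ε ^ (2 * N +
1)`. -/
lemma hasJet_fE_gE (x t : ℝ) :
    d.HasJet (fun ε => d.fE ε x t) (d.fP x t) ∧ d.HasJet (fun ε => d.gE ε x t) (d.gP x t) := by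
  obtain ⟨v, hv, hv0, hv'⟩ := root_factor ha hc hroot hsq
  obtain ⟨Rs, hRs, hs⟩ := sin_eq_truncation_add d.N
  obtain ⟨Rc, hRc, hcs⟩ := cos_eq_truncation_add d.N
  have hr0 := root_zero ha hsq
  have hY := analyticAt_eval_sq (d.YP x t) 0
  have hQ := analyticAt_eval_sq d.QP 0
  have := analyticAt_eval_sq d.shiftP 0
  have := analyticAt_eval_sq d.lamP 0
  have hθ : AnalyticAt ℝ (fun ε : ℝ => d.root ε * (d.YP x t).eval ((ε : ℂ) ^ 2)) 0 := by fun_prop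
  have hθ0 : d.root 0 * (d.YP x t).eval (((0 : ℝ) : ℂ) ^ 2) = 0 := by rw [hr0, zero_mul]
  have hθt : Tendsto (fun ε : ℝ => d.root ε * (d.YP x t).eval ((ε : ℂ) ^ 2)) (𝓝 0) (𝓝 0) := by
    have := hθ.continuousAt.tendsto
    rwa [hθ0] at this
  obtain ⟨RS, hRS⟩ : ∃ RS : ℝ → ℂ, ∀ ε : ℝ,
      RS ε = Rs (d.root ε * (d.YP x t).eval ((ε : ℂ) ^ 2)) := ⟨_, fun _ => rfl⟩
  obtain ⟨RC, hRC⟩ : ∃ RC : ℝ → ℂ, ∀ ε : ℝ,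
      RC ε = Rc (d.root ε * (d.YP x t).eval ((ε : ℂ) ^ 2)) := ⟨_, fun _ => rfl⟩
  have hRs' : AnalyticAt ℝ RS 0 := by
    rw [funext hRS]
    exact (hRs.restrictScalars (𝕜 := ℝ)).comp_of_eq hθ hθ0
  have hRc' : AnalyticAt ℝ RC 0 := by
    rw [funext hRC]
    exact (hRc.restrictScalars (𝕜 := ℝ)).comp_of_eq hθ hθ0
  obtain ⟨hl0, hQ0⟩ := (eventually_ne ha hc).self_of_nhds
  have hc' : (d.c : ℂ) ≠ 0 := by exact_mod_cast hc
  have hU : AnalyticAt ℝ (fun ε : ℝ => exp (I * d.root ε * d.shiftP.eval ((ε : ℂ) ^ 2)) *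
      (d.QP.eval ((ε : ℂ) ^ 2) + I * d.root ε) /
      (4 * d.lamP.eval ((ε : ℂ) ^ 2) * d.c * d.QP.eval ((ε : ℂ) ^ 2))) 0 :=
    AnalyticAt.div (by fun_prop) (by fun_prop)
      (mul_ne_zero (mul_ne_zero (mul_ne_zero (by norm_num) hl0) hc') hQ0)
  set U : ℝ → ℂ := fun ε : ℝ => exp (I * d.root ε * d.shiftP.eval ((ε : ℂ) ^ 2)) *
      (d.QP.eval ((ε : ℂ) ^ 2) + I * d.root ε) /
      (4 * d.lamP.eval ((ε : ℂ) ^ 2) * d.c * d.QP.eval ((ε : ℂ) ^ 2)) with hUdef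
  constructor
  · refine ⟨fun ε => conj (d.carrier x t) * U ε * I * (d.QP.eval ((ε : ℂ) ^ 2) *
      (v ε * (d.YP x t).eval ((ε : ℂ) ^ 2)) ^ (2 * d.N + 1) *
        RS ε - v ε *
      (v ε * (d.YP x t).eval ((ε : ℂ) ^ 2)) ^ (2 * d.N) *
        RC ε), by fun_prop, ?_⟩
    filter_upwards [hv', hsq, eventually_ne ha hc, hθt.eventually hs, hθt.eventually hcs]
      with ε h1 h2 h3 h4 h5
    rw [(fE_eq_trig d h3.1 hc h3.2 h2 x t).1, h4, h5, ← hRS, ← hRC, fP, fJ]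
    have h2' := h2
    rw [S_eq] at h2'
    rw [← eval_truncSin _ _ _ _ _ h2', ← eval_truncCos _ _ _ _ _ h2']
    simp only [eval_mul, eval_C, eval_sub, unitE]
    change conj (d.carrier x t) * U ε * I * _ = I * d.root ε * U ε * _ + _
    have h6 : (d.root ε * (d.YP x t).eval ((ε : ℂ) ^ 2)) ^ (2 * d.N + 1) =
      (ε : ℂ) ^ (2 * d.N + 1) * (v ε * (d.YP x t).eval ((ε : ℂ) ^ 2)) ^ (2 * d.N + 1) := by
      rw [h1]; ring
    have h7 : d.root ε * (d.root ε * (d.YP x t).eval ((ε : ℂ) ^ 2)) ^ (2 * d.N) =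
      (ε : ℂ) ^ (2 * d.N + 1) * (v ε * (v ε * (d.YP x t).eval ((ε : ℂ) ^ 2)) ^ (2 * d.N)) := by
      rw [h1]; ring
    linear_combination conj (d.carrier x t) * U ε * I * (d.QP.eval ((ε : ℂ) ^ 2) *
      RS ε * h6 -
      RC ε * h7)
  · refine ⟨fun ε => d.carrier x t * U ε * I * (-d.QP.eval ((ε : ℂ) ^ 2) *
      (v ε * (d.YP x t).eval ((ε : ℂ) ^ 2)) ^ (2 * d.N + 1) *
        RS ε - v ε *
      (v ε * (d.YP x t).eval ((ε : ℂ) ^ 2)) ^ (2 * d.N) *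
        RC ε), by fun_prop, ?_⟩
    filter_upwards [hv', hsq, eventually_ne ha hc, hθt.eventually hs, hθt.eventually hcs]
      with ε h1 h2 h3 h4 h5
    rw [(fE_eq_trig d h3.1 hc h3.2 h2 x t).2, h4, h5, ← hRS, ← hRC, gP, gJ]
    have h2' := h2
    rw [S_eq] at h2'
    rw [← eval_truncSin _ _ _ _ _ h2', ← eval_truncCos _ _ _ _ _ h2']
    simp only [eval_mul, eval_C, eval_sub, eval_neg, unitE]
    change d.carrier x t * U ε * I * _ = I * d.root ε * U ε * _ + _
    have h6 : (d.root ε * (d.YP x t).eval ((ε : ℂ) ^ 2)) ^ (2 * d.N + 1) =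
      (ε : ℂ) ^ (2 * d.N + 1) * (v ε * (d.YP x t).eval ((ε : ℂ) ^ 2)) ^ (2 * d.N + 1) := by
      rw [h1]; ring
    have h7 : d.root ε * (d.root ε * (d.YP x t).eval ((ε : ℂ) ^ 2)) ^ (2 * d.N) =
      (ε : ℂ) ^ (2 * d.N + 1) * (v ε * (v ε * (d.YP x t).eval ((ε : ℂ) ^ 2)) ^ (2 * d.N)) := by
      rw [h1]; ring
    linear_combination d.carrier x t * U ε * I * (-d.QP.eval ((ε : ℂ) ^ 2) *
      RS ε * h6 -
      RC ε * h7)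

end

end Rows

end Data

end CLL

/-! ### Maximal minors and the interpolation conditions -/

namespace CLL

section Minors

/-- The vector of signed maximal minors of an `n × (n+1)` matrix. -/
noncomputable def minorVec {n : ℕ} (E : Matrix (Fin n) (Fin (n + 1)) ℂ) (j : Fin (n + 1)) : ℂ :=
  (-1) ^ j.1 * (E.submatrix id j.succAbove).det

/-- Prepending a copy of row `k` gives a square matrix with a repeated row; its expansion along that
first row is the asserted sum. -/
lemma mulVec_minorVec {n : ℕ} (E : Matrix (Fin n) (Fin (n + 1)) ℂ) :
    E.mulVec (minorVec E) = 0 := by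
  funext k
  let M : Matrix (Fin (n + 1)) (Fin (n + 1)) ℂ := Matrix.of (Fin.cons (E k) E)
  have h0 : M.det = 0 := by
    refine Matrix.det_zero_of_row_eq (i := 0) (j := k.succ) (Fin.succ_ne_zero k).symm ?_
    rfl
  rw [Matrix.det_succ_row_zero] at h0
  rw [Pi.zero_apply, ← h0, Matrix.mulVec, dotProduct]
  refine Finset.sum_congr rfl fun j _ => ?_
  rw [minorVec]
  have : (M.submatrix Fin.succ j.succAbove) = E.submatrix id j.succAbove := rfl
  rw [this]
  change E k j * _ = _ * E k j * _
  ring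

/-- The permutation exchanging the members of each pair `2k, 2k+1`. -/
def swapPairs (N : ℕ) : Equiv.Perm (Fin (2 * N)) :=
  (finProdFinEquiv.trans (finCongr (mul_comm N 2))).permCongr
    (Equiv.prodCongrRight fun _ => Equiv.swap (0 : Fin 2) 1)

lemma sign_swapPairs (N : ℕ) : Equiv.Perm.sign (swapPairs N) = (-1) ^ N := by
  rw [swapPairs, Equiv.Perm.sign_permCongr, Equiv.Perm.sign_prodCongrRight]
  simp

lemma swapPairs_val (N : ℕ) (i : Fin (2 * N)) :
    (swapPairs N i).1 = if Even i.1 then i.1 + 1 else i.1 - 1 := by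
  have h1 : (swapPairs N i).1 =
      (Equiv.swap (0 : Fin 2) 1 ⟨i.1 % 2, Nat.mod_lt _ two_pos⟩).1 + 2 * (i.1 / 2) := rfl
  rw [h1]
  rcases Nat.even_or_odd' i.1 with ⟨m, hm | hm⟩
  · have h2 : (⟨i.1 % 2, Nat.mod_lt _ two_pos⟩ : Fin 2) = 0 := by ext; simp; omega
    rw [h2, Equiv.swap_apply_left, if_pos ⟨m, by omega⟩]
    simp; omega
  · have h2 : (⟨i.1 % 2, Nat.mod_lt _ two_pos⟩ : Fin 2) = 1 := by ext; simp; omega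
    rw [h2, Equiv.swap_apply_right, if_neg (by rw [Nat.not_even_iff_odd]; exact ⟨m, hm⟩)]
    simp; omega

lemma conj_det {N : ℕ} {M M' : Matrix (Fin (2 * N)) (Fin (2 * N)) ℂ} {s : Fin (2 * N) → ℂ}
    (h : ∀ i j, conj (M i j) = s j * M' (swapPairs N i) j) :
    conj M.det = (-1) ^ N * (∏ j, s j) * M'.det := by
  have e : (starRingEnd ℂ).mapMatrix M =
      Matrix.of fun i j => s j * (M'.submatrix (swapPairs N) id) i j := by
    ext i j
    simp [h]
  rw [RingHom.map_det, e, Matrix.det_mul_row, Matrix.det_permute, sign_swapPairs]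
  push_cast
  ring

/-- The sign of column `j` under the pairing symmetry. -/
def colSign (N : ℕ) (j : Fin (2 * N)) : ℂ := (-1) ^ (2 * N - 1 - j.1)

/-- This product cancels the sign `(-1) ^ N` of the `N` row transpositions, so conjugation turns
`det Delta₂` into `det Delta₁` without a sign. -/
lemma prod_colSign (N : ℕ) : ∏ j, colSign N j = (-1) ^ N := by
  have h1 : ∏ j, colSign N j = ∏ j ∈ Finset.range (2 * N), (-1 : ℂ) ^ (2 * N - 1 - j) := by
    rw [Finset.prod_range]; rfl
  have h2 : ∀ n : ℕ, ∏ j ∈ Finset.range (2 * n), (-1 : ℂ) ^ j = (-1) ^ n := by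
    intro n
    induction n with
    | zero => simp
    | succ n ih =>
      rw [show 2 * (n + 1) = 2 * n + 1 + 1 by ring, Finset.prod_range_succ,
        Finset.prod_range_succ, ih, pow_succ, pow_succ, pow_mul]
      simp
  rw [h1, Finset.prod_range_reflect (fun j => (-1 : ℂ) ^ j), h2]

/-- The sign of column `j` of `Delta₃` under the pairing symmetry. -/
def colSign₃ (N : ℕ) (j : Fin (2 * N)) : ℂ := (if j.1 = 0 then -1 else 1) * colSign N j

/-- The first column of `Delta₃` carries `λ ^ (2 * N)` in place of `λ ^ (2 * N - 1)`, which costs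
one more sign. -/
lemma prod_colSign₃ {N : ℕ} (hN : 1 ≤ N) : ∏ j, colSign₃ N j = -(-1) ^ N := by
  simp only [colSign₃, Finset.prod_mul_distrib, prod_colSign]
  rw [Finset.prod_eq_single ⟨0, by omega⟩]
  · simp
  · intro j _ hj
    rw [if_neg]
    intro h; exact hj (Fin.ext h)
  · simp

/-- Spectral data invariant under `λ ↦ -λ̄`. -/
structure Paired {N : ℕ} (lam f g : Fin (2 * N) → ℂ) : Prop where
  lam_swap : ∀ i, lam (swapPairs N i) = -conj (lam i)
  f_swap : ∀ i, f (swapPairs N i) = conj (g i)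
  g_swap : ∀ i, g (swapPairs N i) = conj (f i)

namespace Paired

variable {N : ℕ} {lam f g : Fin (2 * N) → ℂ}

lemma conj_pow (h : Paired lam f g) (i : Fin (2 * N)) (m : ℕ) :
    conj (lam i) ^ m = (-1) ^ m * lam (swapPairs N i) ^ m := by
  rw [h.lam_swap, ← mul_pow]; ring

lemma conj_Delta₂ (h : Paired lam f g) (i j : Fin (2 * N)) :
    conj (Delta₂ lam f g i j) = colSign N j * Delta₁ lam f g (swapPairs N i) j := by
  simp only [Delta₂, Delta₁, Matrix.of_apply, map_mul, map_pow, h.conj_pow, colSign, h.f_swap,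
    h.g_swap]
  split_ifs <;> ring

lemma conj_Delta₃ (h : Paired lam f g) (i j : Fin (2 * N)) :
    conj (Delta₃ lam f g i j) = colSign₃ N j * Delta₄ lam f g (swapPairs N i) j := by
  simp only [Delta₄, Delta₃, Matrix.of_apply]
  by_cases hj : j.1 = 0
  · have h1 : (-1 : ℂ) ^ (2 * N) = 1 := by rw [pow_mul]; simp
    have h2 : (-1 : ℂ) ^ (2 * N - 1) = -1 := by
      have : 2 * N - 1 = 2 * (N - 1) + 1 := by have := j.2; omega
      rw [this, pow_succ, pow_mul]; simp
    simp only [hj, if_true, map_mul, map_pow, h.conj_pow, h.g_swap, colSign₃, colSign, h1,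
      Nat.sub_zero, h2]
    ring
  · simp only [hj, if_false, map_mul, map_pow, h.conj_pow, colSign₃, colSign, one_mul, h.f_swap,
      h.g_swap]
    split_ifs <;> ring

/-- Each pair contributes `λ * (-λ̄)`, a real number. The product is the constant `κ` linking the
last entry of the kernel vector to the conjugate of the first; its reality rules out nonreal
rescalings. -/
lemma conj_prod_lam (h : Paired lam f g) : conj (∏ i, lam i) = ∏ i, lam i := by
  rw [map_prod, ← Equiv.prod_comp (swapPairs N) lam]
  have : ∀ i, lam (swapPairs N i) = -1 * conj (lam i) := fun i => by rw [h.lam_swap]; ring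
  simp only [this, Finset.prod_mul_distrib]
  simp [pow_mul]

lemma conj_det_Delta₂ (h : Paired lam f g) :
    conj (Delta₂ lam f g).det = (Delta₁ lam f g).det := by
  rw [conj_det h.conj_Delta₂, prod_colSign, ← mul_pow]; simp

end Paired

/-- The `2N × (2N+1)` matrix containing all the columns of the matrices `Δ`. -/
noncomputable def extMatrix {N : ℕ} (lam f g : Fin (2 * N) → ℂ) :
    Matrix (Fin (2 * N)) (Fin (2 * N + 1)) ℂ :=
  Matrix.of fun k j => lam k ^ (2 * N - j.1) * (if Even j.1 then f k else g k)

section Columns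

variable {N : ℕ} (lam f g : Fin (2 * N) → ℂ)

lemma extMatrix_succ (i : Fin (2 * N)) (j : Fin (2 * N)) :
    extMatrix lam f g i j.succ = Delta₂ lam f g i j := by
  simp only [extMatrix, Delta₂, Delta₁, Matrix.of_apply, Fin.val_succ, Nat.even_add_one]
  rw [show 2 * N - (j.1 + 1) = 2 * N - 1 - j.1 by omega]
  split_ifs <;> rfl

lemma extMatrix_succAbove_one (hN : 1 ≤ N) (i : Fin (2 * N)) (j : Fin (2 * N)) :
    extMatrix lam f g i (Fin.succAbove ⟨1, by omega⟩ j) = Delta₃ lam f g i j := by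
  simp only [extMatrix, Delta₃, Matrix.of_apply]
  by_cases hj : j.1 = 0
  · have : (Fin.succAbove ⟨1, by omega⟩ j : Fin (2 * N + 1)).1 = 0 := by
      rw [Fin.succAbove_of_castSucc_lt _ _ (by rw [Fin.lt_def]; simp [hj])]; simp [hj]
    simp [this, hj]
  · have : (Fin.succAbove ⟨1, by omega⟩ j : Fin (2 * N + 1)).1 = j.1 + 1 := by
      rw [Fin.succAbove_of_le_castSucc _ _ (by rw [Fin.le_def]; simp; omega)]; simp
    rw [this, if_neg hj, show 2 * N - (j.1 + 1) = 2 * N - 1 - j.1 by omega]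
    simp only [Nat.even_add_one]
    split_ifs <;> rfl

lemma extMatrix_castSucc (i : Fin (2 * N)) (j : Fin (2 * N)) :
    extMatrix lam f g i j.castSucc = lam i * Delta₁ lam f g i j := by
  simp only [extMatrix, Delta₁, Matrix.of_apply, Fin.val_castSucc]
  have := j.2
  rw [show 2 * N - j.1 = 2 * N - 1 - j.1 + 1 by omega, pow_succ]
  ring

lemma minorVec_extMatrix_zero : minorVec (extMatrix lam f g) 0 = (Delta₂ lam f g).det := by
  have : (extMatrix lam f g).submatrix id (Fin.succAbove 0) = Delta₂ lam f g := by
    ext i j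
    rw [Matrix.submatrix_apply, Fin.succAbove_zero, id, extMatrix_succ]
  rw [minorVec, this]; simp

lemma minorVec_extMatrix_one (hN : 1 ≤ N) :
    minorVec (extMatrix lam f g) ⟨1, by omega⟩ = -(Delta₃ lam f g).det := by
  have : (extMatrix lam f g).submatrix id (Fin.succAbove ⟨1, by omega⟩) = Delta₃ lam f g := by
    ext i j
    rw [Matrix.submatrix_apply, id, extMatrix_succAbove_one lam f g hN]
  rw [minorVec, this]; simp

/-- The first `2 * N` columns are those of `Delta₁` with row `k` multiplied by `λ_k`. -/
lemma minorVec_extMatrix_last :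
    minorVec (extMatrix lam f g) (Fin.last _) = (∏ i, lam i) * (Delta₁ lam f g).det := by
  have : (extMatrix lam f g).submatrix id (Fin.succAbove (Fin.last _)) =
      Matrix.of fun i j => lam i * Delta₁ lam f g i j := by
    ext i j
    rw [Matrix.submatrix_apply, Fin.succAbove_last, id, extMatrix_castSucc]; rfl
  rw [minorVec, this, Matrix.det_mul_column]
  simp [pow_mul]

end Columns

end Minors

namespace Data

variable (d : Data)

section

variable {d}

lemma f_eq (x t : ℝ) (e : Fin d.N → ℝ) (m : Fin (2 * d.N)) :
    d.f x t e m = if Even m.1 then d.fE (d.epsOf e m) x t else conj (d.gE (d.epsOf e m) x t) := by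
  unfold f fE gE
  split_ifs
  · rfl
  · rw [map_add, conj_conj, add_comm]

lemma g_eq (x t : ℝ) (e : Fin d.N → ℝ) (m : Fin (2 * d.N)) :
    d.g x t e m = if Even m.1 then d.gE (d.epsOf e m) x t else conj (d.fE (d.epsOf e m) x t) := by
  unfold g fE gE
  split_ifs
  · rfl
  · rw [map_add, conj_conj, add_comm]

lemma paired (x t : ℝ) (e : Fin d.N → ℝ) : Paired (d.lam e) (d.f x t e) (d.g x t e) := by
  have key : ∀ i : Fin (2 * d.N), (Even (swapPairs d.N i).1 ↔ ¬ Even i.1) ∧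
      d.epsOf e (swapPairs d.N i) = d.epsOf e i := by
    intro i
    unfold epsOf
    simp only [swapPairs_val]
    by_cases h : Even i.1
    · simp only [h, if_true, not_true, iff_false, Nat.not_even_iff_odd]
      refine ⟨h.add_one, ?_⟩
      rcases h with ⟨m, hm⟩
      congr 2; omega
    · simp only [h, if_false, not_false_eq_true, iff_true]
      rw [Nat.not_even_iff_odd] at h
      rcases h with ⟨m, hm⟩
      exact ⟨⟨m, by omega⟩, by congr 2; omega⟩
  constructor
  · intro i
    simp only [lam, (key i).1, (key i).2]
    by_cases h : Even i.1 <;> simp [h]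
  · intro i
    rw [f_eq, g_eq]
    simp only [(key i).1, (key i).2]
    by_cases h : Even i.1 <;> simp [h]
  · intro i
    rw [f_eq, g_eq]
    simp only [(key i).1, (key i).2]
    by_cases h : Even i.1 <;> simp [h]

lemma order_swapPairs {N : ℕ} (i : Fin (2 * N)) :
    order ((swapPairs N i).1 + 1) = order (i.1 + 1) := by
  rw [swapPairs_val]
  unfold order
  rcases Nat.even_or_odd' i.1 with ⟨m, hm | hm⟩
  · have h1 : Even i.1 := ⟨m, by omega⟩
    have h2 : Odd (i.1 + 1) := ⟨m, by omega⟩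
    have h3 : ¬ Odd (i.1 + 1 + 1) := by rw [Nat.not_odd_iff_even]; exact ⟨m + 1, by omega⟩
    simp [h1, h2, h3]
  · have h1 : ¬ Even i.1 := by rw [Nat.not_even_iff_odd]; exact ⟨m, by omega⟩
    have h2 : ¬ Odd (i.1 + 1) := by rw [Nat.not_odd_iff_even]; exact ⟨m + 1, by omega⟩
    have h3 : Odd (i.1 - 1 + 1) := ⟨m, by omega⟩
    simp only [h1, h2, h3, if_true, if_false]; omega

lemma iteratedDeriv_conj (n : ℕ) (F : ℝ → ℂ) (x : ℝ) :
    iteratedDeriv n (fun ε => conj (F ε)) x = conj (iteratedDeriv n F x) := by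
  induction n generalizing x with
  | zero => simp
  | succ n ih =>
    rw [iteratedDeriv_succ, iteratedDeriv_succ, funext ih]
    exact deriv.star

lemma conj_hat {N : ℕ} {M M' : ℝ → Matrix (Fin (2 * N)) (Fin (2 * N)) ℂ} {s : Fin (2 * N) → ℂ}
    (h : ∀ ε i j, conj (M ε i j) = s j * M' ε (swapPairs N i) j) (i j : Fin (2 * N)) :
    conj (hat M i j) = s j * hat M' (swapPairs N i) j := by
  simp only [hat, Matrix.of_apply, order_swapPairs, ← iteratedDeriv_conj, h,
    iteratedDeriv_const_mul_field]

lemma conj_det_hatDelta₂ (x t : ℝ) : conj (d.hatDelta₂ x t).det = (d.hatDelta₁ x t).det := by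
  rw [hatDelta₂, conj_det (conj_hat fun ε i j => (paired x t fun _ => ε).conj_Delta₂ i j),
    prod_colSign, ← mul_pow, hatDelta₁]
  simp

lemma conj_det_hatDelta₃ (hN : 1 ≤ d.N) (x t : ℝ) :
    conj (d.hatDelta₃ x t).det = -(d.hatDelta₄ x t).det := by
  rw [hatDelta₃, conj_det (conj_hat fun ε i j => (paired x t fun _ => ε).conj_Delta₃ i j),
    prod_colSign₃ hN, mul_neg, ← mul_pow, hatDelta₄]
  simp

/-- The confluent version of `extMatrix`. -/
noncomputable def hatExt (d : Data) (x t : ℝ) : Matrix (Fin (2 * d.N)) (Fin (2 * d.N + 1)) ℂ :=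
  Matrix.of fun i j => iteratedDeriv (order (i.1 + 1)) (fun ε =>
    extMatrix (d.lam fun _ => ε) (d.f x t fun _ => ε) (d.g x t fun _ => ε) i j) 0

lemma minorVec_hatExt_zero (x t : ℝ) : minorVec (d.hatExt x t) 0 = (d.hatDelta₂ x t).det := by
  have : (d.hatExt x t).submatrix id (Fin.succAbove 0) = d.hatDelta₂ x t := by
    ext i j
    simp only [Matrix.submatrix_apply, Fin.succAbove_zero, id, hatExt, Matrix.of_apply,
      extMatrix_succ]
    rfl
  rw [minorVec, this]; simp

lemma minorVec_hatExt_one (hN : 1 ≤ d.N) (x t : ℝ) :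
    minorVec (d.hatExt x t) ⟨1, by omega⟩ = -(d.hatDelta₃ x t).det := by
  have : (d.hatExt x t).submatrix id (Fin.succAbove ⟨1, by omega⟩) = d.hatDelta₃ x t := by
    ext i j
    simp only [Matrix.submatrix_apply, id, hatExt, Matrix.of_apply,
      extMatrix_succAbove_one _ _ _ hN]
    rfl
  rw [minorVec, this]; simp

lemma isEven_iff_exists {N : ℕ} (i : Fin (2 * N)) (h : Even i.1) :
    ∃ m < N, i.1 = 2 * m ∧ order (i.1 + 1) = 2 * m + 1 := by
  rcases h with ⟨m, hm⟩
  refine ⟨m, by have := i.2; omega, by omega, ?_⟩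
  rw [order, if_pos ⟨m, by omega⟩]; omega

lemma notEven_iff_exists {N : ℕ} (i : Fin (2 * N)) (h : ¬ Even i.1) :
    ∃ m < N, i.1 = 2 * m + 1 ∧ order (i.1 + 1) = 2 * m + 1 := by
  rw [Nat.not_even_iff_odd] at h
  rcases h with ⟨m, hm⟩
  refine ⟨m, by have := i.2; omega, by omega, ?_⟩
  rw [order, if_neg (by rw [Nat.not_odd_iff_even]; exact ⟨m + 1, by omega⟩)]; omega

open Polynomial in
/-- The confluent interpolation conditions for a coefficient vector `y`. -/
structure IsKer (d : Data) (x t : ℝ) (y : Fin (2 * d.N + 1) → ℂ) : Prop where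
  dvd₁ : X ^ d.N ∣ (evenPoly y).comp (d.lamP ^ 2) * d.fP x t +
    d.lamP * (oddPoly y).comp (d.lamP ^ 2) * d.gP x t
  dvd₂ : X ^ d.N ∣ (cj (evenPoly y)).comp (d.lamP ^ 2) * d.gP x t -
    d.lamP * (cj (oddPoly y)).comp (d.lamP ^ 2) * d.fP x t

section

open Polynomial

variable (ha : d.a < 1) (hc : d.c ≠ 0) (hroot : AnalyticAt ℝ d.root 0)
    (hsq : ∀ᶠ ε in 𝓝 (0 : ℝ), d.root ε ^ 2 = S d.a d.c (lamOdd d.a d.c ε))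
include ha hc

lemma conj_lam₀_sq_ne : conj (d.lam₀ ^ 2) ≠ d.lam₀ ^ 2 := by
  intro h
  have := congrArg Complex.im h
  rw [conj_im, sq, mul_im, lam₀_re, lam₀_im] at this
  have h2 := sqrt_pos' ha
  have h3 : Real.sqrt ((1 - d.a) / 2) * d.c = 0 := by linarith
  rcases mul_eq_zero.1 h3 with h4 | h4
  · exact h2.ne' h4
  · exact hc h4

lemma IsKer.herm_eq (hN : 1 ≤ d.N) {x t : ℝ} {y : Fin (2 * d.N + 1) → ℂ} (h : d.IsKer x t y) :
    herm (evenPoly y) (oddPoly y) = C (y 0 * conj (y 0)) *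
      ((X - C (d.lam₀ ^ 2)) ^ d.N * cj ((X - C (d.lam₀ ^ 2)) ^ d.N)) := by
  rw [← evenPoly_coeff_top y]
  exact herm_eq_of_dvd (evenPoly_natDegree_le y) (oddPoly_degree_lt y)
    ((monic_X_sub_C _).pow _)
    (by rw [natDegree_pow, natDegree_X_sub_C, mul_one]) (isCoprime_pow_cj (conj_lam₀_sq_ne ha hc) _)
    (pow_dvd_herm (lam₀_ne_zero ha) (fP_gP_coeff_zero ha hN x t) h.dvd₁ h.dvd₂)

lemma IsKer.eq_zero (hN : 1 ≤ d.N) {x t : ℝ} {y : Fin (2 * d.N + 1) → ℂ} (h : d.IsKer x t y)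
    (h0 : y 0 = 0) : y = 0 := by
  have h1 := h.herm_eq ha hc hN
  rw [h0, zero_mul, C_0, zero_mul] at h1
  have := herm_eq_zero h1
  exact eq_zero_of_evenPoly_oddPoly this.1 this.2

include hroot hsq

lemma hasJet_combination (x t : ℝ) (y : Fin (2 * d.N + 1) → ℂ) :
    d.HasJet (fun ε => ∑ j : Fin (2 * d.N + 1), y j * (lamOdd d.a d.c ε ^ (2 * d.N - j.1) *
        (if Even j.1 then d.fE ε x t else d.gE ε x t)))
      ((evenPoly y).comp (d.lamP ^ 2) * d.fP x t +
        d.lamP * (oddPoly y).comp (d.lamP ^ 2) * d.gP x t) := by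
  have h := sum_columns y d.lamP (d.fP x t) (d.gP x t)
  simp only [← comp_eq_aeval] at h
  rw [← h]
  refine HasJet.sum _ fun j _ => ?_
  obtain ⟨hf, hg⟩ := hasJet_fE_gE ha hc hroot hsq x t
  have h1 : d.HasJet (fun ε => if Even j.1 then d.fE ε x t else d.gE ε x t)
      (if Even j.1 then d.fP x t else d.gP x t) := by
    split_ifs
    exacts [hf, hg]
  have := (h1.mul_left (d.lamP ^ (2 * d.N - j.1))).const_mul (y j)
  rw [smul_eq_C_mul]
  simpa only [lamOdd_eq, eval_pow] using this

lemma hasJet_combination' (x t : ℝ) (y : Fin (2 * d.N + 1) → ℂ) :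
    d.HasJet (fun ε => ∑ j : Fin (2 * d.N + 1), y j * ((-lamOdd d.a d.c ε) ^ (2 * d.N - j.1) *
        (if Even j.1 then d.gE ε x t else d.fE ε x t)))
      ((evenPoly y).comp (d.lamP ^ 2) * d.gP x t -
        d.lamP * (oddPoly y).comp (d.lamP ^ 2) * d.fP x t) := by
  have h := sum_columns y (-d.lamP) (d.gP x t) (d.fP x t)
  simp only [← comp_eq_aeval] at h
  rw [neg_sq, neg_mul, neg_mul, ← sub_eq_add_neg] at h
  rw [← h]
  refine HasJet.sum _ fun j _ => ?_
  obtain ⟨hf, hg⟩ := hasJet_fE_gE ha hc hroot hsq x t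
  have h1 : d.HasJet (fun ε => if Even j.1 then d.gE ε x t else d.fE ε x t)
      (if Even j.1 then d.gP x t else d.fP x t) := by
    split_ifs
    exacts [hg, hf]
  have := (h1.mul_left ((-d.lamP) ^ (2 * d.N - j.1))).const_mul (y j)
  rw [smul_eq_C_mul]
  simpa only [lamOdd_eq, eval_pow, eval_neg] using this

/-- Vanishing of the odd derivatives of the two row functions implies the confluent
interpolation conditions. -/
lemma isKer_of_iteratedDeriv {x t : ℝ} {y : Fin (2 * d.N + 1) → ℂ}
    (h1 : ∀ i < d.N, iteratedDeriv (2 * i + 1) (fun ε => ∑ j : Fin (2 * d.N + 1), y j *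
      (lamOdd d.a d.c ε ^ (2 * d.N - j.1) * (if Even j.1 then d.fE ε x t else d.gE ε x t))) 0 = 0)
    (h2 : ∀ i < d.N, iteratedDeriv (2 * i + 1) (fun ε => ∑ j : Fin (2 * d.N + 1), conj (y j) *
      ((-lamOdd d.a d.c ε) ^ (2 * d.N - j.1) *
        (if Even j.1 then d.gE ε x t else d.fE ε x t))) 0 = 0) :
    d.IsKer x t y := by
  constructor
  · exact (hasJet_combination ha hc hroot hsq x t y).pow_dvd ha hc hroot hsq h1
  · rw [cj_evenPoly, cj_oddPoly]
    exact (hasJet_combination' ha hc hroot hsq x t _).pow_dvd ha hc hroot hsq h2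

lemma analyticAt_entry (x t : ℝ) (i : Fin (2 * d.N)) :
    AnalyticAt ℝ (fun ε => d.lam (fun _ => ε) i) 0 ∧
    AnalyticAt ℝ (fun ε => d.f x t (fun _ => ε) i) 0 ∧
    AnalyticAt ℝ (fun ε => d.g x t (fun _ => ε) i) 0 := by
  obtain ⟨hf, hg⟩ := hasJet_fE_gE ha hc hroot hsq x t
  have hf := hf.analyticAt ha hc hroot hsq
  have hg := hg.analyticAt ha hc hroot hsq
  have hconj : ∀ F : ℝ → ℂ, AnalyticAt ℝ F 0 → AnalyticAt ℝ (fun ε => conj (F ε)) 0 :=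
    fun F hF => ((conjCLE : ℂ →L[ℝ] ℂ).analyticAt _).comp hF
  have hl : AnalyticAt ℝ (fun ε => lamOdd d.a d.c ε) 0 := by unfold lamOdd; fun_prop
  by_cases h : Even i.1
  · simp only [lam, f_eq, g_eq, h, if_true, epsOf]
    exact ⟨hl, hf, hg⟩
  · simp only [lam, f_eq, g_eq, h, if_false, epsOf]
    exact ⟨(hconj _ hl).neg, hconj _ hg, hconj _ hf⟩

lemma analyticAt_extMatrix (x t : ℝ) (i : Fin (2 * d.N)) (j : Fin (2 * d.N + 1)) :
    AnalyticAt ℝ (fun ε =>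
      extMatrix (d.lam fun _ => ε) (d.f x t fun _ => ε) (d.g x t fun _ => ε) i j) 0 := by
  obtain ⟨h1, h2, h3⟩ := analyticAt_entry ha hc hroot hsq x t i
  simp only [extMatrix, Matrix.of_apply]
  split_ifs <;> fun_prop

lemma isKer_of_mulVec {x t : ℝ} {y : Fin (2 * d.N + 1) → ℂ} (h : (d.hatExt x t).mulVec y = 0) :
    d.IsKer x t y := by
  have key : ∀ i : Fin (2 * d.N), iteratedDeriv (order (i.1 + 1)) (fun ε => ∑ j, y j *
      extMatrix (d.lam fun _ => ε) (d.f x t fun _ => ε) (d.g x t fun _ => ε) i j) 0 = 0 := by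
    intro i
    have h1 := congrFun h i
    have han := analyticAt_extMatrix ha hc hroot hsq x t i
    have hcd : ∀ j ∈ Finset.univ, ContDiffAt ℝ (order (i.1 + 1)) (fun ε : ℝ => y j *
        extMatrix (d.lam fun _ => ε) (d.f x t fun _ => ε) (d.g x t fun _ => ε) i j) 0 :=
      fun j _ => AnalyticAt.contDiffAt (by have := han j; fun_prop)
    rw [iteratedDeriv_fun_sum hcd]
    simp only [iteratedDeriv_const_mul_field]
    rw [Pi.zero_apply, Matrix.mulVec, dotProduct] at h1
    rw [← h1]
    exact Finset.sum_congr rfl fun j _ => mul_comm _ _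
  apply isKer_of_iteratedDeriv ha hc hroot hsq
  · intro m hm
    have := key ⟨2 * m, by omega⟩
    have hev : Even (2 * m) := ⟨m, by omega⟩
    have hord : order (2 * m + 1) = 2 * m + 1 := by rw [order, if_pos ⟨m, by omega⟩]
    simpa only [hord, extMatrix, Matrix.of_apply, f_eq, g_eq, lam, hev, if_true, epsOf] using this
  · intro m hm
    have := key ⟨2 * m + 1, by omega⟩
    have hev : ¬ Even (2 * m + 1) := by rw [Nat.not_even_iff_odd]; exact ⟨m, by omega⟩
    have hord : order (2 * m + 1 + 1) = 2 * m + 1 := by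
      rw [order, if_neg (by rw [Nat.not_odd_iff_even]; exact ⟨m + 1, by omega⟩)]; omega
    simp only [hord, extMatrix, Matrix.of_apply, f_eq, g_eq, lam, hev, if_false, epsOf] at this
    have h3 := congrArg conj this
    rw [← iteratedDeriv_conj, map_zero] at h3
    rw [← h3]
    congr 1
    funext ε
    rw [map_sum]
    refine Finset.sum_congr rfl fun j _ => ?_
    split_ifs <;> simp

/-- A null vector of `hatDelta₂`, padded by a zero in front, lies in the kernel of `hatExt` and has
vanishing first entry. Only the zero vector does. -/
lemma det_hatDelta₂_ne_zero (hN : 1 ≤ d.N) (x t : ℝ) : (d.hatDelta₂ x t).det ≠ 0 := by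
  intro h
  obtain ⟨v, hv, hv'⟩ := Matrix.exists_mulVec_eq_zero_iff.2 h
  have h1 : (d.hatExt x t).mulVec (Fin.cons 0 v) = 0 := by
    funext i
    rw [← hv', Matrix.mulVec, Matrix.mulVec, dotProduct, dotProduct, Fin.sum_univ_succ]
    simp only [Fin.cons_zero, mul_zero, zero_add, Fin.cons_succ]
    refine Finset.sum_congr rfl fun j _ => ?_
    simp only [hatExt, Matrix.of_apply, extMatrix_succ]
    rfl
  have h2 := (isKer_of_mulVec ha hc hroot hsq h1).eq_zero ha hc hN rfl
  apply hv
  funext j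
  simpa using congrFun h2 j.succ

lemma det_hatDelta₁_ne_zero (hN : 1 ≤ d.N) (x t : ℝ) : (d.hatDelta₁ x t).det ≠ 0 := by
  rw [← conj_det_hatDelta₂]
  simpa using det_hatDelta₂_ne_zero ha hc hroot hsq hN x t

omit ha hc hroot hsq in
lemma iteratedDeriv_quadratic {l s : ℂ} {i : ℕ} (h0 : i ≠ 0) (h2 : i ≠ 2) :
    iteratedDeriv i (fun ε : ℝ => l + s * (ε : ℂ) ^ 2) 0 = 0 := by
  rw [iteratedDeriv_const_add (by omega), iteratedDeriv_const_mul_field]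
  have : (fun ε : ℝ => (ε : ℂ) ^ 2) = fun ε : ℝ => (ε ^ 2) • (1 : ℂ) := by ext; simp
  rw [this, iteratedDeriv_smul_const (by fun_prop), iteratedDeriv_fun_pow_zero, if_neg h2]
  simp

omit ha hc hroot hsq in
lemma iteratedDeriv_quadratic_mul (l s : ℂ) {F : ℝ → ℂ} (hF : AnalyticAt ℝ F 0) (m : ℕ) :
    iteratedDeriv (m + 2) (fun ε : ℝ => (l + s * (ε : ℂ) ^ 2) * F ε) 0 =
      l * iteratedDeriv (m + 2) F 0 + (m + 2).choose 2 *
        iteratedDeriv 2 (fun ε : ℝ => l + s * (ε : ℂ) ^ 2) 0 * iteratedDeriv m F 0 := by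
  have hp : AnalyticAt ℝ (fun ε : ℝ => l + s * (ε : ℂ) ^ 2) 0 := by fun_prop
  rw [iteratedDeriv_fun_mul hp.contDiffAt hF.contDiffAt,
    Finset.sum_eq_add_of_mem 0 2 (by simp) (by simp) (by norm_num)
      (fun i _ hi => by rw [iteratedDeriv_quadratic hi.1 hi.2, mul_zero, zero_mul])]
  simp

omit ha hc hroot hsq in
lemma iteratedDeriv_one_quadratic_mul (l s : ℂ) {F : ℝ → ℂ} (hF : AnalyticAt ℝ F 0) :
    iteratedDeriv 1 (fun ε : ℝ => (l + s * (ε : ℂ) ^ 2) * F ε) 0 = l * iteratedDeriv 1 F 0 := by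
  have hp : AnalyticAt ℝ (fun ε : ℝ => l + s * (ε : ℂ) ^ 2) 0 := by fun_prop
  rw [iteratedDeriv_fun_mul hp.contDiffAt hF.contDiffAt, Finset.sum_range_succ,
    Finset.sum_range_one, iteratedDeriv_quadratic one_ne_zero (by norm_num)]
  simp

/-- The last minor of `hatExt`. -/
lemma minorVec_hatExt_last (x t : ℝ) : minorVec (d.hatExt x t) (Fin.last _) =
    (∏ i, d.lam (fun _ => 0) i) * (d.hatDelta₁ x t).det := by
  let s : Fin (2 * d.N) → ℂ := fun i => if Even i.1 then 1 else -1
  have hlam : ∀ (ε : ℝ) i, d.lam (fun _ => ε) i = d.lam (fun _ => 0) i + s i * (ε : ℂ) ^ 2 := by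
    intro ε i
    simp only [lam, s, epsOf, lamOdd]
    split_ifs
    · simp
    · simp; ring
  -- As `λ = λ(0) ± ε²`, Leibniz' rule for the derivative of order `n_i` of `λ * Δ¹` leaves only the
  -- terms of orders `n_i` and `n_i - 2`. The latter belongs to the row two places above, from the
  -- same member of the pair. So multiplication by `λ` acts on the differentiated rows as a lower
  -- triangular matrix with diagonal `λ(0)`.
  let L : Matrix (Fin (2 * d.N)) (Fin (2 * d.N)) ℂ := Matrix.of fun i k =>
    if k = i then d.lam (fun _ => 0) i else if k.1 + 2 = i.1 then
      ((order (i.1 + 1)).choose 2 : ℂ) *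
        iteratedDeriv 2 (fun ε : ℝ => d.lam (fun _ => 0) i + s i * (ε : ℂ) ^ 2) 0 else 0
  have hL : L.BlockTriangular OrderDual.toDual := by
    intro i k hik
    have hik' : i < k := by simpa using hik
    simp only [L, Matrix.of_apply]
    rw [if_neg hik'.ne', if_neg]
    intro h
    have : i.1 < k.1 := hik'
    omega
  have hdet : L.det = ∏ i, d.lam (fun _ => 0) i := by
    rw [Matrix.det_of_isLowerTriangular L hL]
    simp [L]
  have han : ∀ i j, AnalyticAt ℝ (fun ε => Delta₁ (d.lam fun _ => ε) (d.f x t fun _ => ε)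
      (d.g x t fun _ => ε) i j) 0 := by
    intro i j
    obtain ⟨h1, h2, h3⟩ := analyticAt_entry ha hc hroot hsq x t i
    simp only [Delta₁, Matrix.of_apply]
    split_ifs <;> fun_prop
  have hsub : (d.hatExt x t).submatrix id (Fin.succAbove (Fin.last _)) = L * d.hatDelta₁ x t := by
    ext i j
    rw [Matrix.submatrix_apply, Fin.succAbove_last, id, hatExt, Matrix.of_apply, Matrix.mul_apply]
    have e : (fun ε => extMatrix (d.lam fun _ => ε) (d.f x t fun _ => ε) (d.g x t fun _ => ε) i
        j.castSucc) = fun ε : ℝ => (d.lam (fun _ => 0) i + s i * (ε : ℂ) ^ 2) *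
          Delta₁ (d.lam fun _ => ε) (d.f x t fun _ => ε) (d.g x t fun _ => ε) i j := by
      funext ε
      rw [extMatrix_castSucc, hlam ε i]
    rw [e]
    by_cases hi : 2 ≤ i.1
    · let k : Fin (2 * d.N) := ⟨i.1 - 2, by have := i.2; omega⟩
      have hk : k ≠ i := by intro h; have := congrArg Fin.val h; simp only [k] at this; omega
      rw [Finset.sum_eq_add_of_mem i k (Finset.mem_univ _) (Finset.mem_univ _) hk.symm]
      · have hord : order (i.1 + 1) = order (k.1 + 1) + 2 := by
          by_cases h : Even i.1
          · obtain ⟨m, _, h1, h2⟩ := isEven_iff_exists i h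
            obtain ⟨m', _, h3, h4⟩ := isEven_iff_exists k ⟨m - 1, by simp only [k]; omega⟩
            simp only [k] at h3; omega
          · obtain ⟨m, _, h1, h2⟩ := notEven_iff_exists i h
            obtain ⟨m', _, h3, h4⟩ := notEven_iff_exists k (by
              rw [Nat.not_even_iff_odd]; exact ⟨m - 1, by simp only [k]; omega⟩)
            simp only [k] at h3; omega
        have hk2 : k.1 + 2 = i.1 := by simp only [k]; omega
        simp only [L, Matrix.of_apply, if_true, hk, if_false, hk2, hatDelta₁, hat]
        rw [hord, iteratedDeriv_quadratic_mul _ _ (han i j)]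
        have hpar : Even k.1 ↔ Even i.1 := by rw [← hk2, Nat.even_add]; simp
        have hrow : ∀ ε : ℝ, Delta₁ (d.lam fun _ => ε) (d.f x t fun _ => ε) (d.g x t fun _ => ε) k j
            = Delta₁ (d.lam fun _ => ε) (d.f x t fun _ => ε) (d.g x t fun _ => ε) i j := by
          intro ε
          simp only [Delta₁, Matrix.of_apply, lam, f_eq, g_eq, epsOf, hpar]
        simp only [hrow]
      · intro k' _ hk'
        simp only [L, Matrix.of_apply]
        rw [if_neg hk'.1, if_neg, zero_mul]
        intro h
        exact hk'.2 (Fin.ext (by simp only [k]; omega))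
    · rw [Finset.sum_eq_single i]
      · have hord : order (i.1 + 1) = 1 := by
          by_cases h : Even i.1
          · obtain ⟨m, _, h1, h2⟩ := isEven_iff_exists i h
            omega
          · obtain ⟨m, _, h1, h2⟩ := notEven_iff_exists i h
            omega
        simp only [L, Matrix.of_apply, if_true, hatDelta₁, hat]
        rw [hord, iteratedDeriv_one_quadratic_mul _ _ (han i j)]
      · intro k' _ hk'
        simp only [L, Matrix.of_apply]
        rw [if_neg hk', if_neg (by omega), zero_mul]
      · simp
  rw [minorVec, hsub, Matrix.det_mul, hdet]
  simp [pow_mul]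

omit hc hroot hsq in
lemma prod_lam_zero_ne : ∏ i, d.lam (fun _ => 0) i ≠ 0 := by
  refine Finset.prod_ne_zero_iff.2 fun i _ => ?_
  have h : lamOdd d.a d.c 0 = d.lam₀ := by simp [lamOdd, lam₀]
  have := lam₀_ne_zero ha
  simp only [lam, epsOf, h]
  split_ifs <;> simpa

end

end

end Data

end CLL

/-! ### The normalized Darboux dressing -/

namespace CLL

/-! ### Polynomial dependence on `(x, t)` -/

section PolynomialFunctions

/-- Complex polynomial functions of two real variables. -/
def IsPolyFun (F : ℝ → ℝ → ℂ) : Prop :=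
  ∃ p : MvPolynomial (Fin 2) ℂ, ∀ x t : ℝ, F x t = MvPolynomial.eval ![(x : ℂ), (t : ℂ)] p

namespace IsPolyFun

variable {F G : ℝ → ℝ → ℂ}

lemma const (z : ℂ) : IsPolyFun fun _ _ => z := ⟨MvPolynomial.C z, by simp⟩

lemma fst : IsPolyFun fun x _ => (x : ℂ) := ⟨MvPolynomial.X 0, by simp⟩

lemma snd : IsPolyFun fun _ t => (t : ℂ) := ⟨MvPolynomial.X 1, by simp⟩

lemma add (hF : IsPolyFun F) (hG : IsPolyFun G) : IsPolyFun fun x t => F x t + G x t := by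
  obtain ⟨p, hp⟩ := hF
  obtain ⟨q, hq⟩ := hG
  exact ⟨p + q, by simp [hp, hq]⟩

lemma mul (hF : IsPolyFun F) (hG : IsPolyFun G) : IsPolyFun fun x t => F x t * G x t := by
  obtain ⟨p, hp⟩ := hF
  obtain ⟨q, hq⟩ := hG
  exact ⟨p * q, by simp [hp, hq]⟩

lemma sum {ι : Type*} (s : Finset ι) {F : ι → ℝ → ℝ → ℂ} (h : ∀ i ∈ s, IsPolyFun (F i)) :
    IsPolyFun fun x t => ∑ i ∈ s, F i x t := by
  classical
  induction s using Finset.induction_on with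
  | empty => simpa using const 0
  | insert i s hi ih =>
    simp only [Finset.sum_insert hi]
    exact (h i (Finset.mem_insert_self i s)).add
      (ih fun j hj => h j (Finset.mem_insert_of_mem hj))

lemma prod {ι : Type*} (s : Finset ι) {F : ι → ℝ → ℝ → ℂ} (h : ∀ i ∈ s, IsPolyFun (F i)) :
    IsPolyFun fun x t => ∏ i ∈ s, F i x t := by
  classical
  induction s using Finset.induction_on with
  | empty => simpa using const 1
  | insert i s hi ih =>
    simp only [Finset.prod_insert hi]
    exact (h i (Finset.mem_insert_self i s)).mul
      (ih fun j hj => h j (Finset.mem_insert_of_mem hj))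

lemma star (hF : IsPolyFun F) : IsPolyFun fun x t => conj (F x t) := by
  obtain ⟨p, hp⟩ := hF
  refine ⟨MvPolynomial.map (starRingEnd ℂ) p, fun x t => ?_⟩
  beta_reduce
  rw [hp, MvPolynomial.eval_map, ← MvPolynomial.eval₂_id p, MvPolynomial.hom_eval₂]
  simp only [RingHom.comp_id]
  congr 1
  funext i
  fin_cases i <;> simp

lemma det {n : ℕ} {M : ℝ → ℝ → Matrix (Fin n) (Fin n) ℂ}
    (h : ∀ i j, IsPolyFun fun x t => M x t i j) : IsPolyFun fun x t => (M x t).det := by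
  simp only [Matrix.det_apply']
  exact sum _ fun σ _ => (const _).mul (prod _ fun i _ => h _ _)

lemma contDiff (hF : IsPolyFun F) : ContDiff ℝ ∞ fun p : ℝ × ℝ => F p.1 p.2 := by
  obtain ⟨p, hp⟩ := hF
  simp only [hp]
  clear hp
  induction p using MvPolynomial.induction_on with
  | C z => simpa using contDiff_const
  | add p q hp hq => simpa using hp.add hq
  | mul_X p i hp =>
    simp only [MvPolynomial.eval_mul, MvPolynomial.eval_X]
    refine hp.mul ?_
    fin_cases i
    · exact ofRealCLM.contDiff.comp contDiff_fst
    · exact ofRealCLM.contDiff.comp contDiff_snd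

end IsPolyFun

open Polynomial in
/-- Families of polynomials whose coefficients are polynomial functions of two real variables. -/
def IsPolyFamily (F : ℝ → ℝ → ℂ[X]) : Prop := ∀ n, IsPolyFun fun x t => (F x t).coeff n

namespace IsPolyFamily

open Polynomial

variable {F G : ℝ → ℝ → ℂ[X]}

lemma const (p : ℂ[X]) : IsPolyFamily fun _ _ => p := fun _ => IsPolyFun.const _

lemma C {h : ℝ → ℝ → ℂ} (hh : IsPolyFun h) : IsPolyFamily fun x t => C (h x t) := fun n => by
  simp only [coeff_C]
  split_ifs
  exacts [hh, IsPolyFun.const 0]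

lemma add (hF : IsPolyFamily F) (hG : IsPolyFamily G) :
    IsPolyFamily fun x t => F x t + G x t := fun n => by
  simpa using (hF n).add (hG n)

lemma mul (hF : IsPolyFamily F) (hG : IsPolyFamily G) :
    IsPolyFamily fun x t => F x t * G x t := fun n => by
  simp only [coeff_mul]
  exact IsPolyFun.sum _ fun i _ => (hF i.1).mul (hG i.2)

lemma sum {ι : Type*} (s : Finset ι) {F : ι → ℝ → ℝ → ℂ[X]} (h : ∀ i ∈ s, IsPolyFamily (F i)) :
    IsPolyFamily fun x t => ∑ i ∈ s, F i x t := fun n => by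
  simp only [finsetSum_coeff]
  exact IsPolyFun.sum _ fun i hi => h i hi n

lemma pow (hF : IsPolyFamily F) (k : ℕ) : IsPolyFamily fun x t => F x t ^ k := by
  induction k with
  | zero => simpa using const 1
  | succ k ih => simpa only [pow_succ] using ih.mul hF

end IsPolyFamily

end PolynomialFunctions

namespace Data

variable {d : Data}

section

open Polynomial

lemma isPolyFamily_YP : IsPolyFamily d.YP := by
  have h1 : IsPolyFun fun x _ : ℝ => (x / 4 : ℂ) := by
    simpa only [div_eq_mul_inv] using IsPolyFun.fst.mul (IsPolyFun.const _)
  exact ((IsPolyFamily.C h1).add ((IsPolyFamily.C IsPolyFun.snd).mul (.const _))).add (.const _)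

lemma isPolyFamily_truncSin (N : ℕ) (S : ℂ[X]) :
    IsPolyFamily fun x t => truncSin N S (d.YP x t) :=
  IsPolyFamily.sum _ fun _ _ => (IsPolyFamily.const _).mul
    ((IsPolyFamily.const _).mul (isPolyFamily_YP.pow _))

lemma isPolyFamily_truncCos (N : ℕ) (S : ℂ[X]) :
    IsPolyFamily fun x t => truncCos N S (d.YP x t) :=
  IsPolyFamily.sum _ fun _ _ => (IsPolyFamily.const _).mul
    ((IsPolyFamily.const _).mul (isPolyFamily_YP.pow _))

lemma isPolyFamily_fJ : IsPolyFamily d.fJ := by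
  have := ((IsPolyFamily.const d.QP).mul (isPolyFamily_truncSin (d := d) d.N d.SP)).add
    ((IsPolyFamily.const (-1)).mul (isPolyFamily_truncCos (d := d) d.N d.SP))
  intro n
  simpa only [neg_one_mul, ← sub_eq_add_neg] using! this n

lemma isPolyFamily_gJ : IsPolyFamily d.gJ := by
  have := ((IsPolyFamily.const (-d.QP)).mul (isPolyFamily_truncSin (d := d) d.N d.SP)).add
    ((IsPolyFamily.const (-1)).mul (isPolyFamily_truncCos (d := d) d.N d.SP))
  intro n
  simpa only [neg_one_mul, ← sub_eq_add_neg] using! this n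

/-- The carrier of column `j`. -/
noncomputable def colPhase (d : Data) (x t : ℝ) (j : ℕ) : ℂ :=
  if Even j then conj (d.carrier x t) else d.carrier x t

lemma prod_colPhase (x t : ℝ) (N : ℕ) :
    ∏ j : Fin (2 * N + 1), d.colPhase x t j = conj (d.carrier x t) := by
  rw [Finset.prod_fin_eq_prod_range]
  have : ∏ j ∈ Finset.range (2 * N + 1), d.colPhase x t j = conj (d.carrier x t) := by
    induction N with
    | zero => simp [colPhase]
    | succ N ih =>
      rw [show 2 * (N + 1) + 1 = 2 * N + 1 + 1 + 1 by ring, Finset.prod_range_succ,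
        Finset.prod_range_succ, ih]
      have h1 : ¬ Even (2 * N + 1) := by rw [Nat.not_even_iff_odd]; exact ⟨N, rfl⟩
      have h2 : Even (2 * N + 1 + 1) := ⟨N + 1, by ring⟩
      simp only [colPhase, h1, h2, if_true, if_false]
      linear_combination conj (d.carrier x t) * d.carrier_mul_conj x t
  rw [← this]
  refine Finset.prod_congr rfl fun j hj => ?_
  rw [dif_pos (Finset.mem_range.1 hj)]

section

variable (ha : d.a < 1) (hc : d.c ≠ 0) (hroot : AnalyticAt ℝ d.root 0)
    (hsq : ∀ᶠ ε in 𝓝 (0 : ℝ), d.root ε ^ 2 = S d.a d.c (lamOdd d.a d.c ε))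
include ha hc hroot hsq

/-- The carrier depends on the parity of the column alone: `f` carries `conj carrier` and `g`
carries `carrier`, while the second row of a pair has `conj g` in place of `f` and `conj f` in place
of `g`, with the same carriers. -/
lemma hatExt_eq_colPhase_mul (i : Fin (2 * d.N)) (j : Fin (2 * d.N + 1)) :
    ∃ F, IsPolyFun F ∧ ∀ x t, d.hatExt x t i j = d.colPhase x t j * F x t := by
  have key : ∀ m < d.N, ∀ p : ℂ[X], (IsPolyFun fun x t => ∑ l ∈ Finset.range d.N,
      d.jetCoeff m l * (p * d.fJ x t).coeff l) ∧ (IsPolyFun fun x t => ∑ l ∈ Finset.range d.N,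
      d.jetCoeff m l * (p * d.gJ x t).coeff l) := by
    intro m _ p
    exact ⟨IsPolyFun.sum _ fun l _ => (IsPolyFun.const _).mul
      (((IsPolyFamily.const p).mul isPolyFamily_fJ) l), IsPolyFun.sum _ fun l _ =>
      (IsPolyFun.const _).mul (((IsPolyFamily.const p).mul isPolyFamily_gJ) l)⟩
  have keyf : ∀ m < d.N, ∀ p : ℂ[X], ∀ x t, iteratedDeriv (2 * m + 1)
      (fun ε : ℝ => p.eval ((ε : ℂ) ^ 2) * d.fE ε x t) 0 = conj (d.carrier x t) *
        ∑ l ∈ Finset.range d.N, d.jetCoeff m l * (p * d.fJ x t).coeff l := by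
    intro m hm p x t
    rw [((hasJet_fE_gE ha hc hroot hsq x t).1.mul_left p).iteratedDeriv_eq ha hc hroot hsq hm,
      Finset.mul_sum]
    refine Finset.sum_congr rfl fun l _ => ?_
    rw [fP, mul_left_comm, coeff_C_mul]; ring
  have keyg : ∀ m < d.N, ∀ p : ℂ[X], ∀ x t, iteratedDeriv (2 * m + 1)
      (fun ε : ℝ => p.eval ((ε : ℂ) ^ 2) * d.gE ε x t) 0 = d.carrier x t *
        ∑ l ∈ Finset.range d.N, d.jetCoeff m l * (p * d.gJ x t).coeff l := by
    intro m hm p x t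
    rw [((hasJet_fE_gE ha hc hroot hsq x t).2.mul_left p).iteratedDeriv_eq ha hc hroot hsq hm,
      Finset.mul_sum]
    refine Finset.sum_congr rfl fun l _ => ?_
    rw [gP, mul_left_comm, coeff_C_mul]; ring
  have keyc : ∀ (p : ℂ[X]) (F : ℝ → ℂ) (m k : ℕ),
      iteratedDeriv m (fun ε => (-conj (lamOdd d.a d.c ε)) ^ k * conj (F ε)) 0 =
      conj (iteratedDeriv m (fun ε : ℝ => ((-d.lamP) ^ k).eval ((ε : ℂ) ^ 2) * F ε) 0) := by
    intro p F m k
    rw [← iteratedDeriv_conj]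
    simp [lamOdd_eq]
  by_cases hi : Even i.1
  · obtain ⟨m, hm, -, hord⟩ := isEven_iff_exists i hi
    by_cases hj : Even j.1
    · refine ⟨_, (key m hm (d.lamP ^ (2 * d.N - j.1))).1, fun x t => ?_⟩
      simp only [hatExt, Matrix.of_apply, extMatrix, hord, f_eq, g_eq, lam, hi, hj, if_true,
        colPhase, epsOf]
      rw [← keyf m hm]; simp [lamOdd_eq]
    · refine ⟨_, (key m hm (d.lamP ^ (2 * d.N - j.1))).2, fun x t => ?_⟩
      simp only [hatExt, Matrix.of_apply, extMatrix, hord, f_eq, g_eq, lam, hi, hj, if_true,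
        if_false, colPhase, epsOf]
      rw [← keyg m hm]; simp [lamOdd_eq]
  · obtain ⟨m, hm, -, hord⟩ := notEven_iff_exists i hi
    by_cases hj : Even j.1
    · refine ⟨_, (key m hm ((-d.lamP) ^ (2 * d.N - j.1))).2.star, fun x t => ?_⟩
      simp only [hatExt, Matrix.of_apply, extMatrix, hord, f_eq, g_eq, lam, hi, hj, if_true,
        if_false, colPhase, epsOf]
      rw [keyc 0, keyg m hm, map_mul]
    · refine ⟨_, (key m hm ((-d.lamP) ^ (2 * d.N - j.1))).1.star, fun x t => ?_⟩
      simp only [hatExt, Matrix.of_apply, extMatrix, hord, f_eq, g_eq, lam, hi, hj,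
        if_false, colPhase, epsOf]
      rw [keyc 0, keyf m hm, map_mul, conj_conj]

/-- The minors are polynomial in `x, t`, up to the carrier in the odd columns. -/
lemma minorVec_hatExt_eq (j : Fin (2 * d.N + 1)) : ∃ F, IsPolyFun F ∧ ∀ x t,
    minorVec (d.hatExt x t) j = (if Even j.1 then 1 else conj (d.carrier x t) ^ 2) * F x t := by
  choose G hG hG' using hatExt_eq_colPhase_mul ha hc hroot hsq
  refine ⟨fun x t => (-1) ^ j.1 * (Matrix.of fun i k => G i (j.succAbove k) x t).det,
    (IsPolyFun.const _).mul (IsPolyFun.det fun i k => hG _ _), fun x t => ?_⟩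
  have h1 : (d.hatExt x t).submatrix id j.succAbove = Matrix.of fun i k =>
      d.colPhase x t (j.succAbove k) * (Matrix.of fun i k => G i (j.succAbove k) x t) i k := by
    ext i k
    simp [hG']
  have h2 := prod_colPhase (d := d) x t d.N
  rw [Fin.prod_univ_succAbove _ j] at h2
  have h3 := d.carrier_mul_conj x t
  -- All columns together contribute `conj carrier`. Deleting an even column removes this factor;
  -- deleting an odd one removes `carrier` and leaves `conj carrier ^ 2`.
  have h4 : ∏ k, d.colPhase x t (j.succAbove k) =
      if Even j.1 then 1 else conj (d.carrier x t) ^ 2 := by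
    unfold colPhase at h2 ⊢
    split_ifs at h2 ⊢ with h
    · linear_combination d.carrier x t * h2 - (∏ k, (if Even (j.succAbove k).1 then
        conj (d.carrier x t) else d.carrier x t) - 1) * h3
    · linear_combination conj (d.carrier x t) * h2 - (∏ k, (if Even (j.succAbove k).1 then
        conj (d.carrier x t) else d.carrier x t)) * h3
  rw [minorVec, h1, Matrix.det_mul_row, h4]
  ring

end

lemma contDiff_carrier : ContDiff ℝ ∞ fun p : ℝ × ℝ => d.carrier p.1 p.2 := by
  unfold carrier
  refine ContDiff.cexp ?_
  have h : ContDiff ℝ ∞ fun p : ℝ × ℝ => phase d.a d.c p.1 p.2 := by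
    unfold phase; fun_prop
  have h2 : ContDiff ℝ ∞ fun p : ℝ × ℝ => ((phase d.a d.c p.1 p.2 : ℝ) : ℂ) :=
    ofRealCLM.contDiff.comp h
  exact contDiff_const.mul (h2.div_const 2)

lemma contDiff_conj_carrier : ContDiff ℝ ∞ fun p : ℝ × ℝ => conj (d.carrier p.1 p.2) :=
  (conjCLE : ℂ →L[ℝ] ℂ).contDiff.comp contDiff_carrier

/-- A smooth family of normalized coefficient vectors of the Darboux matrix. -/
structure IsDressing (d : Data) (y : ℝ → ℝ → Fin (2 * d.N + 1) → ℂ) : Prop where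
  isKer : ∀ x t, d.IsKer x t (y x t)
  norm_one : ∀ x t, y x t 0 * conj (y x t 0) = 1
  last : ∃ κ : ℂ, κ ≠ 0 ∧ conj κ = κ ∧ ∀ x t, y x t (Fin.last _) = κ * conj (y x t 0)
  contDiff : ∀ j, ContDiff ℝ ∞ fun p : ℝ × ℝ => y p.1 p.2 j

/-- The normalized vector of minors. -/
noncomputable def dressing (d : Data) (x t : ℝ) (j : Fin (2 * d.N + 1)) : ℂ :=
  minorVec (d.hatExt x t) j / (‖minorVec (d.hatExt x t) 0‖ : ℝ)

lemma evenPoly_smul {N : ℕ} (z : ℂ) (y : Fin (2 * N + 1) → ℂ) :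
    evenPoly (z • y) = C z * evenPoly y := by
  simp only [evenPoly, Finset.mul_sum]
  refine Finset.sum_congr rfl fun j _ => ?_
  split_ifs <;> simp [mul_assoc]

lemma oddPoly_smul {N : ℕ} (z : ℂ) (y : Fin (2 * N + 1) → ℂ) :
    oddPoly (z • y) = C z * oddPoly y := by
  simp only [oddPoly, Finset.mul_sum]
  refine Finset.sum_congr rfl fun j _ => ?_
  split_ifs <;> simp [mul_assoc]

lemma IsKer.smul {x t : ℝ} {y : Fin (2 * d.N + 1) → ℂ} (h : d.IsKer x t y) (z : ℂ) :
    d.IsKer x t (z • y) := by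
  constructor
  · rw [evenPoly_smul, oddPoly_smul]
    refine (Dvd.dvd.mul_left h.dvd₁ (C z)).trans (dvd_of_eq ?_)
    simp only [mul_comp, C_comp]; ring
  · rw [evenPoly_smul, oddPoly_smul]
    refine (Dvd.dvd.mul_left h.dvd₂ (C (conj z))).trans (dvd_of_eq ?_)
    simp only [mul_comp, C_comp, map_mul, cj_C]; ring

section

variable (ha : d.a < 1) (hc : d.c ≠ 0) (hroot : AnalyticAt ℝ d.root 0)
    (hsq : ∀ᶠ ε in 𝓝 (0 : ℝ), d.root ε ^ 2 = S d.a d.c (lamOdd d.a d.c ε))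
include ha hc hroot hsq

lemma minorVec_zero_ne (hN : 1 ≤ d.N) (x t : ℝ) : minorVec (d.hatExt x t) 0 ≠ 0 := by
  rw [minorVec_hatExt_zero]; exact det_hatDelta₂_ne_zero ha hc hroot hsq hN x t

/-- The minors are divided by the modulus of the first one, not by the minor itself: a real factor
preserves the relation between the last entry and the conjugate of the first. Smoothness needs the
nonvanishing of that minor. -/
lemma isDressing (hN : 1 ≤ d.N) : d.IsDressing d.dressing := by
  have h0 := minorVec_zero_ne ha hc hroot hsq hN
  constructor
  · intro x t
    have := (isKer_of_mulVec ha hc hroot hsq (mulVec_minorVec (d.hatExt x t))).smul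
      ((‖minorVec (d.hatExt x t) 0‖ : ℝ) : ℂ)⁻¹
    convert this using 1
    funext j
    rw [dressing, Pi.smul_apply, smul_eq_mul, div_eq_inv_mul]
  · intro x t
    have h1 : ((‖minorVec (d.hatExt x t) 0‖ : ℝ) : ℂ) ≠ 0 := by simpa using h0 x t
    rw [dressing, map_div₀, conj_ofReal, div_mul_div_comm, Complex.mul_conj', ← sq]
    exact div_self (pow_ne_zero 2 h1)
  · refine ⟨_, prod_lam_zero_ne ha, (paired 0 0 fun _ => 0).conj_prod_lam, fun x t => ?_⟩
    rw [dressing, dressing, minorVec_hatExt_last ha hc hroot hsq, minorVec_hatExt_zero, map_div₀,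
      conj_det_hatDelta₂, conj_ofReal]
    ring
  · have hm : ∀ j, ContDiff ℝ ∞ fun p : ℝ × ℝ => minorVec (d.hatExt p.1 p.2) j := by
      intro j
      obtain ⟨F, hF, hF'⟩ := minorVec_hatExt_eq ha hc hroot hsq j
      simp only [hF']
      refine ContDiff.mul ?_ hF.contDiff
      split_ifs
      exacts [contDiff_const, contDiff_conj_carrier.pow 2]
    intro j
    simp only [dressing, div_eq_mul_inv]
    have h1 : ContDiff ℝ ∞ fun p : ℝ × ℝ => ‖minorVec (d.hatExt p.1 p.2) 0‖ :=
      (hm 0).norm ℝ fun p => h0 p.1 p.2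
    have h2 : ContDiff ℝ ∞ fun p : ℝ × ℝ => ((‖minorVec (d.hatExt p.1 p.2) 0‖ : ℝ) : ℂ) :=
      ofRealCLM.contDiff.comp h1
    exact (hm j).mul (h2.inv fun p => by simpa using h0 p.1 p.2)

end

end

/-- The rogue wave. -/
noncomputable def rogue (d : Data) (x t : ℝ) : ℂ :=
  (d.hatDelta₂ x t).det / (d.hatDelta₁ x t).det * seedR d.a d.c x t +
    2 * I * ((d.hatDelta₃ x t).det / (d.hatDelta₁ x t).det)

section

variable (ha : d.a < 1) (hc : d.c ≠ 0) (hroot : AnalyticAt ℝ d.root 0)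
    (hsq : ∀ᶠ ε in 𝓝 (0 : ℝ), d.root ε ^ 2 = S d.a d.c (lamOdd d.a d.c ε)) (hN : 1 ≤ d.N)
include ha hc hroot hsq hN

/-- The denominator `det hatDelta₁` is the conjugate of `det hatDelta₂`, so `det hatDelta₂ / det
hatDelta₁` is the square of the unimodular first entry. -/
lemma rogue_eq_dressing (x t : ℝ) : d.rogue x t = d.dressing x t 0 *
    (d.dressing x t 0 * seedR d.a d.c x t - 2 * I * d.dressing x t ⟨1, by omega⟩) := by
  have h0 := det_hatDelta₂_ne_zero ha hc hroot hsq hN x t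
  have h0' := det_hatDelta₁_ne_zero ha hc hroot hsq hN x t
  have h1 : ((‖(d.hatDelta₂ x t).det‖ : ℝ) : ℂ) ≠ 0 := by simpa using h0
  have h2 := Complex.mul_conj' (d.hatDelta₂ x t).det
  rw [conj_det_hatDelta₂] at h2
  rw [rogue, dressing, dressing, minorVec_hatExt_zero, minorVec_hatExt_one hN]
  field_simp
  linear_combination ((d.hatDelta₂ x t).det * seedR d.a d.c x t +
    2 * I * (d.hatDelta₃ x t).det) * (-h2)

omit ha hc hroot hsq in
lemma neg_conj_rogue (x t : ℝ) : -conj (d.rogue x t) =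
    (d.hatDelta₁ x t).det / (d.hatDelta₂ x t).det * seedQ d.a d.c x t -
      2 * I * ((d.hatDelta₄ x t).det / (d.hatDelta₂ x t).det) := by
  have h1 : conj (d.hatDelta₁ x t).det = (d.hatDelta₂ x t).det := by
    rw [← conj_det_hatDelta₂, conj_conj]
  simp only [rogue, map_add, map_mul, map_div₀, conj_det_hatDelta₂, h1, conj_det_hatDelta₃ hN,
    conj_I, map_ofNat, seedR, map_neg, conj_conj]
  ring

/-- The minor for column `0` is carrier-free and the one for column `1` carries `conj carrier ^ 2 =
exp (-I ρ)`, exactly as the seed does. The denominator may be taken to be `det hatDelta₁`. -/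
lemma rogue_rational : ∃ P Q : MvPolynomial (Fin 2) ℂ, ∀ x t : ℝ,
    MvPolynomial.eval ![(x : ℂ), (t : ℂ)] Q ≠ 0 ∧
    d.rogue x t = MvPolynomial.eval ![(x : ℂ), (t : ℂ)] P /
      MvPolynomial.eval ![(x : ℂ), (t : ℂ)] Q * exp (-I * phase d.a d.c x t) := by
  obtain ⟨F, hF, hF'⟩ := minorVec_hatExt_eq ha hc hroot hsq 0
  obtain ⟨G, hG, hG'⟩ := minorVec_hatExt_eq ha hc hroot hsq ⟨1, by omega⟩
  simp only [minorVec_hatExt_zero, minorVec_hatExt_one hN, Fin.val_zero, Even.zero, if_true,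
    one_mul, Nat.not_even_one, if_false] at hF' hG'
  obtain ⟨Q, hQ⟩ := hF.star
  obtain ⟨P, hP⟩ := ((IsPolyFun.const (-d.c)).mul hF).add ((IsPolyFun.const (-2 * I)).mul hG)
  beta_reduce at hQ hP
  refine ⟨P, Q, fun x t => ?_⟩
  have h1 := det_hatDelta₁_ne_zero ha hc hroot hsq hN x t
  have h2 : (d.hatDelta₁ x t).det = MvPolynomial.eval ![(x : ℂ), (t : ℂ)] Q := by
    rw [← hQ, ← hF', conj_det_hatDelta₂]
  refine ⟨h2 ▸ h1, ?_⟩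
  have h3 : exp (-I * phase d.a d.c x t) = conj (d.carrier x t) ^ 2 := by
    rw [conj_carrier, ← exp_nat_mul]; congr 1; push_cast; ring
  have h4 : (d.hatDelta₃ x t).det = -(conj (d.carrier x t) ^ 2 * G x t) := by rw [← hG', neg_neg]
  rw [h3, ← h2, ← hP, rogue, seedR_eq, hF', h4]
  field_simp

end

end Data

end CLL

/-! ### Uniqueness of the dressing and Lax pair identities -/

namespace CLL

open Polynomial

/-! ### Differentiating the Darboux matrix along a Lax equation -/

section LaxPair

/-- Divisibility by `X ^ N` is stable under differentiating the first row of the Darboux matrix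
applied to a solution of a Lax equation, modulo the rows themselves. -/
lemma lax_row_dvd {N : ℕ} {L M : ℂ[X]} (hM : M = L ^ 2) {A B f g : ℝ → ℂ[X]} {A' B' f' g' : ℂ[X]}
    {s : ℝ} (hN : ∀ s, (A s).natDegree ≤ N) (hN' : ∀ s, (B s).natDegree ≤ N)
    (hA : CoeffDeriv A A' s) (hB : CoeffDeriv B B' s) (hf : CoeffDeriv f f' s)
    (hg : CoeffDeriv g g' s) {α β γ α₁ β₁ γ₁ : ℂ[X]}
    (hf' : X ^ N ∣ f' - (α.comp M * f s + L * β.comp M * g s))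
    (hg' : X ^ N ∣ g' - (L * γ.comp M * f s - α.comp M * g s))
    (h1 : ∀ s, X ^ N ∣ (A s).comp M * f s + L * (B s).comp M * g s)
    (h2 : ∀ s, X ^ N ∣ (cj (A s)).comp M * g s - L * (cj (B s)).comp M * f s)
    (hα : cj α = -α) (hα₁ : cj α₁ = -α₁) (hβ : cj β = -γ) (hβ₁ : cj β₁ = -γ₁) :
    X ^ N ∣ (A' + (α - α₁) * A s + X * (γ * B s + β₁ * cj (B s))).comp M * f s +
        L * (B' + β * A s - β₁ * cj (A s) - (α + α₁) * B s).comp M * g s ∧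
    X ^ N ∣ (cj (A' + (α - α₁) * A s + X * (γ * B s + β₁ * cj (B s)))).comp M * g s -
        L * (cj (B' + β * A s - β₁ * cj (A s) - (α + α₁) * B s)).comp M * f s := by
  have hγ : cj γ = -β := by rw [← neg_neg γ, ← hβ, map_neg, cj_cj]
  have d1 := (((hA.comp hN M).mul hf).add (((CoeffDeriv.const L s).mul (hB.comp hN' M)).mul
    hg)).pow_dvd h1
  have d2 := (((hA.cj.comp (by simpa using hN) M).mul hg).sub
    (((CoeffDeriv.const L s).mul (hB.cj.comp (by simpa using hN') M)).mul hf)).pow_dvd h2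
  have k1 := h1 s
  have k2 := h2 s
  constructor
  -- With `T = [[A, λ B], [-λ B̄, Ā]]`, `U = [[α, λ β], [λ γ, -α]]` and `U₁` alike, the conditions
  -- say `T φ ≡ 0`. Differentiation and `φ' ≡ U φ` give `(T' + T U - U₁ T) φ ≡ 0`. The two
  -- polynomials in the conclusion form the first row of this matrix. The symmetries of `α, β, γ`
  -- under `cj` make its second row the conjugate one.
  · have := (d1.sub (((hf'.mul_left ((A s).comp M)).add (hg'.mul_left (L * (B s).comp M))))).sub
      ((k1.mul_left (α₁.comp M)).add (k2.mul_left (L * β₁.comp M)))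
    refine this.trans (dvd_of_eq ?_)
    simp only [add_comp, sub_comp, mul_comp, X_comp]
    subst hM
    ring
  · have := (d2.sub (((hg'.mul_left ((cj (A s)).comp M)).sub
      (hf'.mul_left (L * (cj (B s)).comp M))))).add
      ((k2.mul_left (α₁.comp M)).sub (k1.mul_left (L * γ₁.comp M)))
    refine this.trans (dvd_of_eq ?_)
    simp only [map_add, map_sub, map_mul, cj_X, hα, hα₁, hβ, hβ₁, hγ, cj_cj, add_comp, sub_comp,
      mul_comp, X_comp, neg_comp]
    subst hM
    ring

end LaxPair

namespace Data

variable {d : Data}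

lemma evenPoly_coeffDeriv {N : ℕ} {y : ℝ → Fin (2 * N + 1) → ℂ} {y' : Fin (2 * N + 1) → ℂ} {s : ℝ}
    (h : ∀ j, HasDerivAt (fun u => y u j) (y' j) s) :
    CoeffDeriv (fun u => evenPoly (y u)) (evenPoly y') s := by
  refine CoeffDeriv.sum fun j _ => ?_
  split_ifs
  · simpa using (CoeffDeriv.C (h j)).mul (CoeffDeriv.const (X ^ (N - j.1 / 2)) s)
  · exact CoeffDeriv.const 0 s

lemma oddPoly_coeffDeriv {N : ℕ} {y : ℝ → Fin (2 * N + 1) → ℂ} {y' : Fin (2 * N + 1) → ℂ} {s : ℝ}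
    (h : ∀ j, HasDerivAt (fun u => y u j) (y' j) s) :
    CoeffDeriv (fun u => oddPoly (y u)) (oddPoly y') s := by
  refine CoeffDeriv.sum fun j _ => ?_
  split_ifs
  · exact CoeffDeriv.const 0 s
  · simpa using (CoeffDeriv.C (h j)).mul (CoeffDeriv.const (X ^ (N - 1 - j.1 / 2)) s)

/-- The seed eigenfunction solves a Lax equation along any path on which the phase has slope `κ`
and `YP` has slope `V`. -/
lemma fP_gP_coeffDeriv (ha : d.a < 1) {x t : ℝ → ℝ} {κ : ℝ} {V : ℂ[X]} {s : ℝ}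
    (hκ : HasDerivAt (fun u => phase d.a d.c (x u) (t u)) κ s)
    (hV : CoeffDeriv (fun u => d.YP (x u) (t u)) V s) :
    ∃ f' g', CoeffDeriv (fun u => d.fP (x u) (t u)) f' s ∧
      CoeffDeriv (fun u => d.gP (x u) (t u)) g' s ∧
      X ^ d.N ∣ f' - ((C (-I * κ / 2) + C I * d.KP * V) * d.fP (x s) (t s) +
        d.lamP * (4 * V * C (seedR d.a d.c (x s) (t s))) * d.gP (x s) (t s)) ∧
      X ^ d.N ∣ g' - (d.lamP * (4 * V * C (seedQ d.a d.c (x s) (t s))) * d.fP (x s) (t s) -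
        (C (-I * κ / 2) + C I * d.KP * V) * d.gP (x s) (t s)) := by
  have hcar : HasDerivAt (fun u => d.carrier (x u) (t u)) (d.carrier (x s) (t s) * (I * κ / 2)) s := by
    have := ((hκ.ofReal_comp.div_const 2).const_mul I).cexp
    refine this.congr_deriv ?_
    rw [carrier]; ring
  have hcar' : HasDerivAt (fun u => conj (d.carrier (x u) (t u)))
      (conj (d.carrier (x s) (t s)) * (-I * κ / 2)) s := by
    refine hcar.star.congr_deriv ?_
    simp
  have hs := truncSin_coeffDeriv d.N d.SP hV
  -- The derivative of the truncated cosine is known only modulo `X ^ N`, so the Lax equation for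
  -- the jets is a congruence.
  obtain ⟨D, hD, hD'⟩ := truncCos_coeffDeriv d.N d.SP (SP_coeff_zero ha) hV
  refine ⟨_, _, (CoeffDeriv.C hcar').mul (((CoeffDeriv.const d.QP s).mul hs).sub hD),
    (CoeffDeriv.C hcar).mul (((CoeffDeriv.const (-d.QP) s).mul hs).sub hD), ?_, ?_⟩
  · have := hD'.mul_left (-C (conj (d.carrier (x s) (t s))))
    refine this.trans (dvd_of_eq ?_)
    have e : C (conj (d.carrier (x s) (t s))) * C (d.carrier (x s) (t s)) = 1 := by
      rw [← C_mul, mul_comm, carrier_mul_conj, C_1]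
    simp only [fP, gP, fJ, gJ, seedR_eq, SP, QP, map_mul, map_neg, map_pow, map_ofNat]
    generalize truncSin d.N _ _ = u, truncCos d.N _ _ = v
    linear_combination (4 * d.lamP * V * C (d.c : ℂ) * C (conj (d.carrier (x s) (t s))) *
      ((4 * C (d.c : ℂ) * d.lamP - C I * d.KP) * u + v)) * e
  · have := hD'.mul_left (-C (d.carrier (x s) (t s)))
    refine this.trans (dvd_of_eq ?_)
    have e : C (conj (d.carrier (x s) (t s))) * C (d.carrier (x s) (t s)) = 1 := by
      rw [← C_mul, mul_comm, carrier_mul_conj, C_1]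
    simp only [fP, gP, fJ, gJ, seedQ_eq, SP, QP, map_mul, map_pow, map_ofNat]
    have e' : C (-I * κ / 2) = -C (I * κ / 2) := by rw [← C_neg]; congr 1; ring
    rw [e']
    generalize truncSin d.N _ _ = u, truncCos d.N _ _ = v
    linear_combination (4 * d.lamP * V * C (d.c : ℂ) * C (d.carrier (x s) (t s)) *
      ((4 * C (d.c : ℂ) * d.lamP - C I * d.KP) * u - v)) * e


lemma eq_zero_of_dvd (ha : d.a < 1) (hc : d.c ≠ 0) (hN : 1 ≤ d.N) {x t : ℝ} {A B : ℂ[X]}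
    (hA : A.natDegree ≤ d.N) (hB : B.degree < d.N)
    (h1 : X ^ d.N ∣ A.comp (d.lamP ^ 2) * d.fP x t + d.lamP * B.comp (d.lamP ^ 2) * d.gP x t)
    (h2 : X ^ d.N ∣ (cj A).comp (d.lamP ^ 2) * d.gP x t -
      d.lamP * (cj B).comp (d.lamP ^ 2) * d.fP x t) (h0 : A.coeff d.N = 0) : A = 0 ∧ B = 0 :=
  eq_zero_of_dvd_herm hA hB ((monic_X_sub_C _).pow _)
    (by rw [natDegree_pow, natDegree_X_sub_C, mul_one])
    (isCoprime_pow_cj (conj_lam₀_sq_ne ha hc) _)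
    (pow_dvd_herm (lam₀_ne_zero ha) (fP_gP_coeff_zero ha hN x t) h1 h2) h0

/-- The kernel of the jet conditions is one-dimensional. -/
lemma IsKer.exists_eq_C_mul (ha : d.a < 1) (hc : d.c ≠ 0) (hN : 1 ≤ d.N) {x t : ℝ}
    {y : Fin (2 * d.N + 1) → ℂ} (hy : d.IsKer x t y) (h0 : y 0 ≠ 0) {A B : ℂ[X]}
    (hA : A.natDegree ≤ d.N) (hB : B.degree < d.N)
    (h1 : X ^ d.N ∣ A.comp (d.lamP ^ 2) * d.fP x t + d.lamP * B.comp (d.lamP ^ 2) * d.gP x t)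
    (h2 : X ^ d.N ∣ (cj A).comp (d.lamP ^ 2) * d.gP x t -
      d.lamP * (cj B).comp (d.lamP ^ 2) * d.fP x t) :
    ∃ τ, A = C τ * evenPoly y ∧ B = C τ * oddPoly y := by
  refine ⟨A.coeff d.N / y 0, ?_⟩
  have := eq_zero_of_dvd (d := d) (x := x) (t := t) ha hc hN
    (A := A - C (A.coeff d.N / y 0) * evenPoly y) (B := B - C (A.coeff d.N / y 0) * oddPoly y)
    ((natDegree_sub_le _ _).trans (max_le hA ((natDegree_C_mul_le _ _).trans
      (evenPoly_natDegree_le y))))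
    ((degree_sub_le _ _).trans_lt (max_lt hB ?_)) ?_ ?_ ?_
  · exact ⟨sub_eq_zero.1 this.1, sub_eq_zero.1 this.2⟩
  · refine (degree_mul_le _ _).trans_lt ((add_le_of_nonpos_left degree_C_le).trans_lt
      (oddPoly_degree_lt y))
  · refine (h1.sub (hy.dvd₁.mul_left (C (A.coeff d.N / y 0)))).trans (dvd_of_eq ?_)
    simp only [sub_comp, mul_comp, C_comp]; ring
  · refine (h2.sub (hy.dvd₂.mul_left (C (conj (A.coeff d.N / y 0))))).trans (dvd_of_eq ?_)
    simp only [map_sub, map_mul, cj_C, sub_comp, mul_comp, C_comp]; ring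
  · rw [coeff_sub, coeff_C_mul, evenPoly_coeff_top, div_mul_cancel₀ _ h0, sub_self]

/-- The transformed potential. -/
noncomputable def potential (d : Data) (y : Fin (2 * d.N + 1) → ℂ) (x t : ℝ) : ℂ :=
  y 0 * (y 0 * seedR d.a d.c x t - 2 * I * (oddPoly y).coeff (d.N - 1))

end Data

/-! ### Algebra of the coefficients; primes on `a` and `b` stand for complex conjugates -/

section Algebra

variable {r q a a' r₁ q₁ b b' : ℂ}

/-- Unimodularity of `a` lets the definition of the new potential be solved for `b`. -/
lemma pot_algebra (haa : a * a' = 1) (hr₁ : r₁ = a * (a * r - 2 * I * b)) :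
    b = -I / 2 * (r * a - r₁ * a') := by
  subst hr₁
  linear_combination (-(b + I / 2 * a * r)) * haa + a * a' * b * I_sq

/-- `h1` is the top coefficient of the relation with multiplier `τ`, and `h2` the constant
coefficient rewritten by `y_last = κ * conj y_0`. In `a' * h1 + a * h2 / κ` the derivatives cancel
by unimodularity, and the formulas for `b`, `b'` give `q * b + r₁ * b' = -I / 2 * (q * r - q₁ * r₁)
* a`, which cancels the rest. -/
lemma tau_x_algebra {τ ax ax' κ : ℂ} (haa : a * a' = 1) (hb : b = -I / 2 * (r * a - r₁ * a'))
    (hb' : b' = -I / 2 * (q * a' - q₁ * a)) (hder : ax * a' + a * ax' = 0)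
    (h1 : ax + I / 4 * (q * r - q₁ * r₁) * a + (q * b + r₁ * b') = τ * a)
    (hκ : κ ≠ 0)
    (h2 : κ * ax' + I / 4 * (q * r - q₁ * r₁) * (κ * a') = τ * (κ * a')) :
    τ = 0 ∧ ax = I / 4 * (q * r - q₁ * r₁) * a := by
  have h2' : ax' + I / 4 * (q * r - q₁ * r₁) * a' = τ * a' :=
    mul_left_cancel₀ hκ (by linear_combination h2)
  subst hb hb'
  have : τ = 0 := by
    linear_combination (-1 / 2 * a') * h1 - (1 / 2 * a) * h2' + 1 / 2 * hder - (τ - I / 4 *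
      (q * r - q₁ * r₁)) * haa + I / 4 * (-(q * r - q₁ * r₁)) * haa
  refine ⟨this, ?_⟩
  rw [this] at h1
  linear_combination h1

/-- The normalization in the time direction is preserved. -/
lemma tau_t_algebra {τ at' att a₁ a₁' a₁x b₂ b₂' bx bx' rx qx r₁x q₁x v v₁ : ℂ}
    (haa : a * a' = 1)
    (hb : b = -I / 2 * (r * a - r₁ * a')) (hb' : b' = -I / 2 * (q * a' - q₁ * a))
    (hbx : bx = -I / 2 * (rx * a + r * (I / 4 * (q * r - q₁ * r₁) * a) -
      (r₁x * a' + r₁ * (-I / 4 * (q * r - q₁ * r₁) * a'))))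
    (hbx' : bx' = -I / 2 * (qx * a' + q * (-I / 4 * (q * r - q₁ * r₁) * a') -
      (q₁x * a + q₁ * (I / 4 * (q * r - q₁ * r₁) * a))))
    (ha₁x : a₁x + I / 4 * (q * r - q₁ * r₁) * a₁ + (q * b₂ + r₁ * b₂') = 0)
    (hb₂ : b₂ = -I / 2 * (bx + r * a₁ - r₁ * a₁' - (-I + I / 4 * (q * r + q₁ * r₁)) * b))
    (hb₂' : b₂' = I / 2 * (bx' - q * a₁' + q₁ * a₁ - (I - I / 4 * (q * r + q₁ * r₁)) * b'))
    (hder : at' * a' + a * att = 0)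
    (hv : v = (qx * r - q * rx) / 4 - I / 8 * q ^ 2 * r ^ 2)
    (hv₁ : v₁ = (q₁x * r₁ - q₁ * r₁x) / 4 - I / 8 * q₁ ^ 2 * r₁ ^ 2)
    (h1 : at' + 2 * a₁x - I / 2 * (q * r - q₁ * r₁) * a₁ + (v - v₁) * a +
      (q + (-q ^ 2 * r / 2 - I * qx)) * b + (r₁ + (-q₁ * r₁ ^ 2 / 2 + I * r₁x)) * b' = τ * a)
    (h2 : att + (v - v₁) * a' = τ * a') : τ = 0 := by
  -- As in the `x`-direction, adding `a' * h1` and `a * h2` eliminates the time derivatives.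
  have e : 2 * τ = 2 * (v - v₁) + a' * (2 * a₁x - I / 2 * (q * r - q₁ * r₁) * a₁ +
      (q + (-q ^ 2 * r / 2 - I * qx)) * b + (r₁ + (-q₁ * r₁ ^ 2 / 2 + I * r₁x)) * b') := by
    linear_combination (-a') * h1 - a * h2 + hder + (-2 * τ + 2 * (v - v₁)) * haa
  have e1 : a₁x = -(I / 4 * (q * r - q₁ * r₁) * a₁ + (q * b₂ + r₁ * b₂')) := by
    linear_combination ha₁x
  have ha0 : a ≠ 0 := left_ne_zero_of_mul_eq_one haa
  have e2 : a' = a⁻¹ := eq_inv_of_mul_eq_one_right haa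
  have : 2 * τ = 0 := by
    rw [e, e1, hb₂, hb₂', hbx, hbx', hb, hb', hv, hv₁, e2]
    field_simp
    ring_nf
    simp only [I_sq, I_pow_three]
    ring
  simpa using this

end Algebra

end CLL

/-! ### Derivatives of the dressing -/

namespace CLL

/-- Here `a`, `a₁` are the coefficients of degrees `N` and `N - 1` of the even part, `b` is that of
degree `N - 1` of the odd part, and `b₂` the one below, taken as a coefficient of `X * oddPoly` so
that it is `0` and not `b` when `N = 1`. Once everything is expressed through the potentials and the
seed equation `hs` removes `rxx`, twice the left side of `h1` is `a'` times the equation for `r₁`;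
the unknown `a₁` cancels. -/
lemma pde_algebra {r q a a' r₁ q₁ b b' a₁ a₁' a₁x a₁x' b₂ b₂' b₂x bx bx' bxx bt at' att v v₁
    rx qx r₁x q₁x rxx rt r₁xx r₁t W Wx : ℂ}
    (haa : a * a' = 1) (hW : W = q * r - q₁ * r₁)
    (hWx : Wx = qx * r + q * rx - (q₁x * r₁ + q₁ * r₁x))
    (hb : b = -I / 2 * (r * a - r₁ * a')) (hb' : b' = -I / 2 * (q * a' - q₁ * a))
    (hbx : bx = -I / 2 * (rx * a + r * (I / 4 * W * a) -
      (r₁x * a' + r₁ * (-I / 4 * W * a'))))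
    (hbx' : bx' = -I / 2 * (qx * a' + q * (-I / 4 * W * a') -
      (q₁x * a + q₁ * (I / 4 * W * a))))
    (hbxx : bxx = -I / 2 * (rxx * a + rx * (I / 4 * W * a) +
      I / 4 * (rx * W * a + r * Wx * a + r * W * (I / 4 * W * a)) - r₁xx * a' -
      r₁x * (-I / 4 * W * a') + I / 4 * (r₁x * W * a' + r₁ * Wx * a' +
      r₁ * W * (-I / 4 * W * a'))))
    (ha₁x : a₁x + I / 4 * W * a₁ + (q * b₂ + r₁ * b₂') = 0)
    (ha₁x' : a₁x' = I / 4 * W * a₁' + (r * b₂' + q₁ * b₂))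
    (hb₂ : b₂ = -I / 2 * (bx + r * a₁ - r₁ * a₁' - (-I + I / 4 * (q * r + q₁ * r₁)) * b))
    (hb₂' : b₂' = I / 2 * (bx' - q * a₁' + q₁ * a₁ - (I - I / 4 * (q * r + q₁ * r₁)) * b'))
    (hb₂x : b₂x = -I / 2 * (bxx + (rx * a₁ + r * a₁x) - (r₁x * a₁' + r₁ * a₁x') -
      (I / 4 * (qx * r + q * rx + (q₁x * r₁ + q₁ * r₁x)) * b +
      (-I + I / 4 * (q * r + q₁ * r₁)) * bx)))
    (hat : at' = (v - v₁) * a) (hat' : att = -(v - v₁) * a')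
    (hbt : bt = -I / 2 * (rt * a + r * at' - (r₁t * a' + r₁ * att)))
    (hv : v = (qx * r - q * rx) / 4 - I / 8 * q ^ 2 * r ^ 2)
    (hv₁ : v₁ = (q₁x * r₁ - q₁ * r₁x) / 4 - I / 8 * q₁ ^ 2 * r₁ ^ 2)
    (h1 : bt + 2 * b₂x + (r + (-q * r ^ 2 / 2 + I * rx)) * a₁ -
      (r₁ + (-q₁ * r₁ ^ 2 / 2 + I * r₁x)) * a₁' + (-2 * I + I / 2 * (q * r + q₁ * r₁)) * b₂ +
      I * b - (v + v₁) * b = 0)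
    (hs : I * rt + rxx - q * r ^ 2 + I * q * r * rx = 0) :
    I * r₁t + r₁xx - q₁ * r₁ ^ 2 + I * q₁ * r₁ * r₁x = 0 := by
  have ha0 : a ≠ 0 := left_ne_zero_of_mul_eq_one haa
  have e2 : a' = a⁻¹ := eq_inv_of_mul_eq_one_right haa
  have e1 : a₁x = -(I / 4 * W * a₁ + (q * b₂ + r₁ * b₂')) := by
    linear_combination ha₁x
  have e3 : rxx = -(I * rt - q * r ^ 2 + I * q * r * rx) := by linear_combination hs
  have key : a' * (I * r₁t + r₁xx - q₁ * r₁ ^ 2 + I * q₁ * r₁ * r₁x) = 2 * 0 := by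
    rw [← h1]
    rw [hbt, hb₂x, ha₁x', e1, hat, hat', hb₂, hb₂', hbxx, hbx, hbx', hb, hb', hv, hv₁, hW, hWx,
      e2, e3]
    field_simp
    ring_nf
    simp only [I_sq, I_pow_three, I_pow_four]
    ring
  have : a' ≠ 0 := right_ne_zero_of_mul_eq_one haa
  simpa [this] using key

open Polynomial

lemma seedR_hasDerivAt {a c : ℝ} {x t : ℝ → ℝ} {κ : ℝ} {s : ℝ}
    (hκ : HasDerivAt (fun u => phase a c (x u) (t u)) κ s) :
    HasDerivAt (fun u => seedR a c (x u) (t u)) (-I * κ * seedR a c (x s) (t s)) s := by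
  have h := (((hκ.ofReal_comp.const_mul I).cexp.const_mul (c : ℂ)).star).neg
  refine h.congr_deriv ?_
  simp only [seedR, seedQ]
  simp
  ring

lemma phase_hasDerivAt_fst (a c x t : ℝ) : HasDerivAt (fun u => phase a c u t) a x := by
  unfold phase
  simpa using! ((hasDerivAt_id x).const_mul a).add_const ((a ^ 2 + (a - 1) * c ^ 2) * t)

lemma phase_hasDerivAt_snd (a c x t : ℝ) :
    HasDerivAt (fun u => phase a c x u) (a ^ 2 + (a - 1) * c ^ 2) t := by
  unfold phase
  simpa using! ((hasDerivAt_id t).const_mul (a ^ 2 + (a - 1) * c ^ 2)).const_add (a * x)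

lemma conj_seedR (a c x t : ℝ) : conj (seedR a c x t) = -seedQ a c x t := by simp [seedR]

lemma conj_seedQ (a c x t : ℝ) : conj (seedQ a c x t) = -seedR a c x t := by simp [seedR]

namespace Data

variable {d : Data}

lemma seedQ_mul_seedR (x t : ℝ) : seedQ d.a d.c x t * seedR d.a d.c x t = -(d.c : ℂ) ^ 2 := by
  rw [seedQ_eq, seedR_eq]
  linear_combination (-(d.c : ℂ) ^ 2) * (d.carrier x t * conj (d.carrier x t) + 1) *
    d.carrier_mul_conj x t

lemma YP_coeffDeriv_fst (x t : ℝ) : CoeffDeriv (fun u => d.YP u t) (C (1 / 4)) x := by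
  have h : HasDerivAt (fun u : ℝ => (u / 4 : ℂ)) (1 / 4) x := by
    simpa using (hasDerivAt_id x).ofReal_comp.div_const 4
  simpa using! ((CoeffDeriv.C h).add (CoeffDeriv.const _ x)).add (CoeffDeriv.const _ x)

lemma YP_coeffDeriv_snd (x t : ℝ) : CoeffDeriv (fun u => d.YP x u) d.VP t := by
  have h : HasDerivAt (fun u : ℝ => (u : ℂ)) 1 t := (hasDerivAt_id t).ofReal_comp
  simpa using! ((CoeffDeriv.const _ t).add ((CoeffDeriv.C h).mul (CoeffDeriv.const d.VP t))).add
    (CoeffDeriv.const _ t)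

lemma coeff_X_mul_of_pos {n : ℕ} (hn : 1 ≤ n) (p : ℂ[X]) : (X * p).coeff n = p.coeff (n - 1) := by
  obtain ⟨k, rfl⟩ := Nat.exists_eq_add_of_le' hn
  rw [coeff_X_mul, Nat.add_sub_cancel]

lemma coeff_X_mul_add_cj (B : ℂ[X]) (z w : ℂ) (n : ℕ) :
    (X * (C z * B + C w * cj B)).coeff n = z * (X * B).coeff n + w * conj ((X * B).coeff n) := by
  have : X * (C z * B + C w * cj B) = C z * (X * B) + C w * cj (X * B) := by
    rw [map_mul, cj_X]; ring
  rw [this, coeff_add, coeff_C_mul, coeff_C_mul, cj_coeff]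

lemma coeff_evenPoly_eq_zero {N : ℕ} (y : Fin (2 * N + 1) → ℂ) {n : ℕ} (h : N < n) :
    (evenPoly y).coeff n = 0 :=
  coeff_eq_zero_of_natDegree_lt ((evenPoly_natDegree_le y).trans_lt h)

lemma coeff_oddPoly_eq_zero {N : ℕ} (y : Fin (2 * N + 1) → ℂ) {n : ℕ} (h : N ≤ n) :
    (oddPoly y).coeff n = 0 :=
  (degree_lt_iff_coeff_zero _ _).1 (oddPoly_degree_lt y) n h

lemma potential_conj_mul {y : Fin (2 * d.N + 1) → ℂ} (h : y 0 * conj (y 0) = 1) (x t : ℝ) :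
    (oddPoly y).coeff (d.N - 1) =
      -I / 2 * (seedR d.a d.c x t * y 0 - d.potential y x t * conj (y 0)) :=
  pot_algebra h rfl

lemma conj_coeff_oddPoly {y : Fin (2 * d.N + 1) → ℂ} (h : y 0 * conj (y 0) = 1) (x t : ℝ) :
    conj ((oddPoly y).coeff (d.N - 1)) =
      -I / 2 * (seedQ d.a d.c x t * conj (y 0) - -conj (d.potential y x t) * y 0) := by
  rw [potential_conj_mul h x t]
  simp [conj_seedR, map_ofNat]
  ring

section

variable (ha : d.a < 1) (hc : d.c ≠ 0) (hN : 1 ≤ d.N) {y : ℝ → ℝ → Fin (2 * d.N + 1) → ℂ}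
    (hy : d.IsDressing y)
include ha hc hN hy

/-- The `x`-part of the Lax system for the Darboux matrix. -/
lemma IsDressing.rows_fst {x t : ℝ} {y' : Fin (2 * d.N + 1) → ℂ}
    (hy' : ∀ j, HasDerivAt (fun u => y u t j) (y' j) x) {r q r₁ q₁ : ℂ}
    (hr : r = seedR d.a d.c x t) (hq : q = seedQ d.a d.c x t)
    (hr₁ : r₁ = d.potential (y x t) x t) (hq₁ : q₁ = -conj r₁) :
    evenPoly y' + C (I / 4 * (q * r - q₁ * r₁)) * evenPoly (y x t) +
        X * (C q * oddPoly (y x t) + C r₁ * cj (oddPoly (y x t))) = 0 ∧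
    oddPoly y' + C r * evenPoly (y x t) - C r₁ * cj (evenPoly (y x t)) -
        (C (2 * I) * X + C (-I + I / 4 * (q * r + q₁ * r₁))) * oddPoly (y x t) = 0 := by
  have hcr : conj r = -q := by rw [hr, hq, conj_seedR]
  have hcq : conj q = -r := by rw [hr, hq, conj_seedQ]
  have hcr₁ : conj r₁ = -q₁ := by rw [hq₁, neg_neg]
  have hcq₁ : conj q₁ = -r₁ := by rw [hq₁, map_neg, conj_conj]
  have haa := hy.norm_one x t
  have hb : (oddPoly (y x t)).coeff (d.N - 1) = -I / 2 * (r * y x t 0 - r₁ * conj (y x t 0)) := by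
    rw [hr, hr₁, ← potential_conj_mul haa x t]
  have hb' : conj ((oddPoly (y x t)).coeff (d.N - 1)) =
      -I / 2 * (q * conj (y x t 0) - q₁ * y x t 0) := by
    rw [hq, hq₁, hr₁, ← conj_coeff_oddPoly haa x t]
  obtain ⟨f', g', hf, hg, hf', hg'⟩ := fP_gP_coeffDeriv ha (x := fun u => u) (t := fun _ => t)
    (phase_hasDerivAt_fst d.a d.c x t) (YP_coeffDeriv_fst x t)
  have hqr : q * r = -(d.c : ℂ) ^ 2 := by rw [hr, hq, seedQ_mul_seedR]
  have e1 : C (-I * d.a / 2) + C I * d.KP * C (1 / 4) =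
      (C I * X + C (-I / 2 + I / 4 * (q * r)) : ℂ[X]).comp (d.lamP ^ 2) := by
    rw [hqr]
    refine Polynomial.funext fun z => ?_
    simp only [KP, eval_add, eval_sub, eval_mul, eval_C, eval_comp, eval_X, eval_pow, eval_ofNat]
    ring
  have e2 : ∀ z : ℂ, (4 : ℂ[X]) * C (1 / 4) * C z = (C z).comp (d.lamP ^ 2) := by
    intro z
    rw [show (4 : ℂ[X]) = C 4 from rfl, ← C_mul, C_comp]; norm_num
  rw [e1, e2, ← hr] at hf'
  rw [e1, e2, ← hq] at hg'
  have e5 : ∀ z : ℂ, conj z = z → cj (C I * X + C (-I / 2 + I / 4 * z)) =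
      -(C I * X + C (-I / 2 + I / 4 * z)) := by
    intro z hz
    refine Polynomial.funext fun w => ?_
    simp [hz, map_ofNat]
    ring
  have hdvd := lax_row_dvd (L := d.lamP) rfl (fun u => evenPoly_natDegree_le (y u t))
    (fun u => natDegree_le_of_degree_le (oddPoly_degree_lt (y u t)).le)
    (evenPoly_coeffDeriv hy') (oddPoly_coeffDeriv hy') hf hg
    (α := C I * X + C (-I / 2 + I / 4 * (q * r))) (β := C r) (γ := C q)
    (α₁ := C I * X + C (-I / 2 + I / 4 * (q₁ * r₁))) (β₁ := C r₁) (γ₁ := C q₁)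
    hf' hg'
    (fun u => (hy.isKer u t).dvd₁) (fun u => (hy.isKer u t).dvd₂)
    (e5 _ (by rw [map_mul, hcr, hcq]; ring)) (e5 _ (by rw [map_mul, hcr₁, hcq₁]; ring))
    (by simp [hcr]) (by simp [hcr₁])
  have e3 : (C I * X + C (-I / 2 + I / 4 * (q * r))) - (C I * X + C (-I / 2 + I / 4 * (q₁ * r₁))) =
      C (I / 4 * (q * r - q₁ * r₁)) := by
    rw [add_sub_add_left_eq_sub, ← C_sub]; congr 1; ring
  have e4 : (C I * X + C (-I / 2 + I / 4 * (q * r))) + (C I * X + C (-I / 2 + I / 4 * (q₁ * r₁))) =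
      C (2 * I) * X + C (-I + I / 4 * (q * r + q₁ * r₁)) := by
    refine Polynomial.funext fun w => ?_
    simp only [eval_add, eval_mul, eval_C, eval_X]
    ring
  rw [e3, e4] at hdvd
  have h0 : y x t 0 ≠ 0 := left_ne_zero_of_mul_eq_one haa
  have hdeg₁ : (evenPoly y' + C (I / 4 * (q * r - q₁ * r₁)) * evenPoly (y x t) +
      X * (C q * oddPoly (y x t) + C r₁ * cj (oddPoly (y x t)))).natDegree ≤ d.N := by
    rw [natDegree_le_iff_coeff_eq_zero]
    intro n hn
    obtain ⟨k, rfl⟩ : ∃ k, n = k + 1 := ⟨n - 1, by omega⟩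
    simp only [coeff_add, coeff_C_mul, coeff_X_mul, cj_coeff, coeff_evenPoly_eq_zero _ hn,
      coeff_oddPoly_eq_zero _ (show d.N ≤ k by omega), mul_zero, map_zero, add_zero]
  -- The coefficient of degree `N` is `r * y_0 - r₁ * conj y_0 - 2 * I * b`, with `b` the top
  -- coefficient of the odd part. Its vanishing is the definition of the transformed potential.
  have hdeg₂ : (oddPoly y' + C r * evenPoly (y x t) - C r₁ * cj (evenPoly (y x t)) -
      (C (2 * I) * X + C (-I + I / 4 * (q * r + q₁ * r₁))) * oddPoly (y x t)).degree < (d.N : WithBot ℕ) := by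
    rw [degree_lt_iff_coeff_zero]
    intro n hn
    obtain ⟨k, rfl⟩ : ∃ k, n = k + 1 := ⟨n - 1, by omega⟩
    rcases Nat.lt_or_ge d.N (k + 1) with h | h
    · simp only [add_mul, mul_assoc, coeff_X_mul, coeff_sub, coeff_add, coeff_C_mul, cj_coeff,
        coeff_evenPoly_eq_zero _ h, coeff_oddPoly_eq_zero _ hn,
        coeff_oddPoly_eq_zero _ (show d.N ≤ k by omega), mul_zero, map_zero, add_zero, sub_zero]
    · have hk : k = d.N - 1 := by omega
      have hk' : k + 1 = d.N := by omega
      simp only [add_mul, mul_assoc, coeff_X_mul, coeff_sub, coeff_add, coeff_C_mul,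
        coeff_oddPoly_eq_zero _ hn, cj_coeff]
      rw [hk', evenPoly_coeff_top, hk, hb]
      linear_combination (-(r * y x t 0 - r₁ * conj (y x t 0))) * (-I_sq)
  obtain ⟨τ, hτ₁, hτ₂⟩ :=
    (hy.isKer x t).exists_eq_C_mul ha hc hN h0 hdeg₁ hdeg₂ hdvd.1 hdvd.2
  -- The first row of the Lax expression is `τ` times the first row of the Darboux matrix. The two
  -- normalizations, differentiated, will force `τ = 0`.
  obtain ⟨κ, hκ0, hκ, hlast⟩ := hy.last
  have hy0 : y' (Fin.last _) = κ * conj (y' 0) := by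
    have := hy' (Fin.last _)
    simp only [hlast] at this
    exact this.unique ((hy' 0).star.const_mul κ)
  have hder : y' 0 * conj (y x t 0) + y x t 0 * conj (y' 0) = 0 := by
    have : HasDerivAt (fun u => y u t 0 * conj (y u t 0)) _ x := (hy' 0).mul (hy' 0).star
    simp only [hy.norm_one] at this
    exact this.unique (hasDerivAt_const x 1)
  have hz : τ = 0 := by
    refine (tau_x_algebra haa hb hb' hder ?_ hκ0 ?_).1
    · have := congrArg (fun p => p.coeff d.N) hτ₁
      simpa only [coeff_add, coeff_C_mul, coeff_X_mul_of_pos hN,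
        evenPoly_coeff_top, cj_coeff] using this
    · have := congrArg (fun p => p.coeff 0) hτ₁
      simpa only [coeff_add, coeff_C_mul, coeff_X_mul_zero, evenPoly_coeff_zero, hy0, hlast,
        add_zero] using this
  rw [hτ₁, hτ₂, hz]
  simp


/-- Coefficients of the `x`-part of the Lax system. -/
lemma IsDressing.coeff_fst {x t : ℝ} {y' : Fin (2 * d.N + 1) → ℂ}
    (hy' : ∀ j, HasDerivAt (fun u => y u t j) (y' j) x) {r q r₁ q₁ : ℂ}
    (hr : r = seedR d.a d.c x t) (hq : q = seedQ d.a d.c x t)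
    (hr₁ : r₁ = d.potential (y x t) x t) (hq₁ : q₁ = -conj r₁) :
    y' 0 = I / 4 * (q * r - q₁ * r₁) * y x t 0 ∧
    (evenPoly y').coeff (d.N - 1) + I / 4 * (q * r - q₁ * r₁) * (evenPoly (y x t)).coeff (d.N - 1) +
      (q * (X * oddPoly (y x t)).coeff (d.N - 1) +
        r₁ * conj ((X * oddPoly (y x t)).coeff (d.N - 1))) = 0 ∧
    (X * oddPoly (y x t)).coeff (d.N - 1) = -I / 2 * ((oddPoly y').coeff (d.N - 1) +
      r * (evenPoly (y x t)).coeff (d.N - 1) - r₁ * conj ((evenPoly (y x t)).coeff (d.N - 1)) -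
      (-I + I / 4 * (q * r + q₁ * r₁)) * (oddPoly (y x t)).coeff (d.N - 1)) := by
  obtain ⟨h1, h2⟩ := hy.rows_fst ha hc hN hy' hr hq hr₁ hq₁
  have haa := hy.norm_one x t
  have hb : (oddPoly (y x t)).coeff (d.N - 1) = -I / 2 * (r * y x t 0 - r₁ * conj (y x t 0)) := by
    rw [hr, hr₁, ← potential_conj_mul haa x t]
  have hb' : conj ((oddPoly (y x t)).coeff (d.N - 1)) =
      -I / 2 * (q * conj (y x t 0) - q₁ * y x t 0) := by
    rw [hq, hq₁, hr₁, ← conj_coeff_oddPoly haa x t]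
  refine ⟨?_, ?_, ?_⟩
  · have := congrArg (fun p => p.coeff d.N) h1
    simp only [coeff_add, coeff_C_mul, coeff_X_mul_of_pos hN, cj_coeff,
      evenPoly_coeff_top, coeff_zero] at this
    rw [hb', hb] at this
    linear_combination this
  · have := congrArg (fun p => p.coeff (d.N - 1)) h1
    simpa only [coeff_add, coeff_C_mul, coeff_X_mul_add_cj, coeff_zero] using this
  · have := congrArg (fun p => p.coeff (d.N - 1)) h2
    simp only [add_mul, mul_assoc, coeff_sub, coeff_add, coeff_C_mul, cj_coeff, coeff_zero] at this
    linear_combination (I / 2) * this + (X * oddPoly (y x t)).coeff (d.N - 1) * I_sq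

omit ha hc hN in
lemma IsDressing.coeff_oddPoly_fst {x t : ℝ} {y' : Fin (2 * d.N + 1) → ℂ}
    (hy' : ∀ j, HasDerivAt (fun u => y u t j) (y' j) x) {r₁x : ℂ}
    (hr₁x : HasDerivAt (fun u => d.potential (y u t) u t) r₁x x) :
    (oddPoly y').coeff (d.N - 1) =
      -I / 2 * (-I * d.a * seedR d.a d.c x t * y x t 0 + seedR d.a d.c x t * y' 0 -
        (r₁x * conj (y x t 0) + d.potential (y x t) x t * conj (y' 0))) := by
  have h1 := oddPoly_coeffDeriv hy' (d.N - 1)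
  simp only [fun u => potential_conj_mul (hy.norm_one u t) u t] at h1
  exact h1.unique ((((seedR_hasDerivAt (phase_hasDerivAt_fst d.a d.c x t)).mul (hy' 0)).sub
    (hr₁x.mul (hy' 0).star)).const_mul (-I / 2))

/-- The `t`-part of the Lax system for the Darboux matrix, modulo the `x`-part. -/
lemma IsDressing.rows_snd {x t : ℝ} {y' yt : Fin (2 * d.N + 1) → ℂ}
    (hy' : ∀ j, HasDerivAt (fun u => y u t j) (y' j) x)
    (hyt : ∀ j, HasDerivAt (fun u => y x u j) (yt j) t) {r q r₁ q₁ rx qx r₁x q₁x v v₁ : ℂ}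
    (hr : r = seedR d.a d.c x t) (hq : q = seedQ d.a d.c x t)
    (hr₁ : r₁ = d.potential (y x t) x t) (hq₁ : q₁ = -conj r₁)
    (hrx : rx = -I * d.a * r) (hqx : qx = I * d.a * q)
    (hr₁x : HasDerivAt (fun u => d.potential (y u t) u t) r₁x x) (hq₁x : q₁x = -conj r₁x)
    (hv : v = (qx * r - q * rx) / 4 - I / 8 * q ^ 2 * r ^ 2)
    (hv₁ : v₁ = (q₁x * r₁ - q₁ * r₁x) / 4 - I / 8 * q₁ ^ 2 * r₁ ^ 2) :
    evenPoly yt + C 2 * X * evenPoly y' +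
        (C (-I / 2 * (q * r - q₁ * r₁)) * X + C (v - v₁)) * evenPoly (y x t) +
        X * (C (q + (-q ^ 2 * r / 2 - I * qx)) * oddPoly (y x t) +
          C (r₁ + (-q₁ * r₁ ^ 2 / 2 + I * r₁x)) * cj (oddPoly (y x t))) = 0 ∧
    oddPoly yt + C 2 * X * oddPoly y' + C (r + (-q * r ^ 2 / 2 + I * rx)) * evenPoly (y x t) -
        C (r₁ + (-q₁ * r₁ ^ 2 / 2 + I * r₁x)) * cj (evenPoly (y x t)) +
        (C (-2 * I + I / 2 * (q * r + q₁ * r₁)) * X + C (I - (v + v₁))) * oddPoly (y x t) = 0 := by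
  obtain ⟨hx1, hx2⟩ := hy.rows_fst ha hc hN hy' hr hq hr₁ hq₁
  obtain ⟨hax, ha₁x, hb₂⟩ := hy.coeff_fst ha hc hN hy' hr hq hr₁ hq₁
  have hcr : conj r = -q := by rw [hr, hq, conj_seedR]
  have hcq : conj q = -r := by rw [hr, hq, conj_seedQ]
  have hcr₁ : conj r₁ = -q₁ := by rw [hq₁, neg_neg]
  have hcq₁ : conj q₁ = -r₁ := by rw [hq₁, map_neg, conj_conj]
  have hcr₁x : conj r₁x = -q₁x := by rw [hq₁x, neg_neg]
  have hcq₁x : conj q₁x = -r₁x := by rw [hq₁x, map_neg, conj_conj]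
  have hcrx : conj rx = -qx := by rw [hrx, hqx]; simp [hcr]
  have hcqx : conj qx = -rx := by rw [hrx, hqx]; simp [hcq]
  have hcv : conj v = -v := by
    rw [hv]; simp [hcr, hcq, hcrx, hcqx, map_ofNat]; ring
  have hcv₁ : conj v₁ = -v₁ := by
    rw [hv₁]; simp [hcr₁, hcq₁, hcr₁x, hcq₁x, map_ofNat]; ring
  have haa := hy.norm_one x t
  have hb : (oddPoly (y x t)).coeff (d.N - 1) = -I / 2 * (r * y x t 0 - r₁ * conj (y x t 0)) := by
    rw [hr, hr₁, ← potential_conj_mul haa x t]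
  have hb' : conj ((oddPoly (y x t)).coeff (d.N - 1)) =
      -I / 2 * (q * conj (y x t 0) - q₁ * y x t 0) := by
    rw [hq, hq₁, hr₁, ← conj_coeff_oddPoly haa x t]
  have hax' : conj (y' 0) = -I / 4 * (q * r - q₁ * r₁) * conj (y x t 0) := by
    rw [hax]; simp only [map_mul, map_sub, map_div₀, conj_I, map_ofNat, hcr, hcq, hcr₁, hcq₁]; ring
  have hbx := hy.coeff_oddPoly_fst hy' hr₁x
  rw [← hr, ← hr₁, ← hrx] at hbx
  obtain ⟨f', g', hf, hg, hf', hg'⟩ := fP_gP_coeffDeriv ha (x := fun _ => x) (t := fun u => u)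
    (phase_hasDerivAt_snd d.a d.c x t) (YP_coeffDeriv_snd x t)
  have hqr : q * r = -(d.c : ℂ) ^ 2 := by rw [hr, hq, seedQ_mul_seedR]
  have e1 : C (-I * ((d.a ^ 2 + (d.a - 1) * d.c ^ 2 : ℝ) : ℂ) / 2) + C I * d.KP * d.VP =
      (C (-2 * I) * X ^ 2 + C (2 * I - I * (q * r)) * X + C (v - I / 2) : ℂ[X]).comp
        (d.lamP ^ 2) := by
    have : v = -I * d.a * d.c ^ 2 / 2 - I / 8 * d.c ^ 4 := by
      rw [hv, hrx, hqx]
      linear_combination (I * d.a / 2 - I / 8 * (q * r - (d.c : ℂ) ^ 2)) * hqr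
    rw [hqr, this]
    refine Polynomial.funext fun z => ?_
    simp only [KP, VP, eval_add, eval_sub, eval_mul, eval_C, eval_comp, eval_X, eval_pow,
      eval_ofNat]
    push_cast
    ring
  have e2 : 4 * d.VP * C r =
      (C (-2 * r) * X + C (r + (-q * r ^ 2 / 2 + I * rx)) : ℂ[X]).comp (d.lamP ^ 2) := by
    refine Polynomial.funext fun z => ?_
    simp only [VP, eval_add, eval_sub, eval_mul, eval_C, eval_comp, eval_X, eval_pow,
      eval_ofNat, hrx]
    linear_combination (r / 2) * hqr + d.a * r * I_sq
  have e2' : 4 * d.VP * C q =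
      (C (-2 * q) * X + C (q + (-q ^ 2 * r / 2 - I * qx)) : ℂ[X]).comp (d.lamP ^ 2) := by
    refine Polynomial.funext fun z => ?_
    simp only [VP, eval_add, eval_sub, eval_mul, eval_C, eval_comp, eval_X, eval_pow,
      eval_ofNat, hqx]
    linear_combination (q / 2) * hqr + d.a * q * I_sq
  rw [e1, ← hr, e2] at hf'
  rw [e1, ← hq, e2'] at hg'
  have e5 : ∀ z w : ℂ, conj z = z → conj w = -w →
      cj (C (-2 * I) * X ^ 2 + C (2 * I - I * z) * X + C (w - I / 2)) =
      -(C (-2 * I) * X ^ 2 + C (2 * I - I * z) * X + C (w - I / 2)) := by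
    intro z w hz hw
    refine Polynomial.funext fun w => ?_
    simp [hz, hw, map_ofNat]
    ring
  have hdvd := lax_row_dvd (L := d.lamP) rfl (fun u => evenPoly_natDegree_le (y x u))
    (fun u => natDegree_le_of_degree_le (oddPoly_degree_lt (y x u)).le)
    (evenPoly_coeffDeriv hyt) (oddPoly_coeffDeriv hyt) hf hg
    (α := C (-2 * I) * X ^ 2 + C (2 * I - I * (q * r)) * X + C (v - I / 2))
    (β := C (-2 * r) * X + C (r + (-q * r ^ 2 / 2 + I * rx)))
    (γ := C (-2 * q) * X + C (q + (-q ^ 2 * r / 2 - I * qx)))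
    (α₁ := C (-2 * I) * X ^ 2 + C (2 * I - I * (q₁ * r₁)) * X + C (v₁ - I / 2))
    (β₁ := C (-2 * r₁) * X + C (r₁ + (-q₁ * r₁ ^ 2 / 2 + I * r₁x)))
    (γ₁ := C (-2 * q₁) * X + C (q₁ + (-q₁ ^ 2 * r₁ / 2 - I * q₁x)))
    hf' hg'
    (fun u => (hy.isKer x u).dvd₁) (fun u => (hy.isKer x u).dvd₂)
    (e5 _ _ (by rw [map_mul, hcr, hcq]; ring) hcv)
    (e5 _ _ (by rw [map_mul, hcr₁, hcq₁]; ring) hcv₁)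
    (by
      refine Polynomial.funext fun w => ?_
      simp [hcr, hcq, hcrx, map_ofNat]
      ring)
    (by
      refine Polynomial.funext fun w => ?_
      simp [hcr₁, hcq₁, hcr₁x, map_ofNat]
      ring)
  generalize hA : evenPoly yt + C 2 * X * evenPoly y' +
        (C (-I / 2 * (q * r - q₁ * r₁)) * X + C (v - v₁)) * evenPoly (y x t) +
        X * (C (q + (-q ^ 2 * r / 2 - I * qx)) * oddPoly (y x t) +
          C (r₁ + (-q₁ * r₁ ^ 2 / 2 + I * r₁x)) * cj (oddPoly (y x t))) = A
  generalize hB : oddPoly yt + C 2 * X * oddPoly y' +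
        C (r + (-q * r ^ 2 / 2 + I * rx)) * evenPoly (y x t) -
        C (r₁ + (-q₁ * r₁ ^ 2 / 2 + I * r₁x)) * cj (evenPoly (y x t)) +
        (C (-2 * I + I / 2 * (q * r + q₁ * r₁)) * X + C (I - (v + v₁))) * oddPoly (y x t) = B
  -- The `t`-part exceeds the admissible degree. Adding `2 * X` times the vanishing `x`-part removes
  -- the linear terms `-2 * q * X` and `-2 * r₁ * X` in the off-diagonal coefficients.
  have eA : evenPoly yt + ((C (-2 * I) * X ^ 2 + C (2 * I - I * (q * r)) * X + C (v - I / 2)) -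
        (C (-2 * I) * X ^ 2 + C (2 * I - I * (q₁ * r₁)) * X + C (v₁ - I / 2))) * evenPoly (y x t) +
      X * ((C (-2 * q) * X + C (q + (-q ^ 2 * r / 2 - I * qx))) * oddPoly (y x t) +
        (C (-2 * r₁) * X + C (r₁ + (-q₁ * r₁ ^ 2 / 2 + I * r₁x))) * cj (oddPoly (y x t))) = A := by
    rw [← hA]
    refine Polynomial.funext fun z => ?_
    have h := congrArg (eval z) hx1
    simp only [eval_add, eval_sub, eval_mul, eval_C, eval_X, eval_pow, eval_zero] at h ⊢
    linear_combination (-2 * z) * h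
  have eB : oddPoly yt + (C (-2 * r) * X + C (r + (-q * r ^ 2 / 2 + I * rx))) * evenPoly (y x t) -
      (C (-2 * r₁) * X + C (r₁ + (-q₁ * r₁ ^ 2 / 2 + I * r₁x))) * cj (evenPoly (y x t)) -
      ((C (-2 * I) * X ^ 2 + C (2 * I - I * (q * r)) * X + C (v - I / 2)) +
        (C (-2 * I) * X ^ 2 + C (2 * I - I * (q₁ * r₁)) * X + C (v₁ - I / 2))) *
        oddPoly (y x t) = B := by
    rw [← hB]
    refine Polynomial.funext fun z => ?_
    have h := congrArg (eval z) hx2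
    simp only [eval_add, eval_sub, eval_mul, eval_C, eval_X, eval_pow, eval_zero] at h ⊢
    linear_combination (-2 * z) * h
  rw [eA, eB] at hdvd
  have h0 : y x t 0 ≠ 0 := left_ne_zero_of_mul_eq_one haa
  have hdeg₁ : A.natDegree ≤ d.N := by
    rw [natDegree_le_iff_coeff_eq_zero]
    intro n hn
    obtain ⟨k, rfl⟩ : ∃ k, n = k + 1 := ⟨n - 1, by omega⟩
    rw [← hA]
    simp only [coeff_add, add_mul, mul_assoc, coeff_C_mul, coeff_X_mul, cj_coeff,
      coeff_evenPoly_eq_zero _ hn, coeff_oddPoly_eq_zero _ (show d.N ≤ k by omega), mul_zero,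
      map_zero, add_zero, zero_add]
    rcases Nat.lt_or_ge d.N k with h | h
    · simp only [coeff_evenPoly_eq_zero _ h, mul_zero, add_zero]
    -- The coefficient of degree `N + 1` vanishes by the first-order equation `hax` for `y_0`.
    · rw [show k = d.N by omega, evenPoly_coeff_top, evenPoly_coeff_top, hax]
      ring
  -- In degree `N` the formulas for the top odd coefficient and for its `x`-derivative cancel all
  -- terms.
  have hdeg₂ : B.degree < (d.N : WithBot ℕ) := by
    rw [degree_lt_iff_coeff_zero]
    intro n hn
    obtain ⟨k, rfl⟩ : ∃ k, n = k + 1 := ⟨n - 1, by omega⟩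
    rw [← hB]
    rcases Nat.lt_or_ge d.N (k + 1) with h | h
    · simp only [add_mul, mul_assoc, coeff_X_mul, coeff_sub, coeff_add, coeff_C_mul, cj_coeff,
        coeff_evenPoly_eq_zero _ h, coeff_oddPoly_eq_zero _ hn,
        coeff_oddPoly_eq_zero _ (show d.N ≤ k by omega), mul_zero, map_zero, add_zero, sub_zero]
    · have hk : k = d.N - 1 := by omega
      have hk' : k + 1 = d.N := by omega
      simp only [add_mul, mul_assoc, coeff_X_mul, coeff_sub, coeff_add, coeff_C_mul,
        coeff_oddPoly_eq_zero _ hn, cj_coeff]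
      rw [hk', evenPoly_coeff_top, hk, hb, hbx, hax', hax]
      ring_nf
      simp only [I_sq]
      ring
  obtain ⟨τ, hτ₁, hτ₂⟩ :=
    (hy.isKer x t).exists_eq_C_mul ha hc hN h0 hdeg₁ hdeg₂ hdvd.1 hdvd.2
  obtain ⟨κ, hκ0, hκ, hlast⟩ := hy.last
  have hy0 : yt (Fin.last _) = κ * conj (yt 0) := by
    have := hyt (Fin.last _)
    simp only [hlast] at this
    exact this.unique ((hyt 0).star.const_mul κ)
  have hder : yt 0 * conj (y x t 0) + y x t 0 * conj (yt 0) = 0 := by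
    have : HasDerivAt (fun u => y x u 0 * conj (y x u 0)) _ t := (hyt 0).mul (hyt 0).star
    simp only [hy.norm_one] at this
    exact this.unique (hasDerivAt_const t 1)
  have hz : τ = 0 := by
    refine tau_t_algebra (qx := qx) (q₁x := q₁x) haa hb hb' ?_ ?_ ha₁x hb₂ ?_ hder hv hv₁ ?_ ?_ 
      (bx' := conj ((oddPoly y').coeff (d.N - 1)))
      (a₁' := conj ((evenPoly (y x t)).coeff (d.N - 1)))
    · rw [hbx, hax', hax]
    · rw [hbx, hax', hax]
      simp [hcr, hcq, hcr₁, hcq₁, hcrx, hcr₁x, map_ofNat]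
      ring
    · rw [hb₂]
      simp [hcr, hcq, hcr₁, hcq₁, map_ofNat]
      ring
    · have := congrArg (fun p => p.coeff d.N) hτ₁
      rw [← hA] at this
      simp only [add_mul, mul_assoc, coeff_add, coeff_C_mul, cj_coeff,
        coeff_X_mul_of_pos hN, evenPoly_coeff_top] at this
      linear_combination this
    · have := congrArg (fun p => p.coeff 0) hτ₁
      rw [← hA] at this
      simp only [add_mul, mul_assoc, coeff_add, coeff_C_mul, coeff_X_mul_zero, evenPoly_coeff_zero,
        hy0, hlast] at this
      exact mul_left_cancel₀ hκ0 (by linear_combination this)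
  rw [hτ₁, hτ₂, hz]
  simp

end

end Data

end CLL

/-! ### The transformed potential solves the equation -/

namespace CLL

open Polynomial

lemma hasDerivAt_conj {F : ℝ → ℂ} {F' : ℂ} {x : ℝ} (h : HasDerivAt F F' x) :
    HasDerivAt (fun u => conj (F u)) (conj F') x := h.star

/-- The product rule for the formula giving the second odd coefficient, with `q = -conj r` inserted
and the result arranged as the hypotheses `hbxx` and `hb₂x` of `pde_algebra`. -/
lemma hasDerivAt_slope_coeff {R R₁ R₁d A a₁ b : ℝ → ℂ} {κ Rx R₁xx Ax a₁x bx : ℂ} {x : ℝ}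
    (hR : HasDerivAt R Rx x) (hR₁ : HasDerivAt R₁ (R₁d x) x) (hR₁d : HasDerivAt R₁d R₁xx x)
    (hA : HasDerivAt A Ax x) (ha₁ : HasDerivAt a₁ a₁x x) (hb : HasDerivAt b bx x) :
    HasDerivAt (fun u => -I / 2 * (-I / 2 * (κ * R u * A u + R u *
        (I / 4 * (-conj (R u) * R u - -conj (R₁ u) * R₁ u) * A u) -
        (R₁d u * conj (A u) + R₁ u * (-I / 4 * (-conj (R u) * R u - -conj (R₁ u) * R₁ u) *
          conj (A u)))) + R u * a₁ u - R₁ u * conj (a₁ u) -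
        (-I + I / 4 * (-conj (R u) * R u + -conj (R₁ u) * R₁ u)) * b u))
      (-I / 2 * (-I / 2 * (κ * Rx * A x + κ * R x * Ax +
        I / 4 * (Rx * (-conj (R x) * R x - -conj (R₁ x) * R₁ x) * A x +
          R x * (-conj Rx * R x + -conj (R x) * Rx -
            (-conj (R₁d x) * R₁ x + -conj (R₁ x) * R₁d x)) * A x +
          R x * (-conj (R x) * R x - -conj (R₁ x) * R₁ x) * Ax) - R₁xx * conj (A x) -
        R₁d x * conj Ax +
        I / 4 * (R₁d x * (-conj (R x) * R x - -conj (R₁ x) * R₁ x) * conj (A x) +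
          R₁ x * (-conj Rx * R x + -conj (R x) * Rx -
            (-conj (R₁d x) * R₁ x + -conj (R₁ x) * R₁d x)) * conj (A x) +
          R₁ x * (-conj (R x) * R x - -conj (R₁ x) * R₁ x) * conj Ax)) +
        (Rx * a₁ x + R x * a₁x) - (R₁d x * conj (a₁ x) + R₁ x * conj a₁x) -
        (I / 4 * (-conj Rx * R x + -conj (R x) * Rx +
          (-conj (R₁d x) * R₁ x + -conj (R₁ x) * R₁d x)) * b x +
        (-I + I / 4 * (-conj (R x) * R x + -conj (R₁ x) * R₁ x)) * bx))) x := by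
  have hRc := (hasDerivAt_conj hR).fun_neg.fun_mul hR
  have hR₁c := (hasDerivAt_conj hR₁).fun_neg.fun_mul hR₁
  have hW := hRc.fun_sub hR₁c
  have hAc := hasDerivAt_conj hA
  refine (((((((hR.const_mul κ).fun_mul hA).fun_add (hR.fun_mul ((hW.const_mul
    (I / 4)).fun_mul hA))).fun_sub ((hR₁d.fun_mul hAc).fun_add (hR₁.fun_mul ((hW.const_mul
    (-I / 4)).fun_mul hAc)))).const_mul (-I / 2)).fun_add (hR.fun_mul ha₁)).fun_sub
    (hR₁.fun_mul (hasDerivAt_conj ha₁)) |>.fun_sub (((hRc.fun_add hR₁c).const_mul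
    (I / 4)).const_add (-I) |>.fun_mul hb)).const_mul (-I / 2) |>.congr_deriv ?_
  ring

namespace Data

variable {d : Data}

lemma contDiff_seedR : ContDiff ℝ ∞ fun p : ℝ × ℝ => seedR d.a d.c p.1 p.2 := by
  simp only [seedR_eq]
  exact contDiff_const.mul (contDiff_conj_carrier.pow 2)

section

variable (ha : d.a < 1) (hc : d.c ≠ 0) (hN : 1 ≤ d.N) {y : ℝ → ℝ → Fin (2 * d.N + 1) → ℂ}
    (hy : d.IsDressing y)
include hN hy

lemma IsDressing.contDiff_potential :
    ContDiff ℝ ∞ fun p : ℝ × ℝ => d.potential (y p.1 p.2) p.1 p.2 := by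
  simp only [potential, oddPoly_coeff_top hN]
  exact (hy.contDiff 0).mul (((hy.contDiff 0).mul contDiff_seedR).sub
    (contDiff_const.mul (hy.contDiff _)))

include ha hc

/-- The potential obtained from a dressing of the seed solves the equation. -/
lemma IsDressing.isSolution : IsSolution fun x t => d.potential (y x t) x t := by
  have hpot := hy.contDiff_potential hN
  refine ⟨hpot, fun x t => ?_⟩
  have hfst : ∀ {F : ℝ × ℝ → ℂ}, ContDiff ℝ ∞ F → ∀ t, ContDiff ℝ ∞ fun u => F (u, t) :=
    fun h t => h.comp (contDiff_id.prodMk contDiff_const)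
  have hsnd : ∀ {F : ℝ × ℝ → ℂ}, ContDiff ℝ ∞ F → ∀ x, ContDiff ℝ ∞ fun u => F (x, u) :=
    fun h x => h.comp (contDiff_const.prodMk contDiff_id)
  have hder : ∀ {F : ℝ → ℂ}, ContDiff ℝ ∞ F → ∀ u, HasDerivAt F (deriv F u) u :=
    fun h u => (h.differentiable (by simp) u).hasDerivAt
  set R₁ : ℝ → ℂ := fun u => d.potential (y u t) u t with hR₁
  have hR₁s : ContDiff ℝ ∞ R₁ := hfst hpot t
  have hR₁d := hder hR₁s
  have hR₁dd : HasDerivAt (deriv R₁) (iteratedDeriv 2 R₁ x) x := by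
    rw [iteratedDeriv_succ, iteratedDeriv_one]
    exact hder (hR₁s.iterate_deriv 1) x
  have hR₁t := hder (hsnd hpot x) t
  obtain ⟨yx, hyx'⟩ : ∃ yx : ℝ → Fin (2 * d.N + 1) → ℂ,
      ∀ u j, HasDerivAt (fun w => y w t j) (yx u j) u :=
    ⟨_, fun u j => hder (hfst (hy.contDiff j) t) u⟩
  obtain ⟨yt, hyt⟩ : ∃ yt : Fin (2 * d.N + 1) → ℂ, ∀ j, HasDerivAt (fun w => y x w j) (yt j) t :=
    ⟨_, fun j => hder (hsnd (hy.contDiff j) x) t⟩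
  have hR := seedR_hasDerivAt (phase_hasDerivAt_fst d.a d.c x t)
  have hRt := seedR_hasDerivAt (phase_hasDerivAt_snd d.a d.c x t)
  have hQR : ∀ u, seedQ d.a d.c u t = -conj (seedR d.a d.c u t) := fun u => by simp [conj_seedR]
  have hfun := fun u => hy.coeff_fst ha hc hN (hyx' u) rfl (hQR u).symm rfl rfl
  have hbfun := fun u => hy.coeff_oddPoly_fst (hyx' u) (hR₁d u)
  have haa := hy.norm_one x t
  obtain ⟨hax, ha₁x, hb₂⟩ := hfun x
  obtain ⟨ht1, ht2⟩ := hy.rows_snd ha hc hN (hyx' x) hyt rfl (hQR x).symm rfl rfl rfl rfl (hR₁d x)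
    rfl rfl rfl
  have hbx : ∀ u, (oddPoly (yx u)).coeff (d.N - 1) =
      -I / 2 * (-I * d.a * seedR d.a d.c u t * y u t 0 + seedR d.a d.c u t *
        (I / 4 * (-conj (seedR d.a d.c u t) * seedR d.a d.c u t - -conj (R₁ u) * R₁ u) * y u t 0) -
        (deriv R₁ u * conj (y u t 0) + R₁ u * (-I / 4 * (-conj (seedR d.a d.c u t) *
          seedR d.a d.c u t - -conj (R₁ u) * R₁ u) * conj (y u t 0)))) := by
    intro u
    rw [hbfun, (hfun u).1]
    simp only [map_mul, map_sub, map_div₀, conj_I, map_ofNat, map_neg, conj_conj]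
    ring
  have ha₁ := evenPoly_coeffDeriv (hyx' x) (d.N - 1)
  have hb := oddPoly_coeffDeriv (hyx' x) (d.N - 1)
  have hb₂x : HasDerivAt (fun u => (X * oddPoly (y u t)).coeff (d.N - 1)) _ x :=
    ((CoeffDeriv.const X x).mul (oddPoly_coeffDeriv (hyx' x))) (d.N - 1)
  simp only [fun u => (hfun u).2.2, hbx, zero_mul, zero_add] at hb₂x
  -- The second odd coefficient has been differentiated once as a coefficient of `X * oddPoly` and
  -- once through its closed formula, where the second derivative of the new potential appears.
  have hb₂x' := hb₂x.unique (hasDerivAt_slope_coeff hR (hR₁d x) hR₁dd (hyx' x 0) ha₁ hb)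
  have hder : yt 0 * conj (y x t 0) + y x t 0 * conj (yt 0) = 0 := by
    have : HasDerivAt (fun u => y x u 0 * conj (y x u 0)) _ t := (hyt 0).mul (hyt 0).star
    simp only [hy.norm_one] at this
    exact this.unique (hasDerivAt_const t 1)
  obtain ⟨κ, hκ0, -, hlast⟩ := hy.last
  have hy0 : yt (Fin.last _) = κ * conj (yt 0) := by
    have := hyt (Fin.last _)
    simp only [hlast] at this
    exact this.unique ((hyt 0).star.const_mul κ)
  have hqr := seedQ_mul_seedR (d := d) x t
  rw [hQR] at hqr
  set r := seedR d.a d.c x t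
  set v := (I * d.a * -conj r * r - -conj r * (-I * d.a * r)) / 4 - I / 8 * (-conj r) ^ 2 * r ^ 2
    with hv
  set v₁ := (-conj (deriv R₁ x) * R₁ x - -conj (R₁ x) * deriv R₁ x) / 4 -
    I / 8 * (-conj (R₁ x)) ^ 2 * R₁ x ^ 2 with hv₁
  -- The constant coefficient of the even `t`-equation involves only the last entry, hence only the
  -- conjugate of the first.
  have hat' : conj (yt 0) = -(v - v₁) * conj (y x t 0) := by
    have := congrArg (fun p => p.coeff 0) ht1
    simp only [add_mul, mul_assoc, coeff_add, coeff_C_mul, coeff_X_mul_zero, evenPoly_coeff_zero,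
      mul_zero, add_zero, zero_add, coeff_zero] at this
    change yt _ + (v - v₁) * _ = 0 at this
    rw [hy0, hlast] at this
    exact mul_left_cancel₀ hκ0 (by linear_combination this)
  have hat : yt 0 = (v - v₁) * y x t 0 := by
    rw [hat'] at hder
    linear_combination y x t 0 * hder + ((v - v₁) * y x t 0 - yt 0) * haa
  have hbt := oddPoly_coeffDeriv hyt (d.N - 1)
  simp only [fun u => potential_conj_mul (hy.norm_one x u) x u] at hbt
  replace hbt := hbt.unique (((hRt.mul (hyt 0)).sub (hR₁t.mul (hyt 0).star)).const_mul (-I / 2))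
  have hrr : seedR d.a d.c x t = r := rfl
  have hpr : d.potential (y x t) x t = R₁ x := rfl
  have hax' : conj (yx x 0) = -I / 4 * (-conj r * r - -conj (R₁ x) * R₁ x) * conj (y x t 0) := by
    rw [hax, hpr]
    simp only [map_mul, map_sub, map_div₀, conj_I, map_ofNat, map_neg, conj_conj]
    ring
  rw [hpr] at hax ha₁x hb₂ ht2
  have hcx : -conj (-I * d.a * r) = I * d.a * -conj r := by simp
  rw [hax', hax, hcx] at hb₂x'
  -- The coefficient of degree `N - 1` of the odd `t`-equation: it contains the time derivative of
  -- the new potential and the slope `b₂x`, hence the whole differential equation.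
  have hcoef : (oddPoly yt).coeff (d.N - 1) + 2 * (X * oddPoly (yx x)).coeff (d.N - 1) +
      (r + (- -conj r * r ^ 2 / 2 + I * (-I * d.a * r))) * (evenPoly (y x t)).coeff (d.N - 1) -
      (R₁ x + (- -conj (R₁ x) * R₁ x ^ 2 / 2 + I * deriv R₁ x)) *
        conj ((evenPoly (y x t)).coeff (d.N - 1)) +
      (-2 * I + I / 2 * (-conj r * r + -conj (R₁ x) * R₁ x)) *
        (X * oddPoly (y x t)).coeff (d.N - 1) + I * (oddPoly (y x t)).coeff (d.N - 1) -
      (v + v₁) * (oddPoly (y x t)).coeff (d.N - 1) = 0 := by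
    have := congrArg (fun p => p.coeff (d.N - 1)) ht2
    simp only [add_mul, mul_assoc, coeff_sub, coeff_add, coeff_C_mul, cj_coeff,
      coeff_zero] at this
    linear_combination this
  have hseed : I * (-I * ((d.a ^ 2 + (d.a - 1) * d.c ^ 2 : ℝ) : ℂ) * r) +
      -I * d.a * (-I * d.a * r) - -conj r * r ^ 2 + I * -conj r * r * (-I * d.a * r) = 0 := by
    push_cast
    linear_combination (-(1 - d.a) * r) * hqr +
        (-(d.a ^ 2 + (d.a - 1) * d.c ^ 2) + d.a ^ 2 - d.a * (-conj r * r)) * r * I_sq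
  have hb : (oddPoly (y x t)).coeff (d.N - 1) = -I / 2 * (r * y x t 0 - R₁ x * conj (y x t 0)) :=
    potential_conj_mul haa x t
  have hb' : conj ((oddPoly (y x t)).coeff (d.N - 1)) =
      -I / 2 * (-conj r * conj (y x t 0) - -conj (R₁ x) * y x t 0) := by
    rw [conj_coeff_oddPoly haa x t, hQR]
  have hbx₀ := hbx x
  have hbx' : conj ((oddPoly (yx x)).coeff (d.N - 1)) = -I / 2 * (I * d.a * -conj r *
      conj (y x t 0) + -conj r * (-I / 4 * (-conj r * r - -conj (R₁ x) * R₁ x) * conj (y x t 0)) -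
      (-conj (deriv R₁ x) * y x t 0 + -conj (R₁ x) * (I / 4 * (-conj r * r -
        -conj (R₁ x) * R₁ x) * y x t 0))) := by
    rw [hbx]
    simp only [map_mul, map_sub, map_add, map_div₀, conj_I, map_ofNat, map_neg, conj_conj,
      conj_ofReal]
    ring
  have ha₁x' : conj ((evenPoly (yx x)).coeff (d.N - 1)) = I / 4 * (-conj r * r -
      -conj (R₁ x) * R₁ x) * conj ((evenPoly (y x t)).coeff (d.N - 1)) +
      (r * conj ((X * oddPoly (y x t)).coeff (d.N - 1)) +
        -conj (R₁ x) * (X * oddPoly (y x t)).coeff (d.N - 1)) := by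
    rw [eq_neg_of_add_eq_zero_left ((add_assoc _ _ _).symm.trans ha₁x)]
    simp only [map_mul, map_sub, map_add, map_div₀, conj_I, map_ofNat, map_neg, conj_conj]
    ring
  have hb₂' : conj ((X * oddPoly (y x t)).coeff (d.N - 1)) = I / 2 * (
      conj ((oddPoly (yx x)).coeff (d.N - 1)) - -conj r * conj ((evenPoly (y x t)).coeff (d.N - 1)) +
      -conj (R₁ x) * (evenPoly (y x t)).coeff (d.N - 1) - (I - I / 4 * (-conj r * r +
        -conj (R₁ x) * R₁ x)) * conj ((oddPoly (y x t)).coeff (d.N - 1))) := by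
    rw [hb₂]
    simp only [map_mul, map_sub, map_add, map_div₀, conj_I, map_ofNat, map_neg, conj_conj]
    ring
  have key := pde_algebra haa rfl rfl hb hb' hbx₀ hbx' rfl ha₁x ha₁x' hb₂ hb₂' hb₂x' hat hat' hbt
    hv hv₁ hcoef hseed
  have hn : ((‖R₁ x‖ : ℝ) : ℂ) ^ 2 = R₁ x * conj (R₁ x) := (Complex.mul_conj' _).symm
  change I * deriv (fun u => d.potential (y x u) x u) t + iteratedDeriv 2 R₁ x +
    ((‖R₁ x‖ : ℝ) : ℂ) ^ 2 * R₁ x - I * ((‖R₁ x‖ : ℝ) : ℂ) ^ 2 * deriv R₁ x = 0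
  rw [hn]
  linear_combination key

end

section

variable (ha : d.a < 1) (hc : d.c ≠ 0) (hroot : AnalyticAt ℝ d.root 0)
    (hsq : ∀ᶠ ε in 𝓝 (0 : ℝ), d.root ε ^ 2 = S d.a d.c (lamOdd d.a d.c ε)) (hN : 1 ≤ d.N)
include ha hc hroot hsq hN

lemma rogue_eq_potential (x t : ℝ) : d.rogue x t = d.potential (d.dressing x t) x t := by
  rw [rogue_eq_dressing ha hc hroot hsq hN, potential, oddPoly_coeff_top hN]

lemma isSolution_rogue : IsSolution d.rogue := by
  have := (isDressing ha hc hroot hsq hN).isSolution ha hc hN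
  simp only [← rogue_eq_potential ha hc hroot hsq hN] at this
  exact this

end

end Data

end CLL

/-! ### Confluence of zeros -/

namespace CLL

/-! ### Zeros merging at a point -/

section Rolle

/-- Rolle's theorem for a finite set of zeros. -/
lemma exists_finset_deriv_eq_zero {φ : ℝ → ℝ} {u v : ℝ} (hφ : ContinuousOn φ (Set.Icc u v))
    {Z : Finset ℝ} (hZ : ∀ z ∈ Z, z ∈ Set.Icc u v ∧ φ z = 0) :
    ∃ Z' : Finset ℝ, (∀ z ∈ Z', z ∈ Set.Icc u v ∧ deriv φ z = 0) ∧ Z.card ≤ Z'.card + 1 := by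
  classical
  have h : ∀ p : ℝ × ℝ, ∃ c, p.1 ∈ Z → p.2 ∈ Z → p.1 < p.2 →
      c ∈ Set.Ioo p.1 p.2 ∧ deriv φ c = 0 := by
    intro p
    by_cases hp : p.1 ∈ Z ∧ p.2 ∈ Z ∧ p.1 < p.2
    · obtain ⟨h1, h2, h3⟩ := hp
      obtain ⟨c, hc, hc'⟩ := exists_deriv_eq_zero h3
        (hφ.mono (Set.Icc_subset_Icc (hZ _ h1).1.1 (hZ _ h2).1.2))
        ((hZ _ h1).2.trans (hZ _ h2).2.symm)
      exact ⟨c, fun _ _ _ => ⟨hc, hc'⟩⟩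
    · exact ⟨0, fun h1 h2 h3 => absurd ⟨h1, h2, h3⟩ hp⟩
  choose c hc using h
  refine ⟨((Z ×ˢ Z).filter fun p => p.1 < p.2).image c, fun z hz => ?_, ?_⟩
  · obtain ⟨p, hp, rfl⟩ := Finset.mem_image.1 hz
    rw [Finset.mem_filter, Finset.mem_product] at hp
    obtain ⟨h1, h2⟩ := hc p hp.1.1 hp.1.2 hp.2
    exact ⟨⟨(hZ _ hp.1.1).1.1.trans h1.1.le, h1.2.le.trans (hZ _ hp.1.2).1.2⟩, h2⟩
  · refine Finset.card_le_of_interleaved fun x hx y hy hxy _ => ⟨c (x, y), ?_, ?_⟩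
    · exact Finset.mem_image_of_mem _ (Finset.mem_filter.2 ⟨Finset.mk_mem_product hx hy, hxy⟩)
    · exact (hc (x, y) hx hy hxy).1

lemma exists_finset_iteratedDeriv_eq_zero {φ : ℝ → ℝ} {u v : ℝ}
    (hφ : ∀ j, ContinuousOn (iteratedDeriv j φ) (Set.Icc u v))
    {Z : Finset ℝ} (hZ : ∀ z ∈ Z, z ∈ Set.Icc u v ∧ φ z = 0) (j : ℕ) :
    ∃ Z' : Finset ℝ, (∀ z ∈ Z', z ∈ Set.Icc u v ∧ iteratedDeriv j φ z = 0) ∧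
      Z.card ≤ Z'.card + j := by
  induction j with
  | zero => exact ⟨Z, by simpa using hZ, le_rfl⟩
  | succ j ih =>
    obtain ⟨Z₁, h1, h2⟩ := ih
    obtain ⟨Z₂, h3, h4⟩ := exists_finset_deriv_eq_zero (hφ j) h1
    exact ⟨Z₂, by simpa only [iteratedDeriv_succ] using h3, by omega⟩

lemma iteratedDeriv_clm_comp (L : ℂ →L[ℝ] ℝ) {F : ℝ → ℂ} (n : ℕ) {x : ℝ} (hF : AnalyticAt ℝ F x) :
    iteratedDeriv n (fun ε => L (F ε)) x = L (iteratedDeriv n F x) := by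
  induction n generalizing x with
  | zero => simp
  | succ n ih =>
    rw [iteratedDeriv_succ, iteratedDeriv_succ]
    have h : iteratedDeriv n (fun ε => L (F ε)) =ᶠ[𝓝 x] fun ε => L (iteratedDeriv n F ε) :=
      hF.eventually_analyticAt.mono fun ε h => ih h
    rw [h.deriv_eq]
    have h2 : AnalyticAt ℝ (iteratedDeriv n F) x := by
      rw [iteratedDeriv_eq_iterate]; exact hF.iterated_deriv n
    exact (L.hasFDerivAt.comp_hasDerivAt x h2.differentiableAt.hasDerivAt).deriv

lemma analyticAt_sum_mul {ι : Type*} [Fintype ι] {G : ι → ℝ → ℂ} {ε : ℝ}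
    (hG : ∀ i, AnalyticAt ℝ (G i) ε) (y : ι → ℂ) :
    AnalyticAt ℝ (fun ε => ∑ i, y i * G i ε) ε :=
  Finset.analyticAt_fun_sum _ fun i _ => analyticAt_const.mul (hG i)

lemma iteratedDeriv_sum_mul {ι : Type*} [Fintype ι] {G : ι → ℝ → ℂ} {ε : ℝ}
    (hG : ∀ i, AnalyticAt ℝ (G i) ε) (y : ι → ℂ) (n : ℕ) :
    iteratedDeriv n (fun ε => ∑ i, y i * G i ε) ε = ∑ i, y i * iteratedDeriv n (G i) ε := by
  have h : ∀ i ∈ Finset.univ, ContDiffAt ℝ n (fun ε => y i * G i ε) ε :=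
    fun i _ => (analyticAt_const.mul (hG i)).contDiffAt
  rw [iteratedDeriv_fun_sum h]
  simp only [iteratedDeriv_const_mul_field]

/-- If linear combinations of analytic functions have `n` zeros tending to `0` and the
coefficients converge, then the limiting combination vanishes to order `n` at `0`. -/
lemma iteratedDeriv_eq_zero_of_tendsto {ι α : Type*} [Fintype ι] {l : Filter α} [l.NeBot]
    {G : ι → ℝ → ℂ} (hG : ∀ i, AnalyticAt ℝ (G i) 0) {y : α → ι → ℂ} {y₀ : ι → ℂ}
    (hy : Tendsto y l (𝓝 y₀)) {Z : α → Finset ℝ} {n : ℕ} (hcard : ∀ᶠ a in l, n ≤ (Z a).card)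
    {η : α → ℝ} (hη : Tendsto η l (𝓝 0))
    (hZ : ∀ᶠ a in l, ∀ z ∈ Z a, |z| ≤ η a ∧ ∑ i, y a i * G i z = 0) {j : ℕ} (hj : j < n) :
    iteratedDeriv j (fun ε => ∑ i, y₀ i * G i ε) 0 = 0 := by
  -- Rolle's theorem fails for complex-valued functions. It is applied to the real and imaginary
  -- parts separately, whose intermediate zeros may differ but all tend to `0`.
  have key : ∀ L : ℂ →L[ℝ] ℝ, L (∑ i, y₀ i * iteratedDeriv j (G i) 0) = 0 := by
    intro L
    have hev : ∀ᶠ ε : ℝ in 𝓝 0, ∀ i, AnalyticAt ℝ (G i) ε :=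
      eventually_all.2 fun i => (hG i).eventually_analyticAt
    obtain ⟨δ, hδ, hδ'⟩ := Metric.eventually_nhds_iff.1 hev
    have h1 : ∀ᶠ a in l, ∃ ξ : ℝ, |ξ| ≤ η a ∧ L (∑ i, y a i * iteratedDeriv j (G i) ξ) = 0 := by
      filter_upwards [hcard, hZ, hη.eventually (gt_mem_nhds hδ)] with a h1 h2 h3
      have han : ∀ ξ ∈ Set.Icc (-η a) (η a), ∀ i, AnalyticAt ℝ (G i) ξ := by
        intro ξ hξ
        refine hδ' ?_
        rw [Real.dist_eq, sub_zero]
        exact (abs_le.2 hξ).trans_lt h3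
      have han' : ∀ ξ ∈ Set.Icc (-η a) (η a),
          AnalyticAt ℝ (fun ε => L (∑ i, y a i * G i ε)) ξ := fun ξ hξ =>
        (L.analyticAt _).comp (analyticAt_sum_mul (han ξ hξ) (y a))
      obtain ⟨Z', hZ', hc⟩ := exists_finset_iteratedDeriv_eq_zero
        (φ := fun ε => L (∑ i, y a i * G i ε)) (u := -η a) (v := η a) (Z := Z a)
        (fun k ξ hξ => by
          rw [iteratedDeriv_eq_iterate]
          exact ((han' ξ hξ).iterated_deriv k).continuousAt.continuousWithinAt)
        (fun z hz => ⟨abs_le.1 (h2 z hz).1, by simp only [(h2 z hz).2, map_zero]⟩) j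
      obtain ⟨ξ, hξ⟩ : Z'.Nonempty := Finset.card_pos.1 (by omega)
      obtain ⟨hξ1, hξ2⟩ := hZ' ξ hξ
      refine ⟨ξ, abs_le.2 hξ1, ?_⟩
      rw [← iteratedDeriv_sum_mul (han ξ hξ1), ← iteratedDeriv_clm_comp L j
        (analyticAt_sum_mul (han ξ hξ1) (y a)), hξ2]
    obtain ⟨ξ, hξ⟩ := h1.choice
    have hξ0 : Tendsto ξ l (𝓝 0) :=
      squeeze_zero_norm' (hξ.mono fun a h => by simpa using h.1) hη
    have h2 : Tendsto (fun a => L (∑ i, y a i * iteratedDeriv j (G i) (ξ a))) l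
        (𝓝 (L (∑ i, y₀ i * iteratedDeriv j (G i) 0))) := by
      refine (L.continuous.tendsto _).comp (tendsto_finsetSum _ fun i _ => ?_)
      refine ((tendsto_pi_nhds.1 hy i)).mul ?_
      have : AnalyticAt ℝ (iteratedDeriv j (G i)) 0 := by
        rw [iteratedDeriv_eq_iterate]; exact (hG i).iterated_deriv j
      exact this.continuousAt.tendsto.comp hξ0
    exact tendsto_nhds_unique h2
      (tendsto_const_nhds.congr' (hξ.mono fun a h => h.2.symm))
  rw [iteratedDeriv_sum_mul hG]
  exact Complex.ext (key reCLM) (key imCLM)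

end Rolle

open Polynomial

namespace Data

variable {d : Data}

section

variable (ha : d.a < 1) (hc : d.c ≠ 0) (hroot : AnalyticAt ℝ d.root 0)
    (hsq : ∀ᶠ ε in 𝓝 (0 : ℝ), d.root ε ^ 2 = S d.a d.c (lamOdd d.a d.c ε))
include ha hc hroot hsq

/-- Since `S` depends on `ε²`, `root (-ε)` is `root ε` up to sign. The plus sign would give `v (-ε)
+ v ε = 0`, which is impossible near `0` because `v 0 ≠ 0`. -/
lemma root_neg : ∀ᶠ ε in 𝓝 (0 : ℝ), d.root (-ε) = -d.root ε := by
  obtain ⟨v, hv, hv0, hv'⟩ := root_factor ha hc hroot hsq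
  have hneg : Tendsto (fun ε : ℝ => -ε) (𝓝 0) (𝓝 0) := by
    simpa using (continuous_neg (G := ℝ)).tendsto 0
  have h1 : ∀ᶠ ε in 𝓝 (0 : ℝ), v (-ε) + v ε ≠ 0 := by
    have : Tendsto (fun ε => v (-ε) + v ε) (𝓝 0) (𝓝 (v 0 + v 0)) :=
      (hv.continuousAt.tendsto.comp hneg).add hv.continuousAt.tendsto
    exact this.eventually_ne (by simpa [← two_mul] using hv0)
  filter_upwards [h1, hv', hneg.eventually hv', hsq, hneg.eventually hsq] with ε h1 h2 h3 h4 h5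
  rcases eq_or_ne ε 0 with rfl | h0
  · simp [root_zero ha hsq]
  have h0' : (ε : ℂ) ≠ 0 := by exact_mod_cast h0
  have h6 : d.root (-ε) ^ 2 = d.root ε ^ 2 := by rw [h4, h5]; simp [lamOdd]
  rw [h2, h3] at h6 ⊢
  have h7 : (v (-ε) - v ε) * (v (-ε) + v ε) = 0 := by
    apply mul_left_cancel₀ (pow_ne_zero 2 h0')
    push_cast at h6
    linear_combination h6
  rw [mul_eq_zero, or_iff_left h1, sub_eq_zero] at h7
  rw [h7]; push_cast; ring

/-- Near `0` the eigenfunctions do not vanish, and they have the same parity up to a common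
factor. -/
lemma eventually_fE_gE (x t : ℝ) : ∀ᶠ ε in 𝓝[≠] (0 : ℝ),
    (d.fE ε x t ≠ 0 ∨ d.gE ε x t ≠ 0) ∧
    ∃ m : ℂ, d.fE (-ε) x t = m * d.fE ε x t ∧ d.gE (-ε) x t = m * d.gE ε x t := by
  have hneg : Tendsto (fun ε : ℝ => -ε) (𝓝 0) (𝓝 0) := by
    simpa using (continuous_neg (G := ℝ)).tendsto 0
  obtain ⟨v, hv, hv0, hv'⟩ := root_factor ha hc hroot hsq
  have hr0 := root_zero ha hsq
  have hc' : (d.c : ℂ) ≠ 0 := by exact_mod_cast hc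
  have hQ0 : ∀ᶠ ε : ℝ in 𝓝 0, d.QP.eval ((ε : ℂ) ^ 2) + I * d.root ε ≠ 0 := by
    have := (analyticAt_eval_sq d.QP 0).continuousAt.add (hroot.continuousAt.const_mul I)
    refine this.eventually_ne ?_
    simpa [hr0] using (eventually_ne ha hc).self_of_nhds.2
  have hev := (((eventually_ne ha hc).and hsq).and (hQ0.and ((root_neg ha hc hroot hsq).and
    (hneg.eventually hsq)))).and ((hv.continuousAt.eventually_ne hv0).and hv')
  filter_upwards [hev.filter_mono nhdsWithin_le_nhds, self_mem_nhdsWithin] with ε h h0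
  obtain ⟨⟨⟨⟨hl, hQ⟩, hw⟩, hQr, hodd, hw'⟩, hvε, hrv⟩ := h
  have h0' : (ε : ℂ) ≠ 0 := by exact_mod_cast h0
  have hr : d.root ε ≠ 0 := by rw [hrv]; exact mul_ne_zero h0' hvε
  have e : (((-ε : ℝ) : ℂ)) ^ 2 = (ε : ℂ) ^ 2 := by push_cast; ring
  obtain ⟨h1, h2⟩ := d.fE_eq_trig hl hc hQ hw x t
  obtain ⟨h3, h4⟩ := d.fE_eq_trig (ε := -ε) (by rwa [e]) hc (by rwa [e]) hw' x t
  rw [e, hodd] at h3 h4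
  have hsn : ∀ z, Complex.sin (-d.root ε * z) = -Complex.sin (d.root ε * z) := fun z => by
    rw [neg_mul, Complex.sin_neg]
  have hcs : ∀ z, Complex.cos (-d.root ε * z) = Complex.cos (d.root ε * z) := fun z => by
    rw [neg_mul, Complex.cos_neg]
  rw [hsn, hcs] at h3 h4
  set U := exp (I * d.root ε * d.shiftP.eval ((ε : ℂ) ^ 2)) *
      (d.QP.eval ((ε : ℂ) ^ 2) + I * d.root ε) /
      (4 * d.lamP.eval ((ε : ℂ) ^ 2) * d.c * d.QP.eval ((ε : ℂ) ^ 2)) with hU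
  have hU0 : U ≠ 0 := div_ne_zero (mul_ne_zero (exp_ne_zero _) hQr)
    (mul_ne_zero (mul_ne_zero (mul_ne_zero (by norm_num) hl) hc') hQ)
  set U' := exp (I * -d.root ε * d.shiftP.eval ((ε : ℂ) ^ 2)) *
      (d.QP.eval ((ε : ℂ) ^ 2) + I * -d.root ε) /
      (4 * d.lamP.eval ((ε : ℂ) ^ 2) * d.c * d.QP.eval ((ε : ℂ) ^ 2))
  have hcar := d.carrier_ne_zero x t
  have hcar' : conj (d.carrier x t) ≠ 0 := by simpa using hcar
  refine ⟨?_, -U' / U, ?_, ?_⟩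
  · by_contra! hfg
    rw [h1, mul_eq_zero, or_iff_right (by simp [hcar, hU0])] at hfg
    rw [h2, mul_eq_zero, or_iff_right (by simp [hcar, hU0])] at hfg
    -- The sum of the two trigonometric expressions isolates the cosine and their difference the
    -- sine, and these have no common zero.
    have hcos : Complex.cos (d.root ε * (d.YP x t).eval ((ε : ℂ) ^ 2)) = 0 := by
      apply mul_left_cancel₀ hr
      linear_combination (-1 / 2) * (hfg.1 + hfg.2)
    have hsin : Complex.sin (d.root ε * (d.YP x t).eval ((ε : ℂ) ^ 2)) = 0 := by
      apply mul_left_cancel₀ hQ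
      linear_combination (1 / 2) * (hfg.1 - hfg.2)
    have := Complex.sin_sq_add_cos_sq (d.root ε * (d.YP x t).eval ((ε : ℂ) ^ 2))
    rw [hcos, hsin] at this
    norm_num at this
  · rw [h3, h1]; field_simp; ring
  · rw [h4, h2]; field_simp; ring

end

end Data

end CLL

/-! ### Coalescence of the eigenvalues -/

namespace CLL

open Polynomial

namespace Data

variable {d : Data}

lemma lamOdd_re (ε : ℝ) : (lamOdd d.a d.c ε).re = Real.sqrt ((1 - d.a) / 2) + ε ^ 2 := by
  simp [lamOdd, ← ofReal_pow]

lemma lamOdd_im (ε : ℝ) : (lamOdd d.a d.c ε).im = d.c / 2 := by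
  simp [lamOdd, ← ofReal_pow]

lemma lamOdd_sq_im (ε : ℝ) :
    (lamOdd d.a d.c ε ^ 2).im = d.c * (Real.sqrt ((1 - d.a) / 2) + ε ^ 2) := by
  rw [sq, mul_im, lamOdd_re, lamOdd_im]; ring

/-- The rows of the extended matrix come in pairs. -/
lemma node_equations {e : Fin d.N → ℝ} {x t : ℝ} {y : Fin (2 * d.N + 1) → ℂ}
    (h : (extMatrix (d.lam e) (d.f x t e) (d.g x t e)).mulVec y = 0) (k : Fin d.N) :
    ∑ j : Fin (2 * d.N + 1), y j * (lamOdd d.a d.c (e k) ^ (2 * d.N - j.1) *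
      (if Even j.1 then d.fE (e k) x t else d.gE (e k) x t)) = 0 ∧
    ∑ j : Fin (2 * d.N + 1), conj (y j) * ((-lamOdd d.a d.c (e k)) ^ (2 * d.N - j.1) *
      (if Even j.1 then d.gE (e k) x t else d.fE (e k) x t)) = 0 := by
  constructor
  · have h1 := congrFun h ⟨2 * k.1, by omega⟩
    have hev : Even (2 * k.1) := ⟨k.1, by omega⟩
    have hk : d.epsOf e ⟨2 * k.1, by omega⟩ = e k := by
      unfold epsOf; congr 1; ext; simp
    simp only [Matrix.mulVec, dotProduct, extMatrix, Matrix.of_apply, f_eq, g_eq, lam, hev, if_true,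
      hk, Pi.zero_apply] at h1
    rw [← h1]
    exact Finset.sum_congr rfl fun j _ => mul_comm _ _
  · have h1 := congrFun h ⟨2 * k.1 + 1, by omega⟩
    have hev : ¬ Even (2 * k.1 + 1) := by rw [Nat.not_even_iff_odd]; exact ⟨k.1, rfl⟩
    have hk : d.epsOf e ⟨2 * k.1 + 1, by omega⟩ = e k := by
      unfold epsOf; congr 1; ext; simp; omega
    simp only [Matrix.mulVec, dotProduct, extMatrix, Matrix.of_apply, f_eq, g_eq, lam, hev, if_false,
      hk, Pi.zero_apply] at h1
    have h3 := congrArg conj h1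
    rw [map_zero, map_sum] at h3
    rw [← h3]
    refine Finset.sum_congr rfl fun j _ => ?_
    split_ifs <;> simp <;> ring

section

variable (ha : d.a < 1) (hc : d.c ≠ 0)
include ha hc

/-- The kernel of the discrete interpolation conditions does not contain vectors with vanishing
first entry. -/
lemma eq_zero_of_nodes {e : Fin d.N → ℝ} {x t : ℝ} (he : Function.Injective fun k => e k ^ 2)
    (hfg : ∀ k, d.fE (e k) x t ≠ 0 ∨ d.gE (e k) x t ≠ 0) {y : Fin (2 * d.N + 1) → ℂ}
    (h : (extMatrix (d.lam e) (d.f x t e) (d.g x t e)).mulVec y = 0) (h0 : y 0 = 0) : y = 0 := by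
  have hsg := sqrt_pos' ha
  have hroots : ∀ k, (herm (evenPoly y) (oddPoly y)).eval (lamOdd d.a d.c (e k) ^ 2) = 0 := by
    intro k
    obtain ⟨h1, h2⟩ := node_equations h k
    have h3 := sum_columns y (lamOdd d.a d.c (e k)) (d.fE (e k) x t) (d.gE (e k) x t)
    have h4 := sum_columns (fun j => conj (y j)) (-lamOdd d.a d.c (e k)) (d.gE (e k) x t)
      (d.fE (e k) x t)
    simp only [smul_eq_mul] at h3 h4
    rw [h1] at h3
    rw [h2, ← cj_evenPoly, ← cj_oddPoly, neg_sq] at h4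
    simp only [coe_aeval_eq_eval] at h3 h4
    exact herm_eval_eq_zero (hfg k) h3.symm (by linear_combination -h4)
  set Ω : ℂ[X] := ∏ k : Fin d.N, (X - C (lamOdd d.a d.c (e k) ^ 2)) with hΩ
  have hinj : Function.Injective fun k => lamOdd d.a d.c (e k) ^ 2 := by
    intro j k hjk
    have := congrArg Complex.im hjk
    simp only [lamOdd_sq_im] at this
    exact he (add_left_cancel (mul_left_cancel₀ hc this))
  have hdvd : Ω ∣ herm (evenPoly y) (oddPoly y) := by
    refine Finset.prod_dvd_of_coprime ?_ fun k _ => dvd_iff_isRoot.2 (hroots k)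
    exact fun j _ k _ hjk => pairwise_coprime_X_sub_C hinj hjk
  have hcj : cj Ω = ∏ k : Fin d.N, (X - C (conj (lamOdd d.a d.c (e k) ^ 2))) := by
    rw [hΩ, map_prod]
    simp only [map_sub, cj_X, cj_C]
  -- Every `λ_k²` has imaginary part `c * (√((1-a)/2) + ε_k²)`, of the sign of `c`, so no node
  -- equals a conjugate of a node.
  have hco : IsCoprime Ω (cj Ω) := by
    rw [hcj]
    refine IsCoprime.prod_left fun j _ => IsCoprime.prod_right fun k _ => ?_
    refine isCoprime_X_sub_C_of_isUnit_sub (sub_ne_zero.2 fun hjk => ?_).isUnit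
    have := congrArg Complex.im hjk
    rw [conj_im, lamOdd_sq_im, lamOdd_sq_im, ← mul_neg] at this
    have h5 := mul_left_cancel₀ hc this
    nlinarith [sq_nonneg (e j), sq_nonneg (e k)]
  obtain ⟨hA, hB⟩ := eq_zero_of_dvd_herm (evenPoly_natDegree_le y) (oddPoly_degree_lt y)
    (monic_prod_X_sub_C _ _) (by rw [natDegree_prod_of_monic _ _ fun k _ => monic_X_sub_C _]; simp only [natDegree_X_sub_C]; simp) hco hdvd
    (by rw [evenPoly_coeff_top, h0])
  exact eq_zero_of_evenPoly_oddPoly hA hB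

lemma minorVec_ne_zero_of_nodes {e : Fin d.N → ℝ} {x t : ℝ}
    (he : Function.Injective fun k => e k ^ 2)
    (hfg : ∀ k, d.fE (e k) x t ≠ 0 ∨ d.gE (e k) x t ≠ 0) :
    minorVec (extMatrix (d.lam e) (d.f x t e) (d.g x t e)) ≠ 0 := by
  intro h
  have h0 := congrFun h 0
  rw [minorVec_extMatrix_zero] at h0
  obtain ⟨v, hv, hv'⟩ := Matrix.exists_mulVec_eq_zero_iff.2 h0
  have h1 : (extMatrix (d.lam e) (d.f x t e) (d.g x t e)).mulVec (Fin.cons 0 v) = 0 := by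
    funext i
    rw [← hv', Matrix.mulVec, Matrix.mulVec, dotProduct, dotProduct, Fin.sum_univ_succ]
    simp only [Fin.cons_zero, mul_zero, zero_add, Fin.cons_succ, extMatrix_succ]
  have h2 := eq_zero_of_nodes ha hc he hfg h1 rfl
  apply hv
  funext j
  simpa using congrFun h2 j.succ

end

/-- The points `± e k`. -/
noncomputable def symNodes {N : ℕ} (e : Fin N → ℝ) : Finset ℝ :=
  Finset.univ.image fun p : Fin N × Bool => if p.2 then e p.1 else -e p.1

lemma card_symNodes {N : ℕ} {e : Fin N → ℝ} (h0 : ∀ k, e k ≠ 0)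
    (he : Function.Injective fun k => e k ^ 2) : (symNodes e).card = 2 * N := by
  rw [symNodes, Finset.card_image_of_injective]
  · simp [mul_comm]
  · rintro ⟨j, b⟩ ⟨k, b'⟩ h
    have hsq : e j ^ 2 = e k ^ 2 := by
      have := congrArg (· ^ 2) h
      cases b <;> cases b' <;> simpa using this
    obtain rfl := he hsq
    have := h0 j
    cases b <;> cases b' <;> simp at h ⊢ <;> exact this (by linarith)

section

variable (ha : d.a < 1) (hc : d.c ≠ 0) (hroot : AnalyticAt ℝ d.root 0)
    (hsq : ∀ᶠ ε in 𝓝 (0 : ℝ), d.root ε ^ 2 = S d.a d.c (lamOdd d.a d.c ε))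
include ha hc hroot hsq

omit ha hc hroot hsq in
lemma breather_eq (hN : 1 ≤ d.N) (e : Fin d.N → ℝ) (x t : ℝ) :
    d.breather e x t =
      (minorVec (extMatrix (d.lam e) (d.f x t e) (d.g x t e)) 0 * seedR d.a d.c x t -
        2 * I * minorVec (extMatrix (d.lam e) (d.f x t e) (d.g x t e)) ⟨1, by omega⟩) /
      conj (minorVec (extMatrix (d.lam e) (d.f x t e) (d.g x t e)) 0) := by
  rw [minorVec_extMatrix_zero, minorVec_extMatrix_one _ _ _ hN, (d.paired x t e).conj_det_Delta₂,
    breather]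
  ring

omit ha hc hroot hsq in
lemma rogue_eq_minorVec (hN : 1 ≤ d.N) (x t : ℝ) :
    d.rogue x t = (minorVec (d.hatExt x t) 0 * seedR d.a d.c x t -
      2 * I * minorVec (d.hatExt x t) ⟨1, by omega⟩) / conj (minorVec (d.hatExt x t) 0) := by
  rw [minorVec_hatExt_zero, minorVec_hatExt_one hN, conj_det_hatDelta₂, rogue]
  ring

/-- No expansion of the determinants is needed: both sides are one function of a kernel vector,
invariant under real scaling, so convergence of normalized kernel vectors suffices. The nodes `±
ε_k` provide the `2 * N` zeros that Rolle's theorem needs for derivatives up to order `2 * N - 1`.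
-/
lemma tendsto_breather (hN : 1 ≤ d.N) (x t : ℝ) :
    Tendsto (fun e : Fin d.N → ℝ => d.breather e x t)
      (𝓝[{e | (∀ k, e k ≠ 0) ∧ Function.Injective fun k => e k ^ 2}] 0) (𝓝 (d.rogue x t)) := by
  rw [tendsto_iff_ultrafilter]
  intro U hU
  have hU0 : (U : Filter (Fin d.N → ℝ)) ≤ 𝓝 0 := hU.trans nhdsWithin_le_nhds
  have hgood : ∀ᶠ e in (U : Filter (Fin d.N → ℝ)),
      (∀ k, e k ≠ 0) ∧ Function.Injective fun k => e k ^ 2 := hU self_mem_nhdsWithin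
  have hfg : ∀ᶠ e in (U : Filter (Fin d.N → ℝ)), ∀ k, (d.fE (e k) x t ≠ 0 ∨ d.gE (e k) x t ≠ 0) ∧
      ∃ m : ℂ, d.fE (-e k) x t = m * d.fE (e k) x t ∧ d.gE (-e k) x t = m * d.gE (e k) x t := by
    have h1 := eventually_nhdsWithin_iff.1 (eventually_fE_gE ha hc hroot hsq x t)
    have h2 := eventually_all.2 fun k : Fin d.N =>
      ((continuous_apply k).tendsto (0 : Fin d.N → ℝ)).eventually h1
    filter_upwards [hU0 h2, hgood] with e h3 h4 k
    exact h3 k (h4.1 k)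
  set E := fun e : Fin d.N → ℝ => extMatrix (d.lam e) (d.f x t e) (d.g x t e) with hE
  set y : (Fin d.N → ℝ) → Fin (2 * d.N + 1) → ℂ :=
    fun e => ((‖minorVec (E e)‖⁻¹ : ℝ) : ℂ) • minorVec (E e) with hy
  have hker : ∀ e, (E e).mulVec (y e) = 0 := fun e => by
    rw [hy, Matrix.mulVec_smul, mulVec_minorVec, smul_zero]
  have hm0 : ∀ᶠ e in (U : Filter (Fin d.N → ℝ)), ‖minorVec (E e)‖ ≠ 0 := by
    filter_upwards [hgood, hfg] with e h1 h2
    exact norm_ne_zero_iff.2 (minorVec_ne_zero_of_nodes ha hc h1.2 fun k => (h2 k).1)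
  have hsphere : ∀ᶠ e in (U : Filter (Fin d.N → ℝ)), y e ∈ Metric.sphere 0 1 := by
    filter_upwards [hm0] with e h1
    rw [mem_sphere_zero_iff_norm, hy, norm_smul]
    simp [h1]
  -- Along an ultrafilter the unit kernel vectors converge by compactness. The limit is nonzero, so
  -- it spans the confluent kernel once shown to belong to it.
  obtain ⟨y₀, hy₀, hlim⟩ := (isCompact_sphere (0 : Fin (2 * d.N + 1) → ℂ) 1).ultrafilter_le_nhds
    (U.map y) (le_principal_iff.2 hsphere)
  replace hlim : Tendsto y U (𝓝 y₀) := hlim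
  have hη : Tendsto (fun e : Fin d.N → ℝ => ‖e‖) U (𝓝 0) :=
    (tendsto_norm_zero (E := Fin d.N → ℝ)).mono_left hU0
  have hcard : ∀ᶠ e in (U : Filter (Fin d.N → ℝ)), 2 * d.N ≤ (symNodes e).card :=
    hgood.mono fun e h => (card_symNodes h.1 h.2).ge
  have hl : AnalyticAt ℝ (fun ε => lamOdd d.a d.c ε) 0 := by unfold lamOdd; fun_prop
  obtain ⟨hf, hg⟩ := hasJet_fE_gE ha hc hroot hsq x t
  have hf := hf.analyticAt ha hc hroot hsq
  have hg := hg.analyticAt ha hc hroot hsq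
  have hnode : ∀ᶠ e in (U : Filter (Fin d.N → ℝ)), ∀ z ∈ symNodes e, |z| ≤ ‖e‖ ∧
      ∃ k, ∃ m : ℂ, lamOdd d.a d.c z = lamOdd d.a d.c (e k) ∧
        d.fE z x t = m * d.fE (e k) x t ∧ d.gE z x t = m * d.gE (e k) x t := by
    filter_upwards [hfg] with e h z hz
    obtain ⟨⟨k, b⟩, -, rfl⟩ := Finset.mem_image.1 hz
    obtain ⟨-, m, h1, h2⟩ := h k
    have h3 := norm_le_pi_norm e k
    rw [Real.norm_eq_abs] at h3
    cases b
    · exact ⟨by simpa using h3, k, m, by simp [lamOdd], by simpa using h1, by simpa using h2⟩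
    · exact ⟨by simpa using h3, k, 1, by simp, by simp, by simp⟩
  have hy₀ker : d.IsKer x t y₀ := by
    apply isKer_of_iteratedDeriv ha hc hroot hsq
    · intro i hi
      refine iteratedDeriv_eq_zero_of_tendsto (l := (U : Filter (Fin d.N → ℝ)))
        (Z := symNodes) (n := 2 * d.N) ?_ hlim hcard hη ?_ (by omega)
      · intro j
        split_ifs <;> fun_prop
      · filter_upwards [hnode] with e h z hz
        obtain ⟨h1, k, m, h2, h3, h4⟩ := h z hz
        refine ⟨h1, ?_⟩
        have h5 := (node_equations (hker e) k).1
        rw [← mul_zero m, ← h5, Finset.mul_sum]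
        refine Finset.sum_congr rfl fun j _ => ?_
        rw [h2, h3, h4]
        split_ifs <;> ring
    · intro i hi
      refine iteratedDeriv_eq_zero_of_tendsto (l := (U : Filter (Fin d.N → ℝ)))
        (Z := symNodes) (n := 2 * d.N) (y := fun e j => conj (y e j)) ?_ ?_ hcard hη ?_ (by omega)
      · intro j
        split_ifs <;> fun_prop
      · exact tendsto_pi_nhds.2 fun j =>
          (continuous_conj.tendsto _).comp (tendsto_pi_nhds.1 hlim j)
      · filter_upwards [hnode] with e h z hz
        obtain ⟨h1, k, m, h2, h3, h4⟩ := h z hz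
        refine ⟨h1, ?_⟩
        have h5 := (node_equations (hker e) k).2
        rw [← mul_zero m, ← h5, Finset.mul_sum]
        refine Finset.sum_congr rfl fun j _ => ?_
        rw [h2, h3, h4]
        split_ifs <;> ring
  have hy₀0 : y₀ 0 ≠ 0 := fun h => by
    have := hy₀ker.eq_zero ha hc hN h
    rw [this] at hy₀
    simp at hy₀
  have hlast : y₀ (Fin.last _) = (∏ i, d.lam (fun _ => 0) i) * conj (y₀ 0) := by
    have h1 : Tendsto (fun e : Fin d.N → ℝ => ∏ i, d.lam e i) U (𝓝 (∏ i, d.lam (fun _ => 0) i)) := by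
      have : Continuous fun e : Fin d.N → ℝ => ∏ i, d.lam e i := by
        refine continuous_finsetProd _ fun i _ => ?_
        unfold lam lamOdd epsOf
        split_ifs <;> fun_prop
      exact (this.tendsto _).mono_left hU0
    have h2 : ∀ e, y e (Fin.last _) = (∏ i, d.lam e i) * conj (y e 0) := by
      intro e
      simp only [hy, Pi.smul_apply, smul_eq_mul, hE, minorVec_extMatrix_last,
        minorVec_extMatrix_zero, map_mul, conj_ofReal, (d.paired x t e).conj_det_Delta₂]
      ring
    have h3 := tendsto_pi_nhds.1 hlim (Fin.last _)
    simp only [h2] at h3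
    exact tendsto_nhds_unique h3 (h1.mul ((continuous_conj.tendsto _).comp
      (tendsto_pi_nhds.1 hlim 0)))
  have hm := minorVec_zero_ne ha hc hroot hsq hN x t
  obtain ⟨τ, hτ₁, hτ₂⟩ := (isKer_of_mulVec ha hc hroot hsq
    (mulVec_minorVec (d.hatExt x t))).exists_eq_C_mul ha hc hN hm (evenPoly_natDegree_le y₀)
    (oddPoly_degree_lt y₀) hy₀ker.dvd₁ hy₀ker.dvd₂
  have e0 := congrArg (fun p => p.coeff d.N) hτ₁
  have e1 := congrArg (fun p => p.coeff (d.N - 1)) hτ₂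
  have e2 := congrArg (fun p => p.coeff 0) hτ₁
  simp only [coeff_C_mul, evenPoly_coeff_top, oddPoly_coeff_top hN, evenPoly_coeff_zero] at e0 e1 e2
  have hτ0 : τ ≠ 0 := fun h => hy₀0 (by rw [e0, h, zero_mul])
  -- Both vectors have last entry equal to `∏ λ` times the conjugate of the first, which leaves only
  -- a real proportionality factor. Reality is needed because the wave contains the conjugate of the
  -- first entry in its denominator.
  have hτ : conj τ = τ := by
    rw [hlast, minorVec_hatExt_last ha hc hroot hsq, ← conj_det_hatDelta₂, ← minorVec_hatExt_zero,
      e0, map_mul] at e2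
    have h1 : conj (minorVec (d.hatExt x t) 0) ≠ 0 := by simpa using hm
    have h2 := prod_lam_zero_ne (d := d) ha
    refine mul_right_cancel₀ (mul_ne_zero h2 h1) ?_
    linear_combination e2
  have hval : d.rogue x t =
      (y₀ 0 * seedR d.a d.c x t - 2 * I * y₀ ⟨1, by omega⟩) / conj (y₀ 0) := by
    rw [rogue_eq_minorVec hN, e0, e1, map_mul, hτ]
    field_simp
  rw [hval]
  have hl0 := tendsto_pi_nhds.1 hlim 0
  have hl1 := tendsto_pi_nhds.1 hlim ⟨1, by omega⟩
  refine Tendsto.congr' ?_ (((hl0.mul_const _).sub (hl1.const_mul _)).div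
    ((continuous_conj.tendsto _).comp hl0) (by simpa using hy₀0))
  filter_upwards [hm0] with e h1
  have h2 : ((‖minorVec (E e)‖⁻¹ : ℝ) : ℂ) ≠ 0 := by exact_mod_cast inv_ne_zero h1
  rw [breather_eq hN]
  simp only [Pi.div_apply, Function.comp_apply, hy, Pi.smul_apply, smul_eq_mul, map_mul, conj_ofReal]
  rw [show ∀ u v r s : ℂ, u * v * r - 2 * I * (u * s) = u * (v * r - 2 * I * s) from
    fun u v r s => by ring, mul_div_mul_left _ _ h2]

end

end Data

end CLL

/-! ### A Padé problem for Bessel functions -/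

namespace CLL

section Pade

open PowerSeries

/-- Coefficients of the functions `z^{-n} (z⁻¹ d/dz)^n cosh z`, up to normalization. -/
noncomputable def besselCoeff (n k : ℕ) : ℂ :=
  2 ^ n * (k + n).factorial / (k.factorial * (2 * (k + n)).factorial)

/-- The power series interpolating between `cosh √ξ`, `sinh √ξ / √ξ` and the higher modified
spherical Bessel functions, with `ξ = z X`. -/
noncomputable def besselSeries (z : ℂ) (n : ℕ) : ℂ⟦X⟧ := mk fun k => z ^ k * besselCoeff n k

lemma besselCoeff_zero (k : ℕ) : besselCoeff 0 k = 1 / (2 * k).factorial := by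
  have h1 : (k.factorial : ℂ) ≠ 0 := by exact_mod_cast Nat.factorial_ne_zero _
  simp only [besselCoeff, pow_zero, add_zero, one_mul]
  field_simp

lemma besselCoeff_one (k : ℕ) : besselCoeff 1 k = 1 / (2 * k + 1).factorial := by
  have h1 : (k.factorial : ℂ) ≠ 0 := by exact_mod_cast Nat.factorial_ne_zero _
  have h2 : ((2 * k + 1).factorial : ℂ) ≠ 0 := by exact_mod_cast Nat.factorial_ne_zero _
  have h3 : (k : ℂ) + 1 ≠ 0 := by exact_mod_cast Nat.succ_ne_zero k
  rw [besselCoeff, show 2 * (k + 1) = 2 * k + 1 + 1 by ring, Nat.factorial_succ (2 * k + 1),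
    Nat.factorial_succ k]
  push_cast
  rw [show (2 * k + 1 + 1 : ℂ) = 2 * (k + 1) by ring]
  field_simp

lemma besselCoeff_rec_zero (n : ℕ) : besselCoeff n 0 = (2 * n + 1) * besselCoeff (n + 1) 0 := by
  have h1 : (n.factorial : ℂ) ≠ 0 := by exact_mod_cast Nat.factorial_ne_zero _
  have h2 : ((2 * n).factorial : ℂ) ≠ 0 := by exact_mod_cast Nat.factorial_ne_zero _
  have h3 : (n : ℂ) + 1 ≠ 0 := by exact_mod_cast Nat.succ_ne_zero n
  have h4 : 2 * (n : ℂ) + 1 ≠ 0 := by exact_mod_cast Nat.succ_ne_zero (2 * n)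
  rw [besselCoeff, besselCoeff, zero_add, zero_add, show 2 * (n + 1) = 2 * n + 1 + 1 by ring,
    Nat.factorial_succ (2 * n + 1), Nat.factorial_succ (2 * n), Nat.factorial_succ n]
  push_cast
  rw [show (2 * n + 1 + 1 : ℂ) = 2 * (n + 1) by ring]
  field_simp
  ring

lemma besselCoeff_rec_succ (n k : ℕ) : besselCoeff n (k + 1) =
    (2 * n + 1) * besselCoeff (n + 1) (k + 1) + besselCoeff (n + 2) k := by
  simp only [besselCoeff]
  obtain ⟨m, hm⟩ : ∃ m, m = k + n + 1 := ⟨_, rfl⟩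
  rw [show k + 1 + n = m by omega, show k + 1 + (n + 1) = m + 1 by omega,
    show k + (n + 2) = m + 1 by omega, show 2 * (m + 1) = 2 * m + 1 + 1 by ring,
    Nat.factorial_succ (2 * m + 1), Nat.factorial_succ (2 * m), Nat.factorial_succ m,
    Nat.factorial_succ k]
  have h0 : (k.factorial : ℂ) ≠ 0 := by exact_mod_cast Nat.factorial_ne_zero _
  have h1 : (m.factorial : ℂ) ≠ 0 := by exact_mod_cast Nat.factorial_ne_zero _
  have h2 : ((2 * m).factorial : ℂ) ≠ 0 := by exact_mod_cast Nat.factorial_ne_zero _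
  have h3 : (m : ℂ) + 1 ≠ 0 := by exact_mod_cast Nat.succ_ne_zero m
  have h4 : 2 * (m : ℂ) + 1 ≠ 0 := by exact_mod_cast Nat.succ_ne_zero (2 * m)
  have h5 : (k : ℂ) + 1 ≠ 0 := by exact_mod_cast Nat.succ_ne_zero k
  have h6 : (m : ℂ) = k + n + 1 := by rw [hm]; push_cast; ring
  push_cast
  rw [show (2 * m + 1 + 1 : ℂ) = 2 * (m + 1) by ring]
  field_simp
  rw [h6]
  ring

lemma besselSeries_rec (z : ℂ) (n : ℕ) : besselSeries z n =
    C (2 * n + 1 : ℂ) * besselSeries z (n + 1) + C z * (X * besselSeries z (n + 2)) := by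
  ext k
  rw [map_add, coeff_C_mul, coeff_C_mul]
  rcases k with _ | k
  · rw [coeff_zero_X_mul]
    simp only [besselSeries, coeff_mk, besselCoeff_rec_zero n]
    ring
  · rw [coeff_succ_X_mul]
    simp only [besselSeries, coeff_mk, besselCoeff_rec_succ n k]
    ring

lemma constantCoeff_besselSeries_ne_zero (z : ℂ) (n : ℕ) :
    constantCoeff (besselSeries z n) ≠ 0 := by
  rw [← coeff_zero_eq_constantCoeff_apply, besselSeries, coeff_mk, pow_zero, one_mul, besselCoeff]
  refine div_ne_zero (mul_ne_zero (by norm_num) ?_) (mul_ne_zero ?_ ?_) <;>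
  exact_mod_cast Nat.factorial_ne_zero _

/-- The Padé table of the quotients of consecutive Bessel functions is normal. -/
lemma eq_zero_of_pow_dvd_besselSeries {z : ℂ} (hz : z ≠ 0) (N : ℕ) : ∀ (n : ℕ) (U V : ℂ⟦X⟧),
    (∀ i, N ≤ 2 * i → coeff i U = 0) → (∀ i, N ≤ 2 * i + 1 → coeff i V = 0) →
    X ^ N ∣ U * besselSeries z (n + 1) - V * besselSeries z n → U = 0 ∧ V = 0 := by
  induction N with
  | zero =>
    intro n U V hU hV _
    exact ⟨PowerSeries.ext fun i => by simpa using hU i (by omega),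
      PowerSeries.ext fun i => by simpa using hV i (by omega)⟩
  | succ N ih =>
    intro n U V hU hV h
    -- One step of a continued fraction. The recurrence rewrites the expression as `(U - (2n+1) V)
    -- i_{n+1} - z X V i_{n+2}`, where `i_n` is the series of index `n`. Hence `U - (2n+1) V = X W`,
    -- and division by `X` leaves the same problem for `(z V, W)` with `N` lowered and `n` raised by
    -- one; the degree bounds match.
    have h0 : X ∣ (U - C (2 * n + 1 : ℂ) * V) := by
      have h1 : X ∣ U * besselSeries z (n + 1) - V * besselSeries z n :=
        (dvd_pow_self X (Nat.succ_ne_zero N)).trans h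
      have h2 : X ∣ (U - C (2 * n + 1 : ℂ) * V) * besselSeries z (n + 1) := by
        refine (h1.add (dvd_mul_right X (V * (C z * besselSeries z (n + 2))))).trans (dvd_of_eq ?_)
        rw [besselSeries_rec z n]; ring
      rw [X_dvd_iff, map_mul] at h2
      exact X_dvd_iff.2 ((mul_eq_zero.1 h2).resolve_right (constantCoeff_besselSeries_ne_zero z _))
    obtain ⟨W, hW⟩ := h0
    have hW' : ∀ i, coeff i W = coeff (i + 1) U - (2 * n + 1) * coeff (i + 1) V := by
      intro i
      rw [← coeff_succ_X_mul i W, ← hW, map_sub, coeff_C_mul]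
    have h3 : X ^ N ∣ (C z * V) * besselSeries z (n + 2) - W * besselSeries z (n + 1) := by
      obtain ⟨K, hK⟩ := h
      refine ⟨-K, ?_⟩
      apply mul_left_cancel₀ (X_ne_zero (R := ℂ))
      rw [besselSeries_rec z n] at hK
      linear_combination -hK + besselSeries z (n + 1) * hW
    obtain ⟨h4, h5⟩ := ih (n + 1) (C z * V) W
      (fun i hi => by rw [coeff_C_mul, hV i (by omega), mul_zero])
      (fun i hi => by rw [hW', hU _ (by omega), hV _ (by omega)]; ring) h3
    have hV0 : V = 0 := (mul_eq_zero.1 h4).resolve_left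
      ((map_ne_zero_iff _ C_injective).2 hz)
    refine ⟨?_, hV0⟩
    rw [h5, hV0, mul_zero, sub_zero, mul_zero] at hW
    exact hW

end Pade

/-- A scaled family of linear systems with a nondegenerate limit forces the low coefficients of
its bounded solutions to vanish in the limit. -/
lemma tendsto_scaled_eq_zero {α : Type*} (l : Ultrafilter α) {N : ℕ} {Y : α → ℂ}
    (hY : Tendsto (fun e => ‖Y e‖) l atTop) {h : α → ℕ → ℂ} {h₀ : ℕ → ℂ}
    (hh : ∀ k, Tendsto (fun e => h e k) l (𝓝 (h₀ k))) {σ γ : α → ℕ → ℂ} {σ₀ γ₀ : ℕ → ℂ}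
    (hσ : ∀ j < N, Tendsto (fun e => σ e j) l (𝓝 (σ₀ j)))
    (hγ : ∀ j < N, Tendsto (fun e => γ e j) l (𝓝 (γ₀ j)))
    (heq : ∀ᶠ e in (l : Filter α), ∀ m < N, ∑ p ∈ Finset.HasAntidiagonal.antidiagonal m,
      (h e (2 * p.1) / Y e ^ (2 * p.1 + 1) * σ e p.2 -
        h e (2 * p.1 + 1) / Y e ^ (2 * p.1 + 1 + 1) * γ e p.2) = 0)
    (hnd : ∀ w : ℕ → ℂ, (∀ k, N ≤ k → w k = 0) → (∀ m < N, ∑ p ∈ Finset.HasAntidiagonal.antidiagonal m,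
      (w (2 * p.1) * σ₀ p.2 - w (2 * p.1 + 1) * γ₀ p.2) = 0) → ∀ k, w k = 0) :
    ∀ k < N, h₀ k = 0 := by
  intro k₀ hk₀
  by_contra hne
  have hY0 : ∀ᶠ e in (l : Filter α), 1 ≤ ‖Y e‖ := hY.eventually_ge_atTop 1
  -- For `k < N` the weight is `Y ^ (N - 1 - k)`, of modulus at least `1` eventually, and for `k ≥
  -- N` it tends to `0`. If `h₀ k₀ ≠ 0`, the norm `M` stays away from `0`, so that `W / M` has a
  -- nonzero limit supported on `k < N`, against `hnd`.
  set W : α → ℕ → ℂ := fun e k => Y e ^ N * (h e k / Y e ^ (k + 1)) with hW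
  set M : α → ℝ := fun e => ‖fun k : Fin N => W e k‖ with hM
  have hδ : 0 < ‖h₀ k₀‖ / 2 := by have := norm_pos_iff.2 hne; linarith
  have hMδ : ∀ᶠ e in (l : Filter α), ‖h₀ k₀‖ / 2 ≤ M e := by
    have h1 : ∀ᶠ e in (l : Filter α), ‖h₀ k₀‖ / 2 < ‖h e k₀‖ :=
      (hh k₀).norm.eventually_const_lt (by linarith)
    filter_upwards [h1, hY0] with e h1 h2
    have h3 : ‖W e k₀‖ ≤ M e := norm_le_pi_norm (fun k : Fin N => W e k) ⟨k₀, hk₀⟩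
    refine h1.le.trans (le_trans ?_ h3)
    have h4 : Y e ≠ 0 := fun h => by rw [h, norm_zero] at h2; linarith
    have h5 : W e k₀ = Y e ^ (N - (k₀ + 1)) * h e k₀ := by
      have : Y e ^ N = Y e ^ (N - (k₀ + 1)) * Y e ^ (k₀ + 1) := by
        rw [← pow_add]; congr 1; omega
      simp only [hW, this]
      field_simp
    rw [h5, norm_mul, norm_pow]
    exact le_mul_of_one_le_left (norm_nonneg _) (one_le_pow₀ h2)
  set w : α → Fin N → ℂ := fun e => ((M e)⁻¹ : ℂ) • fun k : Fin N => W e k with hw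
  have hsphere : ∀ᶠ e in (l : Filter α), w e ∈ Metric.sphere 0 1 := by
    filter_upwards [hMδ] with e h1
    have h2 : M e ≠ 0 := (hδ.trans_le h1).ne'
    rw [mem_sphere_zero_iff_norm, hw, norm_smul, norm_inv, norm_real, Real.norm_eq_abs,
      abs_of_nonneg (norm_nonneg _)]
    exact inv_mul_cancel₀ h2
  obtain ⟨w₀, hw₀, hlim⟩ := (isCompact_sphere (0 : Fin N → ℂ) 1).ultrafilter_le_nhds
    (l.map w) (le_principal_iff.2 hsphere)
  replace hlim : Tendsto w l (𝓝 w₀) := hlim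
  let w₁ : ℕ → ℂ := fun k => if hk : k < N then w₀ ⟨k, hk⟩ else 0
  have hw₁ : ∀ k, Tendsto (fun e => W e k / M e) l (𝓝 (w₁ k)) := by
    intro k
    by_cases hk : k < N
    · have := tendsto_pi_nhds.1 hlim ⟨k, hk⟩
      simp only [w₁, dif_pos hk]
      refine this.congr fun e => ?_
      simp only [hw, Pi.smul_apply, smul_eq_mul]
      rw [div_eq_inv_mul]
    · simp only [w₁, dif_neg hk]
      rw [tendsto_zero_iff_norm_tendsto_zero]
      have h1 : Tendsto (fun e => ‖h e k‖ * ‖Y e‖⁻¹ * (‖h₀ k₀‖ / 2)⁻¹) l (𝓝 0) := by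
        have := ((hh k).norm.mul hY.inv_tendsto_atTop).mul_const (‖h₀ k₀‖ / 2)⁻¹
        simpa using this
      refine tendsto_of_tendsto_of_tendsto_of_le_of_le' tendsto_const_nhds h1
        (Eventually.of_forall fun _ => norm_nonneg _) ?_
      filter_upwards [hMδ, hY0] with e h2 h3
      have h4 : Y e ≠ 0 := fun h => by rw [h, norm_zero] at h3; linarith
      have h5 : W e k = h e k * (Y e ^ (k + 1 - N))⁻¹ := by
        have : Y e ^ (k + 1) = Y e ^ (k + 1 - N) * Y e ^ N := by
          rw [← pow_add]; congr 1; omega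
        simp only [hW, this]
        field_simp
      rw [norm_div, norm_real, Real.norm_eq_abs, abs_of_nonneg (norm_nonneg _), h5, norm_mul,
        norm_inv, norm_pow, div_eq_mul_inv]
      have h6 : (‖Y e‖ ^ (k + 1 - N))⁻¹ ≤ ‖Y e‖⁻¹ :=
        inv_anti₀ (by linarith) (le_self_pow₀ h3 (by omega))
      have h7 : (M e)⁻¹ ≤ (‖h₀ k₀‖ / 2)⁻¹ := inv_anti₀ hδ h2
      gcongr
  have h0 := hnd w₁ (fun k hk => dif_neg (by omega)) fun m hm => by
    have h1 : Tendsto (fun e => ∑ p ∈ Finset.HasAntidiagonal.antidiagonal m,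
        (W e (2 * p.1) / M e * σ e p.2 - W e (2 * p.1 + 1) / M e * γ e p.2)) l
        (𝓝 (∑ p ∈ Finset.HasAntidiagonal.antidiagonal m,
          (w₁ (2 * p.1) * σ₀ p.2 - w₁ (2 * p.1 + 1) * γ₀ p.2))) := by
      refine tendsto_finsetSum _ fun p hp => ?_
      have hp2 : p.2 < N := by
        have := Finset.HasAntidiagonal.mem_antidiagonal.1 hp; omega
      exact ((hw₁ _).mul (hσ _ hp2)).sub ((hw₁ _).mul (hγ _ hp2))
    refine tendsto_nhds_unique h1 (tendsto_const_nhds.congr' ?_)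
    filter_upwards [heq] with e he
    rw [← mul_zero (Y e ^ N / M e), ← he m hm, Finset.mul_sum]
    refine Finset.sum_congr rfl fun p _ => ?_
    simp only [hW]
    ring
  have : w₀ = 0 := by
    funext k
    simpa [w₁] using h0 k
  rw [this] at hw₀
  simp at hw₀

end CLL

/-! ### Scaling for large arguments -/

namespace CLL

/-! ### Coefficientwise limits and homogeneity of the truncations -/

section CoeffTendsto

open Polynomial

/-- Coefficientwise convergence of polynomials. -/
def CoeffTendsto {α : Type*} (F : α → ℂ[X]) (l : Filter α) (P : ℂ[X]) : Prop :=
  ∀ n, Tendsto (fun e => (F e).coeff n) l (𝓝 (P.coeff n))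

namespace CoeffTendsto

variable {α : Type*} {F G : α → ℂ[X]} {l : Filter α} {P Q : ℂ[X]}

lemma const (P : ℂ[X]) (l : Filter α) : CoeffTendsto (fun _ => P) l P := fun _ =>
  tendsto_const_nhds

lemma mul (hF : CoeffTendsto F l P) (hG : CoeffTendsto G l Q) :
    CoeffTendsto (fun e => F e * G e) l (P * Q) := fun n => by
  simp only [coeff_mul]
  exact tendsto_finsetSum _ fun p _ => (hF _).mul (hG _)

lemma sum {ι : Type*} {s : Finset ι} {F : ι → α → ℂ[X]} {P : ι → ℂ[X]}
    (h : ∀ i ∈ s, CoeffTendsto (F i) l (P i)) :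
    CoeffTendsto (fun e => ∑ i ∈ s, F i e) l (∑ i ∈ s, P i) := fun n => by
  simp only [finsetSum_coeff]
  exact tendsto_finsetSum _ fun i hi => h i hi n

lemma pow (hF : CoeffTendsto F l P) (k : ℕ) : CoeffTendsto (fun e => F e ^ k) l (P ^ k) := by
  induction k with
  | zero => simpa using const 1 l
  | succ k ih => simpa only [pow_succ] using ih.mul hF

lemma congr' (hF : CoeffTendsto F l P) (h : ∀ᶠ e in l, F e = G e) : CoeffTendsto G l P := fun n =>
  (hF n).congr' (h.mono fun e he => by rw [he])

lemma truncSin {S Y : α → ℂ[X]} {S₀ Y₀ : ℂ[X]} (hS : CoeffTendsto S l S₀)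
    (hY : CoeffTendsto Y l Y₀) (N : ℕ) :
    CoeffTendsto (fun e => CLL.truncSin N (S e) (Y e)) l (CLL.truncSin N S₀ Y₀) :=
  sum fun _ _ => (const _ l).mul ((hS.pow _).mul (hY.pow _))

lemma truncCos {S Y : α → ℂ[X]} {S₀ Y₀ : ℂ[X]} (hS : CoeffTendsto S l S₀)
    (hY : CoeffTendsto Y l Y₀) (N : ℕ) :
    CoeffTendsto (fun e => CLL.truncCos N (S e) (Y e)) l (CLL.truncCos N S₀ Y₀) :=
  sum fun _ _ => (const _ l).mul ((hS.pow _).mul (hY.pow _))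

end CoeffTendsto

/-- Only powers of `S * Y ^ 2` times one factor `Y` occur, so the scaling acts through that single
factor. -/
lemma truncSin_scale (N : ℕ) (S Y : ℂ[X]) {r : ℂ} (hr : r ≠ 0) :
    truncSin N (C (r ^ 2) * S) (C r⁻¹ * Y) = C r⁻¹ * truncSin N S Y := by
  have h : C r * C r⁻¹ = 1 := by rw [← C_mul, mul_inv_cancel₀ hr, C_1]
  simp only [truncSin, Finset.mul_sum]
  refine Finset.sum_congr rfl fun k _ => ?_
  have h2 : (C r ^ 2) ^ k * C r⁻¹ ^ (2 * k + 1) = C r⁻¹ := by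
    rw [← pow_mul, pow_succ, ← mul_assoc, ← mul_pow, h, one_pow, one_mul]
  rw [mul_pow, mul_pow, C_pow]
  linear_combination C ((-1) ^ k / (2 * k + 1).factorial : ℂ) * S ^ k * Y ^ (2 * k + 1) * h2

lemma truncCos_scale (N : ℕ) (S Y : ℂ[X]) {r : ℂ} (hr : r ≠ 0) :
    truncCos N (C (r ^ 2) * S) (C r⁻¹ * Y) = truncCos N S Y := by
  have h : C r * C r⁻¹ = 1 := by rw [← C_mul, mul_inv_cancel₀ hr, C_1]
  simp only [truncCos]
  refine Finset.sum_congr rfl fun k _ => ?_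
  have h2 : (C r ^ 2) ^ k * C r⁻¹ ^ (2 * k) = 1 := by
    rw [← pow_mul, ← mul_pow, h, one_pow]
  rw [mul_pow, mul_pow, C_pow]
  linear_combination C ((-1) ^ k / (2 * k).factorial : ℂ) * S ^ k * Y ^ (2 * k) * h2

lemma truncSin_comp (N : ℕ) (S Y R : ℂ[X]) :
    (truncSin N S Y).comp R = truncSin N (S.comp R) (Y.comp R) := by
  simp [truncSin, Polynomial.sum_comp]

lemma truncCos_comp (N : ℕ) (S Y R : ℂ[X]) :
    (truncCos N S Y).comp R = truncCos N (S.comp R) (Y.comp R) := by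
  simp [truncCos, Polynomial.sum_comp]

/-- The argument is `-z` because `besselSeries` has the hyperbolic signs. -/
lemma truncSin_coeff_linear {N j : ℕ} (hj : j < N) (z : ℂ) :
    (truncSin N (C z * X) 1).coeff j = PowerSeries.coeff j (besselSeries (-z) 1) := by
  rw [truncSin, finsetSum_coeff, Finset.sum_eq_single_of_mem j (Finset.mem_range.2 hj)]
  · rw [besselSeries, PowerSeries.coeff_mk, besselCoeff_one, one_pow, mul_one, coeff_C_mul, mul_pow,
      ← C_pow, coeff_C_mul, coeff_X_pow_self, neg_pow]
    ring
  · intro k _ hk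
    rw [one_pow, mul_one, coeff_C_mul, mul_pow, ← C_pow, coeff_C_mul, coeff_X_pow, if_neg hk.symm]
    simp

lemma truncCos_coeff_linear {N j : ℕ} (hj : j < N) (z : ℂ) :
    (truncCos N (C z * X) 1).coeff j = PowerSeries.coeff j (besselSeries (-z) 0) := by
  rw [truncCos, finsetSum_coeff, Finset.sum_eq_single_of_mem j (Finset.mem_range.2 hj)]
  · rw [besselSeries, PowerSeries.coeff_mk, besselCoeff_zero, one_pow, mul_one, coeff_C_mul, mul_pow,
      ← C_pow, coeff_C_mul, coeff_X_pow_self, neg_pow]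
    ring
  · intro k _ hk
    rw [one_pow, mul_one, coeff_C_mul, mul_pow, ← C_pow, coeff_C_mul, coeff_X_pow, if_neg hk.symm]
    simp

end CoeffTendsto

namespace Data

open Polynomial

variable {d : Data}

lemma YP_coeff_zero (x t : ℝ) : (d.YP x t).coeff 0 = x / 4 + t * d.VP.coeff 0 := by
  have : ∑ l ∈ Finset.Icc 1 (d.N - 1), (C ((d.s l + conj (d.s' l)) / 2) * X ^ l : ℂ[X]).coeff 0 = 0 := by
    refine Finset.sum_eq_zero fun l hl => ?_
    rw [coeff_C_mul, coeff_X_pow, if_neg, mul_zero]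
    have := (Finset.mem_Icc.1 hl).1
    omega
  rw [YP, coeff_add, coeff_add, coeff_C_mul, coeff_C_zero, finsetSum_coeff, this, add_zero]

lemma YP_coeff_of_ne {n : ℕ} (hn : n ≠ 0) (x t : ℝ) :
    (d.YP x t).coeff n = t * d.VP.coeff n + (d.YP 0 0).coeff n := by
  simp only [YP, coeff_add, coeff_C_mul, coeff_C_of_ne_zero hn]
  simp

/-- The imaginary part is `-c * √((1-a)/2) / 2`. Being nonzero, it makes `(x, t) ↦ x / 4 + t *
VP(0)` an injective real-linear map, hence proper. -/
lemma VP_coeff_zero_im (ha : d.a < 1) (hc : d.c ≠ 0) : (d.VP.coeff 0).im ≠ 0 := by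
  have h : d.VP.coeff 0 = (4 * d.a - 4 * I * d.c * d.lam₀) / 8 := by
    rw [coeff_zero_eq_eval_zero]
    simp [VP, lamP, lam₀_sq ha]
    ring
  have h2 : d.VP.coeff 0 =
      (((4 * d.a + 2 * d.c ^ 2) / 8 : ℝ) : ℂ) + ((-(d.c * Real.sqrt ((1 - d.a) / 2)) / 2 : ℝ) : ℂ) * I := by
    rw [h, lam₀]; push_cast
    linear_combination (-d.c ^ 2 / 4 : ℂ) * I_sq
  have h3 := sqrt_pos' ha
  rw [h2, add_im, ofReal_im, zero_add, im_ofReal_mul, I_im, mul_one]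
  exact div_ne_zero (neg_ne_zero.2 (mul_ne_zero hc h3.ne')) two_ne_zero

/-- The leading coefficient of `YP` is a proper function of `(x, t)`. -/
lemma tendsto_YP_coeff_zero (ha : d.a < 1) (hc : d.c ≠ 0) :
    Tendsto (fun p : ℝ × ℝ => ‖(d.YP p.1 p.2).coeff 0‖) (cocompact (ℝ × ℝ)) atTop := by
  let L : ℝ × ℝ →ₗ[ℝ] ℂ :=
    { toFun := fun p => p.1 / 4 + p.2 * d.VP.coeff 0
      map_add' := fun p q => by simp; ring
      map_smul' := fun z p => by simp; ring }
  have hL : LinearMap.ker L = ⊥ := by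
    rw [LinearMap.ker_eq_bot']
    intro p hp
    have h1 : (p.1 / 4 + p.2 * d.VP.coeff 0 : ℂ) = 0 := hp
    have h2 : p.2 = 0 := by
      have := congrArg Complex.im h1
      simpa [VP_coeff_zero_im ha hc] using this
    rw [h2] at h1
    have h3 : p.1 = 0 := by simpa using h1
    exact Prod.ext h3 h2
  have := (LinearMap.isClosedEmbedding_of_injective hL).tendsto_cocompact
  refine (tendsto_norm_cocompact_atTop.comp this).congr fun p => ?_
  rw [YP_coeff_zero]; rfl

variable {l : Filter (ℝ × ℝ)}

/-- With `η` the constant coefficient, every higher coefficient is `t` times a constant plus a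
constant, hence `O(|η|)` since `t` is controlled by `im η`. Rescaling multiplies coefficient `n` by
`η ^ (-1 - 2 * n)`, so only the constant term survives. -/
lemma coeffTendsto_YP (ha : d.a < 1) (hc : d.c ≠ 0) (hl : l ≤ cocompact (ℝ × ℝ)) :
    CoeffTendsto (fun p : ℝ × ℝ => C ((d.YP p.1 p.2).coeff 0)⁻¹ *
      (d.YP p.1 p.2).comp (C (((d.YP p.1 p.2).coeff 0)⁻¹ ^ 2) * X)) l 1 := by
  have hY := (tendsto_YP_coeff_zero ha hc).mono_left hl
  have hinv : Tendsto (fun p : ℝ × ℝ => ((d.YP p.1 p.2).coeff 0)⁻¹) l (𝓝 0) :=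
    tendsto_inv₀_cobounded.comp (tendsto_norm_atTop_iff_cobounded.1 hY)
  have hY0 : ∀ᶠ p : ℝ × ℝ in l, (d.YP p.1 p.2).coeff 0 ≠ 0 :=
    (hY.eventually_gt_atTop 0).mono fun p hp => norm_pos_iff.1 hp
  intro n
  simp only [coeff_C_mul, comp_C_mul_X_coeff]
  rcases eq_or_ne n 0 with rfl | hn
  · refine tendsto_const_nhds.congr' ?_
    filter_upwards [hY0] with p hp
    simp [hp]
  · rw [coeff_one, if_neg hn]
    have hb : ∀ᶠ p : ℝ × ℝ in l, ‖((d.YP p.1 p.2).coeff 0)⁻¹ * p.2‖ ≤ |(d.VP.coeff 0).im|⁻¹ := by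
      filter_upwards [hY0] with p hp
      have h1 : |p.2| * |(d.VP.coeff 0).im| ≤ ‖(d.YP p.1 p.2).coeff 0‖ := by
        refine le_trans (le_of_eq ?_) (abs_im_le_norm _)
        rw [YP_coeff_zero, ← abs_mul]
        simp
      rw [norm_mul, norm_inv, norm_real, Real.norm_eq_abs]
      have h2 := abs_pos.2 (VP_coeff_zero_im ha hc)
      have h3 := norm_pos_iff.2 hp
      rw [inv_mul_le_iff₀ h3, ← div_eq_mul_inv, le_div_iff₀ h2]
      exact h1
    have h1 : Tendsto (fun p : ℝ × ℝ => ((d.YP p.1 p.2).coeff 0)⁻¹ * p.2 *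
        (((d.YP p.1 p.2).coeff 0)⁻¹ ^ 2) ^ n) l (𝓝 0) := by
      have h0 : Tendsto (fun p : ℝ × ℝ => (((d.YP p.1 p.2).coeff 0)⁻¹ ^ 2) ^ n) l (𝓝 0) := by
        simpa [hn] using (hinv.pow 2).pow n
      exact isBoundedUnder_le_mul_tendsto_zero (isBoundedUnder_of_eventually_le hb) h0
    have h2 : Tendsto (fun p : ℝ × ℝ => ((d.YP p.1 p.2).coeff 0)⁻¹ * (d.YP 0 0).coeff n *
        (((d.YP p.1 p.2).coeff 0)⁻¹ ^ 2) ^ n) l (𝓝 0) := by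
      simpa using (hinv.mul_const ((d.YP 0 0).coeff n)).mul ((hinv.pow 2).pow n)
    have h3 := (h1.const_mul (d.VP.coeff n)).add h2
    rw [mul_zero, add_zero] at h3
    refine h3.congr fun p => ?_
    rw [YP_coeff_of_ne hn p.1 p.2]
    ring

/-- A simple zero at the origin: `η² * S(z / η²)` tends to the linear part of `S`. -/
lemma coeffTendsto_SP (ha : d.a < 1) (hc : d.c ≠ 0) (hl : l ≤ cocompact (ℝ × ℝ)) :
    CoeffTendsto (fun p : ℝ × ℝ => C ((d.YP p.1 p.2).coeff 0 ^ 2) *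
      d.SP.comp (C (((d.YP p.1 p.2).coeff 0)⁻¹ ^ 2) * X)) l (C (d.SP.coeff 1) * X) := by
  have hY := (tendsto_YP_coeff_zero ha hc).mono_left hl
  have hinv : Tendsto (fun p : ℝ × ℝ => ((d.YP p.1 p.2).coeff 0)⁻¹) l (𝓝 0) :=
    tendsto_inv₀_cobounded.comp (tendsto_norm_atTop_iff_cobounded.1 hY)
  have hY0 : ∀ᶠ p : ℝ × ℝ in l, (d.YP p.1 p.2).coeff 0 ≠ 0 :=
    (hY.eventually_gt_atTop 0).mono fun p hp => norm_pos_iff.1 hp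
  intro n
  simp only [coeff_C_mul, comp_C_mul_X_coeff]
  rcases n with _ | n
  · simpa [SP_coeff_zero ha] using tendsto_const_nhds
  · have h1 : Tendsto (fun p : ℝ × ℝ => d.SP.coeff (n + 1) *
        (((d.YP p.1 p.2).coeff 0)⁻¹ ^ 2) ^ n) l (𝓝 (d.SP.coeff 1 * X.coeff (n + 1))) := by
      rcases eq_or_ne n 0 with rfl | hn
      · simpa using tendsto_const_nhds
      · rw [coeff_X_of_ne_one (by omega), mul_zero]
        simpa [hn] using ((hinv.pow 2).pow n).const_mul (d.SP.coeff (n + 1))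
    refine h1.congr' ?_
    filter_upwards [hY0] with p hp
    rw [pow_succ (_ ^ 2) n]
    generalize (((d.YP p.1 p.2).coeff 0)⁻¹ ^ 2) ^ n = z
    field_simp

lemma coeffTendsto_QP (ha : d.a < 1) (hc : d.c ≠ 0) (hl : l ≤ cocompact (ℝ × ℝ)) :
    CoeffTendsto (fun p : ℝ × ℝ => d.QP.comp (C (((d.YP p.1 p.2).coeff 0)⁻¹ ^ 2) * X)) l
      (C (d.QP.coeff 0)) := by
  have hY := (tendsto_YP_coeff_zero ha hc).mono_left hl
  have hinv : Tendsto (fun p : ℝ × ℝ => ((d.YP p.1 p.2).coeff 0)⁻¹) l (𝓝 0) :=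
    tendsto_inv₀_cobounded.comp (tendsto_norm_atTop_iff_cobounded.1 hY)
  intro n
  simp only [comp_C_mul_X_coeff]
  rcases eq_or_ne n 0 with rfl | hn
  · simpa using tendsto_const_nhds
  · rw [coeff_C_of_ne_zero hn]
    simpa [hn] using ((hinv.pow 2).pow n).const_mul (d.QP.coeff n)

/-- In the limit of large `(x, t)`, solutions of the interpolation conditions have many vanishing
coefficients. -/
lemma coeff_eq_zero_of_tendsto (ha : d.a < 1) (hc : d.c ≠ 0) {l : Ultrafilter (ℝ × ℝ)}
    (hl : (l : Filter (ℝ × ℝ)) ≤ cocompact (ℝ × ℝ)) {u v : ℝ × ℝ → ℂ[X]} {U V : ℂ[X]}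
    (hu : CoeffTendsto u l U) (hv : CoeffTendsto v l V)
    (huv : ∀ p : ℝ × ℝ, X ^ d.N ∣ u p * (d.QP * truncSin d.N d.SP (d.YP p.1 p.2)) -
      v p * truncCos d.N d.SP (d.YP p.1 p.2)) :
    (∀ i, 2 * i < d.N → U.coeff i = 0) ∧ ∀ i, 2 * i + 1 < d.N → V.coeff i = 0 := by
  have hY := (tendsto_YP_coeff_zero ha hc).mono_left hl
  have hY0 : ∀ᶠ p : ℝ × ℝ in (l : Filter (ℝ × ℝ)), (d.YP p.1 p.2).coeff 0 ≠ 0 :=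
    (hY.eventually_gt_atTop 0).mono fun p hp => norm_pos_iff.1 hp
  have hσ := (coeffTendsto_QP ha hc hl).mul
    ((coeffTendsto_SP ha hc hl).truncSin (coeffTendsto_YP ha hc hl) d.N)
  have hγ := (coeffTendsto_SP ha hc hl).truncCos (coeffTendsto_YP ha hc hl) d.N
  replace hσ := hσ.congr' (G := fun p => C ((d.YP p.1 p.2).coeff 0)⁻¹ *
    (d.QP * truncSin d.N d.SP (d.YP p.1 p.2)).comp (C (((d.YP p.1 p.2).coeff 0)⁻¹ ^ 2) * X)) (by
      filter_upwards [hY0] with p hp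
      rw [truncSin_scale _ _ _ hp, mul_comp, truncSin_comp]; ring)
  replace hγ := hγ.congr' (G := fun p =>
    (truncCos d.N d.SP (d.YP p.1 p.2)).comp (C (((d.YP p.1 p.2).coeff 0)⁻¹ ^ 2) * X)) (by
      filter_upwards [hY0] with p hp
      rw [truncCos_scale _ _ _ hp, truncCos_comp])
  -- The coefficients are interleaved as `u_0, v_0, u_1, v_1, …`. Since the sine part scales with
  -- one extra factor `1 / η`, multiplying equation `m` by `η ^ (-2 * m - 2)` gives `u_i` the weight
  -- `η ^ (-2 * i - 1)` and `v_i` the weight `η ^ (-2 * i - 2)`.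
  have key := tendsto_scaled_eq_zero l (N := d.N) hY
    (h := fun p k => if Even k then (u p).coeff (k / 2) else (v p).coeff (k / 2))
    (h₀ := fun k => if Even k then U.coeff (k / 2) else V.coeff (k / 2))
    (fun k => by split_ifs; exacts [hu _, hv _]) (fun j _ => hσ j) (fun j _ => hγ j) ?_ ?_
  · refine ⟨fun i hi => by simpa using key _ hi, fun i hi => ?_⟩
    have := key _ hi
    rwa [if_neg (by simp), show (2 * i + 1) / 2 = i by omega] at this
  · filter_upwards [hY0] with p hp m hm
    have h1 := X_pow_dvd_iff.1 (huv p) m hm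
    rw [coeff_sub, coeff_mul, coeff_mul, ← Finset.sum_sub_distrib] at h1
    rw [← mul_zero ((d.YP p.1 p.2).coeff 0 ^ (2 * m + 2))⁻¹, ← h1, Finset.mul_sum]
    refine Finset.sum_congr rfl fun q hq => ?_
    rw [← Finset.HasAntidiagonal.mem_antidiagonal.1 hq]
    simp only [coeff_C_mul, comp_C_mul_X_coeff]
    rw [if_pos (by simp), if_neg (by simp), show (2 * q.1 + 1) / 2 = q.1 by omega,
      show 2 * q.1 / 2 = q.1 by omega]
    generalize (d.YP p.1 p.2).coeff 0 = η at hp ⊢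
    rw [inv_pow, inv_pow, ← pow_mul]
    field_simp
    ring
  · intro w hw h
    -- The limiting system is the Padé problem of index `n = 0`, between `sin √ζ / √ζ` and `cos √ζ`;
    -- the nonzero constant `QP(0)` is absorbed in the first unknown.
    have h1 := eq_zero_of_pow_dvd_besselSeries (neg_ne_zero.2 (SP_coeff_one_ne ha hc)) d.N 0
      (PowerSeries.C (d.QP.coeff 0) * PowerSeries.mk fun i => w (2 * i))
      (PowerSeries.mk fun i => w (2 * i + 1))
      (fun i hi => by rw [PowerSeries.coeff_C_mul, PowerSeries.coeff_mk, hw _ hi, mul_zero])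
      (fun i hi => by rw [PowerSeries.coeff_mk, hw _ hi]) ?_
    · intro k
      rcases Nat.even_or_odd' k with ⟨i, rfl | rfl⟩
      · have h2 := congrArg (PowerSeries.coeff i) h1.1
        rw [PowerSeries.coeff_C_mul, PowerSeries.coeff_mk, map_zero] at h2
        exact (mul_eq_zero.1 h2).resolve_left (QP_coeff_zero_ne ha hc)
      · simpa using congrArg (PowerSeries.coeff i) h1.2
    · rw [PowerSeries.X_pow_dvd_iff]
      intro m hm
      rw [← h m hm, map_sub, PowerSeries.coeff_mul, PowerSeries.coeff_mul,
        ← Finset.sum_sub_distrib]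
      refine Finset.sum_congr rfl fun q hq => ?_
      have hq2 : q.2 < d.N := by
        have := Finset.HasAntidiagonal.mem_antidiagonal.1 hq; omega
      rw [coeff_C_mul, truncSin_coeff_linear hq2, truncCos_coeff_linear hq2,
        PowerSeries.coeff_C_mul, PowerSeries.coeff_mk, PowerSeries.coeff_mk]
      ring

end Data

end CLL

/-! ### Behaviour at infinity -/

namespace CLL

open Polynomial

section

/-- The polynomial `∑ (-1)^j y_j l^{2N-j}`. -/
noncomputable def kerPoly {N : ℕ} (l : ℂ[X]) (y : Fin (2 * N + 1) → ℂ) : ℂ[X] :=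
  ∑ j : Fin (2 * N + 1), y j • (l ^ (2 * N - j.1) * (if Even j.1 then 1 else -1))

variable {N : ℕ} (l : ℂ[X]) (y : Fin (2 * N + 1) → ℂ)

lemma kerPoly_eq : kerPoly l y = (evenPoly y).comp (l ^ 2) - l * (oddPoly y).comp (l ^ 2) := by
  rw [kerPoly, sum_columns y l 1 (-1)]
  simp only [comp_eq_aeval]
  ring

lemma kerPoly_comp (R : ℂ[X]) : (kerPoly l y).comp R = kerPoly (l.comp R) y := by
  simp only [kerPoly, Polynomial.sum_comp, smul_comp, mul_comp, pow_comp]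
  refine Finset.sum_congr rfl fun j _ => ?_
  split_ifs <;> simp

lemma cj_kerPoly : cj (kerPoly X y) = kerPoly X fun j => conj (y j) := by
  simp only [kerPoly, map_sum, smul_eq_C_mul, map_mul, cj_C, map_pow, cj_X]
  refine Finset.sum_congr rfl fun j _ => ?_
  split_ifs <;> simp

lemma kerPoly_X_natDegree_le : (kerPoly X y).natDegree ≤ 2 * N := by
  refine natDegree_sum_le_of_forall_le _ _ fun j _ => (natDegree_smul_le _ _).trans ?_
  split_ifs
  · rw [mul_one, natDegree_X_pow]; omega
  · rw [mul_neg_one, natDegree_neg, natDegree_X_pow]; omega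

lemma kerPoly_X_coeff (j : Fin (2 * N + 1)) :
    (kerPoly X y).coeff (2 * N - j.1) = y j * (if Even j.1 then 1 else -1) := by
  rw [kerPoly, finsetSum_coeff, Finset.sum_eq_single j]
  · rw [coeff_smul]
    split_ifs <;> simp
  · intro i _ hi
    have h : 2 * N - j.1 ≠ 2 * N - i.1 := fun h => hi (Fin.ext (by omega))
    rw [coeff_smul]
    split_ifs <;> simp [coeff_X_pow, h]
  · simp

lemma coeffTendsto_kerPoly {α : Type*} {L : Filter α} {y : α → Fin (2 * N + 1) → ℂ}
    {y₀ : Fin (2 * N + 1) → ℂ} (hy : Tendsto y L (𝓝 y₀)) (l : ℂ[X]) :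
    CoeffTendsto (fun e => kerPoly l (y e)) L (kerPoly l y₀) := by
  simp only [kerPoly, smul_eq_C_mul]
  refine CoeffTendsto.sum fun j _ => CoeffTendsto.mul (fun n => ?_) (CoeffTendsto.const _ L)
  simp only [coeff_C]
  split_ifs
  · exact tendsto_pi_nhds.1 hy j
  · exact tendsto_const_nhds

lemma coeffTendsto_evenPoly {α : Type*} {L : Filter α} {y : α → Fin (2 * N + 1) → ℂ}
    {y₀ : Fin (2 * N + 1) → ℂ} (hy : Tendsto y L (𝓝 y₀)) :
    CoeffTendsto (fun e => evenPoly (y e)) L (evenPoly y₀) := by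
  refine CoeffTendsto.sum fun j _ n => ?_
  split_ifs
  · simp only [coeff_C_mul]
    exact (tendsto_pi_nhds.1 hy j).mul_const _
  · exact tendsto_const_nhds

lemma coeffTendsto_oddPoly {α : Type*} {L : Filter α} {y : α → Fin (2 * N + 1) → ℂ}
    {y₀ : Fin (2 * N + 1) → ℂ} (hy : Tendsto y L (𝓝 y₀)) :
    CoeffTendsto (fun e => oddPoly (y e)) L (oddPoly y₀) := by
  refine CoeffTendsto.sum fun j _ n => ?_
  split_ifs
  · exact tendsto_const_nhds
  · simp only [coeff_C_mul]
    exact (tendsto_pi_nhds.1 hy j).mul_const _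

lemma CoeffTendsto.cj {α : Type*} {L : Filter α} {F : α → ℂ[X]} {P : ℂ[X]}
    (h : CoeffTendsto F L P) : CoeffTendsto (fun e => CLL.cj (F e)) L (CLL.cj P) := fun n => by
  simp only [cj_coeff]
  exact (continuous_conj.tendsto _).comp (h n)

lemma CoeffTendsto.herm {α : Type*} {L : Filter α} {F G : α → ℂ[X]} {P Q : ℂ[X]}
    (hF : CoeffTendsto F L P) (hG : CoeffTendsto G L Q) :
    CoeffTendsto (fun e => CLL.herm (F e) (G e)) L (CLL.herm P Q) := fun n => by
  simp only [CLL.herm, coeff_add]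
  exact (hF.mul hF.cj n).add (((CoeffTendsto.const X L).mul hG).mul hG.cj n)

/-- Vieta's formula for a polynomial with prescribed zeros at `± l` and `± l̄`. -/
lemma coeff_sub_one_of_dvd {G : ℂ[X]} {l : ℂ} {p q : ℕ} (hre : l.re ≠ 0) (him : l.im ≠ 0)
    (hpq : 1 ≤ p + q) (hG : G.natDegree ≤ 2 * (p + q)) (h1 : (X - C l) ^ p ∣ G)
    (h2 : (X - C (-l)) ^ q ∣ G) (h3 : (X - C (-conj l)) ^ p ∣ G) (h4 : (X - C (conj l)) ^ q ∣ G) :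
    G.coeff (2 * (p + q) - 1) = -((p - q) * (l - conj l)) * G.coeff (2 * (p + q)) := by
  have hco : ∀ {u v : ℂ}, u ≠ v → ∀ m n : ℕ, IsCoprime ((X - C u) ^ m) ((X - C v) ^ n) :=
    fun h m n => (isCoprime_X_sub_C_of_isUnit_sub (sub_ne_zero.2 h).isUnit).pow
  have n1 : l ≠ -l := fun h => hre (by have := congrArg re h; simp at this; linarith)
  have n2 : l ≠ -conj l := fun h => hre (by have := congrArg re h; simp at this; linarith)
  have n3 : l ≠ conj l := fun h => him (by have := congrArg im h; simp at this; linarith)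
  have n4 : -l ≠ -conj l := fun h => n3 (neg_injective h)
  have n5 : -l ≠ conj l := fun h => hre (by have := congrArg re h; simp at this; linarith)
  have n6 : -conj l ≠ conj l := fun h => hre (by have := congrArg re h; simp at this; linarith)
  set P : ℂ[X] := (X - C l) ^ p * (X - C (-l)) ^ q * (X - C (-conj l)) ^ p * (X - C (conj l)) ^ q
    with hP
  have hm : ∀ (u : ℂ) (m : ℕ), ((X - C u) ^ m).Monic := fun u m => (monic_X_sub_C u).pow m
  have hPm : P.Monic := (((hm _ _).mul (hm _ _)).mul (hm _ _)).mul (hm _ _)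
  have hdeg : P.natDegree = 2 * (p + q) := by
    rw [hP, ((((hm _ _).mul (hm _ _)).mul (hm _ _))).natDegree_mul (hm _ _),
      (((hm _ _).mul (hm _ _))).natDegree_mul (hm _ _), (hm _ _).natDegree_mul (hm _ _)]
    simp only [natDegree_pow, natDegree_X_sub_C]
    ring
  have hnext : P.nextCoeff = -((p - q) * (l - conj l)) := by
    rw [hP, ((((hm _ _).mul (hm _ _)).mul (hm _ _))).nextCoeff_mul (hm _ _),
      (((hm _ _).mul (hm _ _))).nextCoeff_mul (hm _ _), (hm _ _).nextCoeff_mul (hm _ _)]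
    simp only [(monic_X_sub_C _).nextCoeff_pow, nextCoeff_X_sub_C, nsmul_eq_mul]
    ring
  have hdvd : P ∣ G := by
    refine IsCoprime.mul_dvd ?_ (IsCoprime.mul_dvd ?_ (IsCoprime.mul_dvd (hco n1 _ _) h1 h2) h3) h4
    · exact ((hco n3 _ _).mul_left (hco n5 _ _)).mul_left (hco n6 _ _)
    · exact (hco n2 _ _).mul_left (hco n4 _ _)
  obtain ⟨K, rfl⟩ := hdvd
  have hK : K = C (K.coeff 0) := by
    rcases eq_or_ne K 0 with rfl | hK
    · simp
    · rw [hPm.natDegree_mul' hK, hdeg] at hG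
      exact eq_C_of_natDegree_le_zero (by omega)
  rw [hK, coeff_mul_C, coeff_mul_C, ← hnext, nextCoeff_of_natDegree_pos (by omega), hdeg,
    show P.coeff (2 * (p + q)) = 1 by rw [← hdeg]; exact hPm]
  ring

end

namespace Data

variable {d : Data}

/-- Removal of the carrier from a vector in the kernel. -/
noncomputable def gauge (d : Data) (x t : ℝ) (y : Fin (2 * d.N + 1) → ℂ) : Fin (2 * d.N + 1) → ℂ :=
  fun j => if Even j.1 then y j else d.carrier x t ^ 2 * y j

lemma gauge_smul (x t : ℝ) (z : ℂ) (y : Fin (2 * d.N + 1) → ℂ) :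
    d.gauge x t (z • y) = z • d.gauge x t y := by
  funext j
  simp only [gauge, Pi.smul_apply, smul_eq_mul]
  split_ifs <;> ring

lemma evenPoly_gauge (x t : ℝ) (y : Fin (2 * d.N + 1) → ℂ) :
    evenPoly (d.gauge x t y) = evenPoly y := by
  refine Finset.sum_congr rfl fun j _ => ?_
  simp only [gauge]
  split_ifs <;> rfl

lemma oddPoly_gauge (x t : ℝ) (y : Fin (2 * d.N + 1) → ℂ) :
    oddPoly (d.gauge x t y) = C (d.carrier x t ^ 2) * oddPoly y := by
  rw [oddPoly, oddPoly, Finset.mul_sum]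
  refine Finset.sum_congr rfl fun j _ => ?_
  simp only [gauge]
  split_ifs
  · simp
  · rw [C_mul, mul_assoc]

lemma herm_gauge (x t : ℝ) (y : Fin (2 * d.N + 1) → ℂ) :
    herm (evenPoly (d.gauge x t y)) (oddPoly (d.gauge x t y)) = herm (evenPoly y) (oddPoly y) := by
  have h : C (d.carrier x t) * C (conj (d.carrier x t)) = 1 := by
    rw [← C_mul, carrier_mul_conj, C_1]
  rw [evenPoly_gauge, oddPoly_gauge, herm, herm]
  simp only [map_mul, cj_C, map_pow]
  linear_combination X * oddPoly y * cj (oddPoly y) *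
    (C (d.carrier x t) * C (conj (d.carrier x t)) + 1) * h

/-- With the carrier removed, `f = Q s - C` and `g = -Q s - C` for the truncated sine `s` and cosine
`C`, so that `A f + λ B g = (A - λ B) Q s - (A + λ B) C`. The two brackets are one polynomial
evaluated at `λ` and at `-λ`. -/
lemma IsKer.gauge_dvd {x t : ℝ} {y : Fin (2 * d.N + 1) → ℂ} (hy : d.IsKer x t y) :
    X ^ d.N ∣ kerPoly d.lamP (d.gauge x t y) * (d.QP * truncSin d.N d.SP (d.YP x t)) -
      kerPoly (-d.lamP) (d.gauge x t y) * truncCos d.N d.SP (d.YP x t) := by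
  have h : C (d.carrier x t) * C (conj (d.carrier x t)) = 1 := by
    rw [← C_mul, carrier_mul_conj, C_1]
  refine (hy.dvd₁.mul_left (C (d.carrier x t))).trans (dvd_of_eq ?_)
  rw [kerPoly_eq, kerPoly_eq, evenPoly_gauge, oddPoly_gauge, fP, gP, fJ, gJ, neg_sq, mul_comp, C_pow,
    pow_comp, C_comp]
  linear_combination (evenPoly y).comp (d.lamP ^ 2) *
    (d.QP * truncSin d.N d.SP (d.YP x t) - truncCos d.N d.SP (d.YP x t)) * h

lemma IsKer.conj_gauge_dvd {x t : ℝ} {y : Fin (2 * d.N + 1) → ℂ} (hy : d.IsKer x t y) :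
    X ^ d.N ∣ kerPoly (-d.lamP) (fun j => conj (d.gauge x t y j)) *
        (d.QP * truncSin d.N d.SP (d.YP x t)) -
      -kerPoly d.lamP (fun j => conj (d.gauge x t y j)) * truncCos d.N d.SP (d.YP x t) := by
  have h : C (d.carrier x t) * C (conj (d.carrier x t)) = 1 := by
    rw [← C_mul, carrier_mul_conj, C_1]
  refine (hy.dvd₂.mul_left (-C (conj (d.carrier x t)))).trans (dvd_of_eq ?_)
  rw [kerPoly_eq, kerPoly_eq, ← cj_evenPoly, ← cj_oddPoly, evenPoly_gauge, oddPoly_gauge, fP, gP,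
    fJ, gJ, map_mul, cj_C, neg_sq, mul_comp, map_pow,
    C_pow, pow_comp, C_comp]
  linear_combination (cj (evenPoly y)).comp (d.lamP ^ 2) *
    (d.QP * truncSin d.N d.SP (d.YP x t) + truncCos d.N d.SP (d.YP x t)) * h

lemma pow_dvd_of_comp_lamP {G : ℂ[X]} {p : ℕ} (h : X ^ p ∣ G.comp d.lamP) :
    (X - C d.lam₀) ^ p ∣ G := by
  obtain ⟨K, hK⟩ := h
  refine ⟨K.comp (X - C d.lam₀), ?_⟩
  have := congrArg (fun P => P.comp (X - C d.lam₀)) hK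
  simpa [comp_assoc, lamP] using this

lemma pow_dvd_of_comp_neg_lamP {G : ℂ[X]} {p : ℕ} (h : X ^ p ∣ G.comp (-d.lamP)) :
    (X - C (-d.lam₀)) ^ p ∣ G := by
  obtain ⟨K, hK⟩ := h
  refine ⟨(-1) ^ p * K.comp (-X - C d.lam₀), ?_⟩
  have := congrArg (fun P => P.comp (-X - C d.lam₀)) hK
  simp only [comp_assoc, mul_comp, pow_comp, X_comp] at this
  rw [show (-d.lamP).comp (-X - C d.lam₀) = X by simp [lamP], comp_X] at this
  rw [this, ← mul_assoc, ← mul_pow, C_neg]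
  congr 2
  ring

lemma cj_X_sub_C_pow (z : ℂ) (p : ℕ) : cj ((X - C z) ^ p) = (X - C (conj z)) ^ p := by
  rw [map_pow, map_sub, cj_X, cj_C]

/-- The modulus of the wave is unchanged by complex rescaling of the kernel vector and by the
unimodular carrier, so the vector can be normalized after gauging. -/
lemma norm_rogue (hN : 1 ≤ d.N) (x t : ℝ) {k : ℂ} (hk : k ≠ 0) : ‖d.rogue x t‖ =
    ‖-d.c * d.gauge x t (k • minorVec (d.hatExt x t)) 0 -
        2 * I * d.gauge x t (k • minorVec (d.hatExt x t)) ⟨1, by omega⟩‖ /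
      ‖d.gauge x t (k • minorVec (d.hatExt x t)) 0‖ := by
  have h := d.carrier_mul_conj x t
  have hcn : ‖d.carrier x t‖ = 1 := by
    have := congrArg norm h
    rw [norm_mul, norm_conj, norm_one, ← sq] at this
    exact (pow_eq_one_iff_of_nonneg (norm_nonneg _) two_ne_zero).1 this
  rw [rogue_eq_minorVec hN]
  generalize minorVec (d.hatExt x t) = m
  have e1 : -d.c * d.gauge x t (k • m) 0 - 2 * I * d.gauge x t (k • m) ⟨1, by omega⟩ =
      k * (d.carrier x t ^ 2 * (m 0 * seedR d.a d.c x t - 2 * I * m ⟨1, by omega⟩)) := by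
    simp only [seedR_eq, Pi.smul_apply, smul_eq_mul, gauge, Fin.val_zero, Even.zero,
      if_true, Nat.not_even_one, if_false]
    linear_combination (k * m 0 * d.c) * (d.carrier x t * conj (d.carrier x t) + 1) * h
  have e2 : d.gauge x t (k • m) 0 = k * m 0 := by simp [gauge]
  rw [e1, e2, norm_mul, norm_mul, norm_mul, norm_pow, hcn, one_pow, one_mul, norm_div, norm_conj,
    mul_div_mul_left _ _ (norm_ne_zero_iff.2 hk)]

variable (ha : d.a < 1) (hc : d.c ≠ 0) (hroot : AnalyticAt ℝ d.root 0)
    (hsq : ∀ᶠ ε in 𝓝 (0 : ℝ), d.root ε ^ 2 = S d.a d.c (lamOdd d.a d.c ε))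
include ha hc

/-- The ratio of the two leading entries of a vector in the kernel at infinity. -/
lemma gauge_limit (hN : 1 ≤ d.N) {l : Ultrafilter (ℝ × ℝ)}
    (hl : (l : Filter (ℝ × ℝ)) ≤ cocompact (ℝ × ℝ)) {y : ℝ × ℝ → Fin (2 * d.N + 1) → ℂ}
    (hy : ∀ p, d.IsKer p.1 p.2 (y p)) {z : Fin (2 * d.N + 1) → ℂ} (hz : z ≠ 0)
    (hlim : Tendsto (fun p => d.gauge p.1 p.2 (y p)) l (𝓝 z)) :
    z 0 ≠ 0 ∧ (z ⟨1, by omega⟩ = 0 ∨ z ⟨1, by omega⟩ = I * d.c * z 0) := by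
  have hconj : Tendsto (fun p j => conj (d.gauge p.1 p.2 (y p) j)) l (𝓝 fun j => conj (z j)) :=
    tendsto_pi_nhds.2 fun j => (continuous_conj.tendsto _).comp (tendsto_pi_nhds.1 hlim j)
  -- The Hermitian form equals `|y_0|²` times a fixed polynomial and the gauge does not change it.
  -- In the limit `z 0 = 0` would make it vanish, hence `z = 0`.
  have h0 : z 0 ≠ 0 := by
    intro h0
    have h1 := (coeffTendsto_evenPoly hlim).herm (coeffTendsto_oddPoly hlim)
    have h2 : herm (evenPoly z) (oddPoly z) = 0 := by
      ext n
      refine tendsto_nhds_unique (h1 n) ?_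
      simp only [herm_gauge, (hy _).herm_eq ha hc hN, coeff_C_mul]
      have h3 : Tendsto (fun p => y p 0) l (𝓝 (z 0)) := by
        simpa [gauge] using tendsto_pi_nhds.1 hlim 0
      have h4 := (h3.mul ((continuous_conj.tendsto _).comp h3)).mul_const
        (((X - C (d.lam₀ ^ 2)) ^ d.N * cj ((X - C (d.lam₀ ^ 2)) ^ d.N)).coeff n)
      rw [h0, zero_mul, zero_mul] at h4
      exact h4
    obtain ⟨h5, h6⟩ := herm_eq_zero h2
    exact hz (eq_zero_of_evenPoly_oddPoly h5 h6)
  refine ⟨h0, ?_⟩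
  obtain ⟨a1, a2⟩ := coeff_eq_zero_of_tendsto ha hc hl (coeffTendsto_kerPoly hlim d.lamP)
    (coeffTendsto_kerPoly hlim (-d.lamP)) fun p => (hy p).gauge_dvd
  obtain ⟨a3, a4⟩ := coeff_eq_zero_of_tendsto ha hc hl (coeffTendsto_kerPoly hconj (-d.lamP))
    (V := -kerPoly d.lamP fun j => conj (z j))
    (fun n => by simpa using (coeffTendsto_kerPoly hconj d.lamP n).neg)
    fun p => (hy p).conj_gauge_dvd
  -- Take `p = ⌈N/2⌉` and `q = ⌊N/2⌋`, the numbers of `i` with `2 * i < N` and with `2 * i + 1 < N`.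
  -- The resulting zeros at `λ₀`, `-λ₀`, `-λ̄₀`, `λ̄₀` number `2 * (p + q) = 2 * N`, the full
  -- degree.
  obtain ⟨p, q, hpq, hp, hq, hcase⟩ : ∃ p q : ℕ, p + q = d.N ∧ (∀ i < p, 2 * i < d.N) ∧
      (∀ i < q, 2 * i + 1 < d.N) ∧ (p = q ∨ p = q + 1) :=
    ⟨d.N - d.N / 2, d.N / 2, by omega, fun i hi => by omega, fun i hi => by omega, by omega⟩
  have e : ∀ (w : Fin (2 * d.N + 1) → ℂ) (R : ℂ[X]), (kerPoly X w).comp R = kerPoly R w := by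
    intro w R; rw [kerPoly_comp, X_comp]
  have b1 : (X - C d.lam₀) ^ p ∣ kerPoly X z := pow_dvd_of_comp_lamP
    (by rw [e]; exact X_pow_dvd_iff.2 fun i hi => a1 i (hp i hi))
  have b2 : (X - C (-d.lam₀)) ^ q ∣ kerPoly X z := pow_dvd_of_comp_neg_lamP
    (by rw [e]; exact X_pow_dvd_iff.2 fun i hi => a2 i (hq i hi))
  have b3 : (X - C (-conj d.lam₀)) ^ p ∣ kerPoly X z := by
    have : (X - C (-d.lam₀)) ^ p ∣ kerPoly X fun j => conj (z j) := pow_dvd_of_comp_neg_lamP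
      (by rw [e]; exact X_pow_dvd_iff.2 fun i hi => a3 i (hp i hi))
    have := map_dvd cj this
    rwa [cj_kerPoly, cj_X_sub_C_pow, map_neg, funext fun j => conj_conj (z j)] at this
  have b4 : (X - C (conj d.lam₀)) ^ q ∣ kerPoly X z := by
    have : (X - C d.lam₀) ^ q ∣ kerPoly X fun j => conj (z j) := pow_dvd_of_comp_lamP
      (by rw [e]; exact X_pow_dvd_iff.2 fun i hi => by simpa using a4 i (hq i hi))
    have := map_dvd cj this
    rwa [cj_kerPoly, cj_X_sub_C_pow, funext fun j => conj_conj (z j)] at this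
  have him : d.lam₀.im ≠ 0 := by rw [lam₀_im]; exact div_ne_zero hc two_ne_zero
  have hre : d.lam₀.re ≠ 0 := by rw [lam₀_re]; exact (sqrt_pos' ha).ne'
  have key := coeff_sub_one_of_dvd hre him (hpq ▸ hN) (by rw [hpq]; exact kerPoly_X_natDegree_le z)
    b1 b2 b3 b4
  have k0 := kerPoly_X_coeff z 0
  have k1 := kerPoly_X_coeff z ⟨1, by omega⟩
  simp only [Fin.val_zero, Nat.sub_zero, Even.zero, if_true, mul_one, Nat.not_even_one,
    if_false, mul_neg] at k0 k1
  have hdiff : d.lam₀ - conj d.lam₀ = I * d.c := by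
    rw [sub_conj, lam₀_im]; push_cast; ring
  rw [hpq, k0, k1, hdiff] at key
  -- Vieta's formula gives `z_1 = (p - q) * I * c * z_0`, and `p - q` is `0` or `1` according to the
  -- parity of `N`.
  rcases hcase with h | h
  · left
    have h' : (p : ℂ) = q := by rw [h]
    linear_combination -key + (I * d.c * z 0) * h'
  · right
    have h' : (p : ℂ) = q + 1 := by rw [h]; push_cast; ring
    linear_combination -key + (I * d.c * z 0) * h'

include hroot hsq

lemma tendsto_norm_rogue (hN : 1 ≤ d.N) :
    Tendsto (fun p : ℝ × ℝ => ‖d.rogue p.1 p.2‖) (cocompact (ℝ × ℝ)) (𝓝 |d.c|) := by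
  rw [tendsto_iff_ultrafilter]
  intro l hl
  obtain ⟨k, hk, hsphere⟩ : ∃ k : ℝ × ℝ → ℂ, (∀ p, k p ≠ 0) ∧
      ∀ p, ‖d.gauge p.1 p.2 (k p • minorVec (d.hatExt p.1 p.2))‖ = 1 := by
    have hne : ∀ p : ℝ × ℝ, ‖d.gauge p.1 p.2 (minorVec (d.hatExt p.1 p.2))‖ ≠ 0 := fun p h => by
      have := congrFun (norm_eq_zero.1 h) 0
      exact minorVec_zero_ne ha hc hroot hsq hN p.1 p.2 (by simpa [gauge] using this)
    refine ⟨fun p => ((‖d.gauge p.1 p.2 (minorVec (d.hatExt p.1 p.2))‖ : ℝ) : ℂ)⁻¹,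
      fun p => inv_ne_zero (ofReal_ne_zero.2 (hne p)), fun p => ?_⟩
    rw [gauge_smul, norm_smul, norm_inv, norm_real, norm_norm]
    exact inv_mul_cancel₀ (hne p)
  have hker : ∀ p : ℝ × ℝ, d.IsKer p.1 p.2 (k p • minorVec (d.hatExt p.1 p.2)) := fun p =>
    (isKer_of_mulVec ha hc hroot hsq (mulVec_minorVec _)).smul _
  obtain ⟨z, hz, hlim⟩ := (isCompact_sphere (0 : Fin (2 * d.N + 1) → ℂ) 1).ultrafilter_le_nhds
    (l.map fun p => d.gauge p.1 p.2 (k p • minorVec (d.hatExt p.1 p.2)))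
    (le_principal_iff.2 (mem_map.2 (univ_mem' fun p => mem_sphere_zero_iff_norm.2 (hsphere p))))
  have hlim' : Tendsto (fun p => d.gauge p.1 p.2 (k p • minorVec (d.hatExt p.1 p.2))) l (𝓝 z) :=
    hlim
  have hz0 : z ≠ 0 := fun h => by rw [h] at hz; simp at hz
  obtain ⟨h0, h1⟩ := gauge_limit ha hc hN hl hker hz0 hlim'
  have hl0 := tendsto_pi_nhds.1 hlim' 0
  have hl1 := tendsto_pi_nhds.1 hlim' ⟨1, by omega⟩
  have hfin := ((hl0.const_mul (-d.c : ℂ)).sub (hl1.const_mul (2 * I))).norm.div hl0.norm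
    (norm_ne_zero_iff.2 h0)
  -- The numerator is `-c * z_0` in the first case and `-c * z_0 + 2 * c * z_0 = c * z_0` in the
  -- second, so the modulus is `|c|` either way.
  have hval : ‖-d.c * z 0 - 2 * I * z ⟨1, by omega⟩‖ / ‖z 0‖ = |d.c| := by
    rw [div_eq_iff (norm_ne_zero_iff.2 h0)]
    rcases h1 with h1 | h1
    · rw [h1, mul_zero, sub_zero, norm_mul, norm_neg, norm_real, Real.norm_eq_abs]
    · rw [h1, show -d.c * z 0 - 2 * I * (I * d.c * z 0) = d.c * z 0 by
        linear_combination (-2 * d.c * z 0 : ℂ) * I_sq, norm_mul, norm_real, Real.norm_eq_abs]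
  rw [hval] at hfin
  exact hfin.congr fun p => (norm_rogue hN p.1 p.2 (hk p)).symm

end Data

end CLL

/-! ### The main theorem -/

theorem theorem4 (d : CLL.Data) (hN : 1 ≤ d.N) (ha : d.a < 1) (hc : d.c ≠ 0)
    (hroot : AnalyticAt ℝ d.root 0)
    (hsq : ∀ᶠ ε in 𝓝 (0 : ℝ), d.root ε ^ 2 = CLL.S d.a d.c (CLL.lamOdd d.a d.c ε)) :
    (∀ x t : ℝ, (d.hatDelta₁ x t).det ≠ 0 ∧ (d.hatDelta₂ x t).det ≠ 0) ∧
    ∃ r : ℝ → ℝ → ℂ, d.IsRogueWave r ∧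
      ∀ x t : ℝ,
        r x t = (d.hatDelta₂ x t).det / (d.hatDelta₁ x t).det * CLL.seedR d.a d.c x t
            + 2 * Complex.I * ((d.hatDelta₃ x t).det / (d.hatDelta₁ x t).det) ∧
        -(starRingEnd ℂ) (r x t) =
          (d.hatDelta₁ x t).det / (d.hatDelta₂ x t).det * CLL.seedQ d.a d.c x t
            - 2 * Complex.I * ((d.hatDelta₄ x t).det / (d.hatDelta₂ x t).det) := by
  refine ⟨fun x t => ⟨CLL.Data.det_hatDelta₁_ne_zero ha hc hroot hsq hN x t,
    CLL.Data.det_hatDelta₂_ne_zero ha hc hroot hsq hN x t⟩, d.rogue, ⟨?_, ?_, ?_, ?_⟩,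
    fun x t => ⟨rfl, CLL.Data.neg_conj_rogue hN x t⟩⟩
  · exact CLL.Data.tendsto_breather ha hc hroot hsq hN
  · exact CLL.Data.isSolution_rogue ha hc hroot hsq hN
  · exact CLL.Data.rogue_rational ha hc hroot hsq hN
  · exact CLL.Data.tendsto_norm_rogue ha hc hroot hsq hN
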